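/- Let $X_1,X_2,\dots$ be i.i.d. integer-valued random variables with the law of $X$, let $S^x_n=x+X_1+\cdots+X_n$ for $x\in\mathbb Z$, and suppose that the walk is irreducible on $\mathbb Z$, that $EX=0$ and $EX^2=\infty$, and that $P[X\ge 2]>0$. For $x\ge 0$ put $m_\pm(x)=\int_0^x dy\int_y^\infty P[\pm X>u]\,du$ and $m=m_++m_-$. Let $$a(x)=\sum_{n=0}^\infty\big(P[S^0_n=0]-P[S^0_n=-x]\big),\qquad a^\dagger(x)=\delta_{x,0}+a(x)\qquad(x\in\mathbb Z)$$ be the potential function of the walk (the sum being the limit of the partial sums) and its modification at $0$. For $B\subset\mathbb Z$ let $\sigma^x_B=\inf\{n\ge 1: S^x_n\in B\}$, $\sigma^x_0=\sigma^x_{\{0\}}$, and let $H^x_B(y)=P[\sigma^x_B<\infty,\ S^x_{\sigma^x_B}=y]$. For positive integers $Q,R$ put $B(Q,R)=\{-Q,0,R\}$. Proposition. Suppose $m_+(x)/m(x)\to 0$ as $x\to\infty$. Then, as $Q\wedge R\to\infty$, uniformly for integers $-Q<x<R$ subject to the condition $$a^\dagger(x)\ne 0,\qquad |a(Q)-a(x+Q)|+|a(-R)-a(x-R)|=o(a^\dagger(x)),\tag{cnstr}$$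 one has $$P[\sigma^x_{\mathbb Z\setminus(-Q,R)}<\sigma^x_0]\ \sim\ a^\dagger(x)\big(1-H^0_{B(Q,R)}(0)\big)\ \sim\ a^\dagger(x)\,\frac{a(Q+R)}{a(Q)\,a(R)}.$$ Explicitly: for every $\varepsilon>0$ there are $\delta>0$ and $N$ such that for all positive integers $Q,R$ with $Q\wedge R\ge N$ and all integers $-Q<x<R$ with $a^\dagger(x)\neq 0$ and $|a(Q)-a(x+Q)|+|a(-R)-a(x-R)|\le\delta\,|a^\dagger(x)|$, the ratio of the first to the second expression and the ratio of the second to the third expression both differ from $1$ by less than $\varepsilon$. -/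

import Mathlib

open MeasureTheory ProbabilityTheory Filter Topology

noncomputable section

namespace RandomWalk

variable {Ω : Type*} [MeasurableSpace Ω]

/-- The walk `S^x_n = x + X_1 + ⋯ + X_n`; the increments are indexed from `0`. -/
def walk (X : ℕ → Ω → ℤ) (x : ℤ) (n : ℕ) (ω : Ω) : ℤ :=
  x + ∑ k ∈ Finset.range n, X k ω

/-- The standing assumptions: `(X n)` is an i.i.d. sequence of integer-valued random variables,
the walk is irreducible on `ℤ`, `E X = 0`, `E X² = ∞`, and the walk is not right-continuous. -/
structure IsAdmissible (P : Measure Ω) (X : ℕ → Ω → ℤ) : Prop where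
  measurable : ∀ n, Measurable (X n)
  indep : iIndepFun X P
  identDistrib : ∀ n, IdentDistrib (X n) (X 0) P P
  irreducible : ∀ x y : ℤ, ∃ n : ℕ, 0 < P {ω | walk X x n ω = y}
  integrable : Integrable (fun ω => (X 0 ω : ℝ)) P
  mean_zero : ∫ ω, (X 0 ω : ℝ) ∂P = 0
  sq_infinite : ∫⁻ ω, ENNReal.ofReal ((X 0 ω : ℝ) ^ 2) ∂P = ⊤
  not_right_continuous : 0 < P {ω | 2 ≤ X 0 ω}

/-- The tail `P[Y > x]`. -/
def tail (P : Measure Ω) (Y : Ω → ℝ) (x : ℝ) : ℝ := P.real {ω | x < Y ω}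

/-- The integrated tail `∫_x^∞ P[Y > u] du`. -/
def eta (P : Measure Ω) (Y : Ω → ℝ) (x : ℝ) : ℝ := ∫ u in Set.Ioi x, tail P Y u

/-- The doubly integrated tail `∫_0^x dy ∫_y^∞ P[Y > u] du`. -/
def doubleTail (P : Measure Ω) (Y : Ω → ℝ) (x : ℝ) : ℝ := ∫ y in (0 : ℝ)..x, eta P Y y

/-- `m_+(x)`, for the increment `X = X 0`. -/
def mPlus (P : Measure Ω) (X : ℕ → Ω → ℤ) (x : ℝ) : ℝ := doubleTail P (fun ω => (X 0 ω : ℝ)) x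

/-- `m_-(x)`, for the increment `X = X 0`. -/
def mMinus (P : Measure Ω) (X : ℕ → Ω → ℤ) (x : ℝ) : ℝ := doubleTail P (fun ω => -(X 0 ω : ℝ)) x

/-- `m(x) = m_+(x) + m_-(x)`. -/
def mTotal (P : Measure Ω) (X : ℕ → Ω → ℤ) (x : ℝ) : ℝ := mPlus P X x + mMinus P X x

/-- The potential function `a(x) = ∑_{n ≥ 0} (P[S^0_n = 0] - P[S^0_n = -x])`. The series need not
converge absolutely, so its sum is the limit of the partial sums. -/
def potential (P : Measure Ω) (X : ℕ → Ω → ℤ) (x : ℤ) : ℝ :=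
  limUnder atTop fun N : ℕ =>
    ∑ n ∈ Finset.range N, (P.real {ω | walk X 0 n ω = 0} - P.real {ω | walk X 0 n ω = -x})

/-- `a†(x) = δ_{x,0} + a(x)`. -/
def potentialDagger (P : Measure Ω) (X : ℕ → Ω → ℤ) (x : ℤ) : ℝ :=
  (if x = 0 then 1 else 0) + potential P X x

/-- `σ^x_B`: the first time `n ≥ 1` with `S^x_n ∈ B`, equal to `⊤` if there is none. -/
def hitTime (X : ℕ → Ω → ℤ) (x : ℤ) (B : Set ℤ) (ω : Ω) : ℕ∞ :=
  ⨅ (n : ℕ) (_ : 1 ≤ n ∧ walk X x n ω ∈ B), (n : ℕ∞)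

/-- The hitting distribution `H^x_B(y) = P[σ^x_B < ∞, S^x_{σ_B} = y]`. -/
def hitDist (P : Measure Ω) (X : ℕ → Ω → ℤ) (x : ℤ) (B : Set ℤ) (y : ℤ) : ℝ :=
  P.real {ω | ∃ n : ℕ, hitTime X x B ω = n ∧ walk X x n ω = y}

/-- `P[σ^x_{ℤ ∖ (-Q,R)} < σ^x_0]`. -/
def escapeProb (P : Measure Ω) (X : ℕ → Ω → ℤ) (Q R : ℕ) (x : ℤ) : ℝ :=
  P.real {ω | hitTime X x (Set.Ioo (-(Q : ℤ)) (R : ℤ))ᶜ ω < hitTime X x {0} ω}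

end RandomWalk

end

/-! Write `ρ(x) = a(x) + a(-x)` and `g(x,y) = a(x) + a(-y) - a(x-y)`, the Green function of the walk
killed at `0`. The function `g(·,y)` is bounded, harmonic off `{0,y}`, zero at `0` and `ρ(y)` at
`y`. Let `κ` be the combination of `g(·,R)` and `g(·,-Q)` that equals `1` at `R` and at `-Q`.
Optional stopping makes `1 - H^x_B(0)` the one-step mean of `κ` at `x`. The one-step mean of
`g(·,R)` at `x` is `a†(x) + (a(-R) - a(x-R))`, and that of `g(·,-Q)` is `a†(x) + (a(Q) - a(x+Q))`.
Under (cnstr) both are `a†(x)(1 + o(1))`, so `1 - H^x_B(0) ~ a†(x)(1 - H^0_B(0))`. Moreover `1 -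
H^0_B(0) = ρ(Q+R)/D`, where `D = ρ(Q)ρ(R) - g(R,-Q)g(-Q,R)`.

It remains to compare leaving the window `(-Q,R)` with hitting `{-Q,R}` before `0`. Stopping `κ`
when the walk leaves the window or visits `0` shows that the difference of the two probabilities is
the mean of `1 - κ` at the exit point, on the event of escape (`escape_sub_mem`). This must be
`o(1)` times the escape probability. Above `R`, `1 - κ(z)` is at most `ρ(z-R)/ρ(R)`, and the mean of
`a(S-R)` at exit is controlled because `a(·-R)` is harmonic off `R`. Below `-Q`, at `z = -Q-w`, it
is at most `g(-w,Q)/ρ(Q)`. This is small as long as `a(-w)` is at most a large constant times `ρ(Q)`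
(`green_neg_le_of_pot_le`), and larger values of `a(z)` are rare because the mean of `a` at exit is
at most `a†(x)`. Everything is expressed through the escape probability by `a†(x) ≤ 2ρ(y)·P[escape]`
for `y = R` and `y = -Q` (`potDagger_le_escape`).

The inputs are `ρ(x) ≍ x/m(x)` and `a(-x) = o(x/m(x))` as `x → ∞`; the latter gives `a ~ ρ` on the
positive side and `D ~ ρ(Q)ρ(R)`, hence the second equivalence. The upper bound for `ρ` comes from
Fourier inversion: since `m_+` is negligible, `|1 - φ(t)| ≥ c t² m(1/t)`
(`exists_norm_one_sub_phi_ge`), and `Re 1/(1-φ(t))` is dominated by the derivative of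
`-(1/t)/m(1/t)`. The lower bound comes from the mean exit time of `(-x,x)` (`rho_ge`). The bound for
`a(-x)` rests on the fact that a walk from the negative half-line seldom makes long upward jumps
across `0` (`green_neg_le`), combined with an iterated subadditivity argument
(`eventually_pot_neg_le`).

Convergence of the series for `a` is also proved: the symmetrised sums converge by Fourier analysis,
the partial sums are therefore bounded, and any two limit points differ by a linear function that is
`o(x)`. -/

set_option linter.unusedSectionVars false

/-! ### Killed walks, exit laws and optional stopping -/

namespace RandomWalk

/-- The one-step average `E f(z + X)`, where `ξ` is the law of `X`. -/
noncomputable def avg (ξ : Measure ℤ) (f : ℤ → ℝ) (z : ℤ) : ℝ := ∫ k, f (z + k) ∂ξ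

/-- The law of the walk started at `x` at time `n`, on the event that it is in `D` at the
times `1, …, n`. -/
noncomputable def aliveLaw (ξ : Measure ℤ) (D : Set ℤ) (x : ℤ) : ℕ → Measure ℤ
  -- The starting point need not lie in `D`: hitting times only count times `≥ 1`.
  | 0 => Measure.dirac x
  | n + 1 => (aliveLaw ξ D x n ∗ ξ).restrict D

/-- The law of the position at which the walk started at `x` first is outside `D`, at a
time `≥ 1`. -/
noncomputable def exitLaw (ξ : Measure ℤ) (D : Set ℤ) (x : ℤ) : Measure ℤ :=
  Measure.sum fun n => (aliveLaw ξ D x n ∗ ξ).restrict Dᶜ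

/-- Functions on `ℤ` of at most linear growth. -/
def LinGrowth (f : ℤ → ℝ) : Prop := ∃ C : ℝ, ∀ z, |f z| ≤ C * (1 + |(z : ℝ)|)

lemma linGrowth_of_bounded {f : ℤ → ℝ} {C : ℝ} (h : ∀ z, |f z| ≤ C) : LinGrowth f := by
  refine ⟨C, fun z => (h z).trans ?_⟩
  have : 0 ≤ C := (abs_nonneg _).trans (h z)
  nlinarith [abs_nonneg (z : ℝ)]

lemma LinGrowth.add {f g : ℤ → ℝ} (hf : LinGrowth f) (hg : LinGrowth g) :
    LinGrowth (fun z => f z + g z) := by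
  obtain ⟨C, hC⟩ := hf
  obtain ⟨C', hC'⟩ := hg
  refine ⟨C + C', fun z => (abs_add_le _ _).trans ?_⟩
  linarith [hC z, hC' z]

lemma LinGrowth.const_mul {f : ℤ → ℝ} (hf : LinGrowth f) (c : ℝ) :
    LinGrowth (fun z => c * f z) := by
  obtain ⟨C, hC⟩ := hf
  refine ⟨|c| * C, fun z => ?_⟩
  rw [abs_mul, mul_assoc]
  exact mul_le_mul_of_nonneg_left (hC z) (abs_nonneg _)

lemma LinGrowth.sub {f g : ℤ → ℝ} (hf : LinGrowth f) (hg : LinGrowth g) :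
    LinGrowth (fun z => f z - g z) := by
  simpa [sub_eq_add_neg] using hf.add (hg.const_mul (-1))

lemma linGrowth_const (c : ℝ) : LinGrowth (fun _ => c) := linGrowth_of_bounded (C := |c|) (by simp)

lemma LinGrowth.translate {f : ℤ → ℝ} (hf : LinGrowth f) (y : ℤ) :
    LinGrowth (fun z => f (z + y)) := by
  obtain ⟨C, hC⟩ := hf
  have hC0 : 0 ≤ C := by have := (abs_nonneg _).trans (hC 0); simpa using this
  refine ⟨C * (1 + |(y : ℝ)|), fun z => (hC _).trans ?_⟩
  rw [mul_assoc]
  refine mul_le_mul_of_nonneg_left ?_ hC0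
  push_cast
  nlinarith [abs_add_le (z : ℝ) (y : ℝ), abs_nonneg (z : ℝ), abs_nonneg (y : ℝ),
    mul_nonneg (abs_nonneg (z : ℝ)) (abs_nonneg (y : ℝ))]

lemma LinGrowth.integrable {f : ℤ → ℝ} (hf : LinGrowth f) {ν : Measure ℤ} [IsFiniteMeasure ν]
    (hν : Integrable (fun k : ℤ => (k : ℝ)) ν) : Integrable f ν := by
  obtain ⟨C, hC⟩ := hf
  refine Integrable.mono' (((integrable_const 1).add hν.abs).const_mul C)
    (measurable_of_countable f).aestronglyMeasurable (Eventually.of_forall fun z => ?_)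
  simpa using hC z

section

variable {ξ : Measure ℤ} [IsProbabilityMeasure ξ]

instance isFiniteMeasure_aliveLaw (D : Set ℤ) (x : ℤ) (n : ℕ) :
    IsFiniteMeasure (aliveLaw ξ D x n) := by
  induction n with
  | zero => unfold aliveLaw; infer_instance
  | succ n ih => unfold aliveLaw; infer_instance

lemma aliveLaw_succ (D : Set ℤ) (x : ℤ) (n : ℕ) :
    aliveLaw ξ D x (n + 1) = (aliveLaw ξ D x n ∗ ξ).restrict D := rfl

lemma aliveLaw_zero (D : Set ℤ) (x : ℤ) : aliveLaw ξ D x 0 = Measure.dirac x := rfl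

lemma integrable_id_conv {ν : Measure ℤ} [IsFiniteMeasure ν]
    (hν : Integrable (fun k : ℤ => (k : ℝ)) ν) (hξ : Integrable (fun k : ℤ => (k : ℝ)) ξ) :
    Integrable (fun k : ℤ => (k : ℝ)) (ν ∗ ξ) := by
  rw [Measure.conv, integrable_map_measure (measurable_of_countable _).aestronglyMeasurable
    (by fun_prop)]
  have h1 : Integrable (fun p : ℤ × ℤ => (p.1 : ℝ)) (ν.prod ξ) := hν.comp_fst ξ
  have h2 : Integrable (fun p : ℤ × ℤ => (p.2 : ℝ)) (ν.prod ξ) := hξ.comp_snd ν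
  refine (h1.add h2).congr (Eventually.of_forall fun p => ?_)
  simp

lemma integral_conv_eq {ν : Measure ℤ} [IsFiniteMeasure ν]
    (hν : Integrable (fun k : ℤ => (k : ℝ)) ν) (hξ : Integrable (fun k : ℤ => (k : ℝ)) ξ)
    {f : ℤ → ℝ} (hf : LinGrowth f) : ∫ z, f z ∂(ν ∗ ξ) = ∫ z, avg ξ f z ∂ν := by
  have h := hf.integrable (integrable_id_conv hν hξ)
  rw [Measure.conv] at h ⊢
  rw [integral_map (by fun_prop) (measurable_of_countable _).aestronglyMeasurable]
  rw [integrable_map_measure (measurable_of_countable _).aestronglyMeasurable (by fun_prop)] at h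
  exact integral_prod _ h

lemma lintegral_conv_eq {ν : Measure ℤ} [IsFiniteMeasure ν] (f : ℤ → ENNReal) :
    ∫⁻ z, f z ∂(ν ∗ ξ) = ∫⁻ z, ∫⁻ k, f (z + k) ∂ξ ∂ν := by
  rw [Measure.conv, lintegral_map (measurable_of_countable f) (by fun_prop),
    lintegral_prod _ (measurable_of_countable _).aemeasurable]

lemma integrable_id_aliveLaw (hξ : Integrable (fun k : ℤ => (k : ℝ)) ξ) (D : Set ℤ) (x : ℤ)
    (n : ℕ) : Integrable (fun k : ℤ => (k : ℝ)) (aliveLaw ξ D x n) := by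
  induction n with
  | zero => exact integrable_dirac (by simp)
  | succ n ih => exact (integrable_id_conv ih hξ).restrict

lemma LinGrowth.avg (hξ : Integrable (fun k : ℤ => (k : ℝ)) ξ) {f : ℤ → ℝ} (hf : LinGrowth f) :
    LinGrowth (avg ξ f) := by
  obtain ⟨C, hC⟩ := hf
  have hC0 : 0 ≤ C := by have := (abs_nonneg _).trans (hC 0); simpa using this
  set I := ∫ k, |(k : ℝ)| ∂ξ
  have hI : 0 ≤ I := integral_nonneg fun _ => abs_nonneg _
  refine ⟨C * (1 + I), fun z => ?_⟩
  calc |RandomWalk.avg ξ f z| ≤ ∫ k : ℤ, C * ((1 + |(z : ℝ)|) + |(k : ℝ)|) ∂ξ := by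
        refine abs_integral_le_integral_abs.trans (integral_mono_of_nonneg
          (Eventually.of_forall fun _ => abs_nonneg _)
          (((integrable_const _).add hξ.abs).const_mul C) (Eventually.of_forall fun k => ?_))
        refine (hC _).trans (mul_le_mul_of_nonneg_left ?_ hC0)
        push_cast
        linarith [abs_add_le (z : ℝ) (k : ℝ)]
    _ = C * ((1 + |(z : ℝ)|) + I) := by
        rw [integral_const_mul, integral_add (integrable_const _) hξ.abs]
        simp [I]
    _ ≤ _ := by
        rw [mul_assoc]
        refine mul_le_mul_of_nonneg_left ?_ hC0
        nlinarith [abs_nonneg (z : ℝ), mul_nonneg hI (abs_nonneg (z : ℝ))]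

/-- The discrete Dynkin formula. -/
lemma sum_exit_add_alive (hξ : Integrable (fun k : ℤ => (k : ℝ)) ξ) {f : ℤ → ℝ}
    (hf : LinGrowth f) (D : Set ℤ) (x : ℤ) (N : ℕ) :
    ∑ n ∈ Finset.range N, ∫ z in Dᶜ, f z ∂(aliveLaw ξ D x n ∗ ξ) + ∫ z, f z ∂(aliveLaw ξ D x N)
      = f x + ∑ n ∈ Finset.range N, ∫ z, (avg ξ f z - f z) ∂(aliveLaw ξ D x n) := by
  induction N with
  | zero => simp [aliveLaw_zero]
  | succ N ih =>
    have hi := integrable_id_aliveLaw hξ D x N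
    have h1 : Integrable f (aliveLaw ξ D x N ∗ ξ) := hf.integrable (integrable_id_conv hi hξ)
    have h2 := integral_add_compl (s := D) .of_discrete h1
    rw [Finset.sum_range_succ, Finset.sum_range_succ, aliveLaw_succ, integral_sub
      ((hf.avg hξ).integrable hi) (hf.integrable hi), ← integral_conv_eq hi hξ hf, ← h2]
    linarith

lemma aliveLaw_ae_mem (D : Set ℤ) (x : ℤ) (n : ℕ) : ∀ᵐ z ∂(aliveLaw ξ D x (n + 1)), z ∈ D :=
  ae_restrict_mem .of_discrete

lemma exitLaw_ae_mem (D : Set ℤ) (x : ℤ) : ∀ᵐ z ∂(exitLaw ξ D x), z ∈ Dᶜ := by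
  rw [exitLaw, Measure.ae_sum_eq, Filter.eventually_iSup]
  exact fun n => ae_restrict_mem .of_discrete

lemma lintegral_exitLaw (D : Set ℤ) (x : ℤ) (f : ℤ → ENNReal) :
    ∫⁻ z, f z ∂(exitLaw ξ D x) = ∑' n, ∫⁻ z in Dᶜ, f z ∂(aliveLaw ξ D x n ∗ ξ) := by
  rw [exitLaw, lintegral_sum_measure]

/-- Dynkin's formula with nonpositive drift on `D` and nonnegative surviving mass. The bound
involves `avg ξ f x` and not `f x`, because `f` need not be superharmonic at `x`. -/
lemma sum_exit_le (hξ : Integrable (fun k : ℤ => (k : ℝ)) ξ) {f : ℤ → ℝ}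
    (hf : LinGrowth f) (hf0 : ∀ z, 0 ≤ f z) {D : Set ℤ} (hD : ∀ z ∈ D, avg ξ f z ≤ f z)
    (x : ℤ) (N : ℕ) :
    ∑ n ∈ Finset.range N, ∫ z in Dᶜ, f z ∂(aliveLaw ξ D x n ∗ ξ) ≤ avg ξ f x := by
  rcases N with _ | N
  · simpa [avg] using integral_nonneg fun k => hf0 (x + k)
  have h := sum_exit_add_alive hξ hf D x (N + 1)
  -- The time `0` term is split off: it is the only one whose law is not carried by `D`, and it
  -- turns `f x` into `avg ξ f x`.
  rw [Finset.sum_range_succ' (fun n => ∫ z, (avg ξ f z - f z) ∂(aliveLaw ξ D x n)),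
    aliveLaw_zero, integral_dirac] at h
  have : ∑ n ∈ Finset.range N, ∫ z, (avg ξ f z - f z) ∂(aliveLaw ξ D x (n + 1)) ≤ 0 := by
    refine Finset.sum_nonpos fun n _ => integral_nonpos_of_ae ?_
    filter_upwards [aliveLaw_ae_mem D x n] with z hz
    simpa using hD z hz
  have h0 : 0 ≤ ∫ z, f z ∂(aliveLaw ξ D x (N + 1)) := integral_nonneg hf0
  linarith

lemma lintegral_exitLaw_le (hξ : Integrable (fun k : ℤ => (k : ℝ)) ξ) {f : ℤ → ℝ}
    (hf : LinGrowth f) (hf0 : ∀ z, 0 ≤ f z) {D : Set ℤ} (hD : ∀ z ∈ D, avg ξ f z ≤ f z)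
    (x : ℤ) : ∫⁻ z, ENNReal.ofReal (f z) ∂(exitLaw ξ D x) ≤ ENNReal.ofReal (avg ξ f x) := by
  rw [lintegral_exitLaw]
  refine ENNReal.tsum_le_of_sum_range_le fun N => ?_
  have hI : ∀ n, Integrable f ((aliveLaw ξ D x n ∗ ξ).restrict Dᶜ) := fun n =>
    (hf.integrable (integrable_id_conv (integrable_id_aliveLaw hξ D x n) hξ)).restrict
  simp_rw [← fun n => ofReal_integral_eq_lintegral_ofReal (hI n) (Eventually.of_forall hf0)]
  rw [← ENNReal.ofReal_sum_of_nonneg fun n _ => integral_nonneg hf0]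
  exact ENNReal.ofReal_le_ofReal (sum_exit_le hξ hf hf0 hD x N)

lemma exitLaw_univ_le (hξ : Integrable (fun k : ℤ => (k : ℝ)) ξ) (D : Set ℤ) (x : ℤ) :
    exitLaw ξ D x Set.univ ≤ 1 := by
  have := lintegral_exitLaw_le hξ (f := fun _ => 1) (linGrowth_const 1) (fun _ => zero_le_one)
    (D := D) (fun z _ => by simp [avg]) x
  simpa [avg] using this

lemma isFiniteMeasure_exitLaw (hξ : Integrable (fun k : ℤ => (k : ℝ)) ξ) (D : Set ℤ) (x : ℤ) :
    IsFiniteMeasure (exitLaw ξ D x) := ⟨(exitLaw_univ_le hξ D x).trans_lt ENNReal.one_lt_top⟩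

lemma exitLaw_real_le_one (hξ : Integrable (fun k : ℤ => (k : ℝ)) ξ) (D : Set ℤ) (x : ℤ)
    (A : Set ℤ) : (exitLaw ξ D x).real A ≤ 1 :=
  ENNReal.toReal_le_of_le_ofReal zero_le_one
    (by simpa using (measure_mono (Set.subset_univ A)).trans (exitLaw_univ_le hξ D x))

/-- Nonnegative functions superharmonic on `D`: their mean over the exit law. -/
lemma integral_exitLaw_le (hξ : Integrable (fun k : ℤ => (k : ℝ)) ξ) {f : ℤ → ℝ}
    (hf : LinGrowth f) (hf0 : ∀ z, 0 ≤ f z) {D : Set ℤ} (hD : ∀ z ∈ D, avg ξ f z ≤ f z)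
    (x : ℤ) : Integrable f (exitLaw ξ D x) ∧ ∫ z, f z ∂(exitLaw ξ D x) ≤ avg ξ f x := by
  have h := lintegral_exitLaw_le hξ hf hf0 hD x
  have hI : Integrable f (exitLaw ξ D x) := by
    refine ⟨(measurable_of_countable f).aestronglyMeasurable, ?_⟩
    rw [hasFiniteIntegral_iff_ofReal (Eventually.of_forall hf0)]
    exact h.trans_lt ENNReal.ofReal_lt_top
  refine ⟨hI, ?_⟩
  rw [← ofReal_integral_eq_lintegral_ofReal hI (Eventually.of_forall hf0)] at h
  exact (ENNReal.ofReal_le_ofReal_iff (integral_nonneg fun k => hf0 _)).1 h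

/-- Bounded functions harmonic on `D`, when the walk leaves `D` almost surely. -/
lemma integral_exitLaw_eq (hξ : Integrable (fun k : ℤ => (k : ℝ)) ξ) {f : ℤ → ℝ} {C : ℝ}
    (hf : ∀ z, |f z| ≤ C) {D : Set ℤ} (hD : ∀ z ∈ D, avg ξ f z = f z) (x : ℤ)
    (hx : Tendsto (fun N => (aliveLaw ξ D x N).real Set.univ) atTop (𝓝 0)) :
    ∫ z, f z ∂(exitLaw ξ D x) = avg ξ f x := by
  have := isFiniteMeasure_exitLaw hξ D x
  have hlg := linGrowth_of_bounded hf
  have hI : Integrable f (exitLaw ξ D x) :=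
    Integrable.of_bound (measurable_of_countable f).aestronglyMeasurable C
      (Eventually.of_forall hf)
  have hs : HasSum (fun n => ∫ z in Dᶜ, f z ∂(aliveLaw ξ D x n ∗ ξ))
      (∫ z, f z ∂(exitLaw ξ D x)) := hasSum_integral_measure hI
  refine tendsto_nhds_unique hs.tendsto_sum_nat ?_
  -- Boundedness of `f` makes the contribution of the surviving walk vanish with its mass.
  have hlim : Tendsto (fun N => ∫ z, f z ∂(aliveLaw ξ D x N)) atTop (𝓝 0) := by
    refine squeeze_zero_norm (fun N => norm_integral_le_of_norm_le_const
      (Eventually.of_forall hf)) ?_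
    simpa using hx.const_mul C
  have h2 : Tendsto (fun N => avg ξ f x - ∫ z, f z ∂(aliveLaw ξ D x N)) atTop
      (𝓝 (avg ξ f x)) := by simpa using tendsto_const_nhds.sub hlim
  refine h2.congr' ?_
  filter_upwards [eventually_ge_atTop 1] with N hN
  obtain ⟨N, rfl⟩ := Nat.exists_eq_add_of_le' hN
  have h := sum_exit_add_alive hξ hlg D x (N + 1)
  rw [Finset.sum_range_succ' (fun n => ∫ z, (avg ξ f z - f z) ∂(aliveLaw ξ D x n)),
    aliveLaw_zero, integral_dirac] at h
  have : ∑ n ∈ Finset.range N, ∫ z, (avg ξ f z - f z) ∂(aliveLaw ξ D x (n + 1)) = 0 := by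
    refine Finset.sum_eq_zero fun n _ => integral_eq_zero_of_ae ?_
    filter_upwards [aliveLaw_ae_mem D x n] with z hz
    simpa [sub_eq_zero] using hD z hz
  linarith

end

end RandomWalk

/-! ### The functions `m`, `m_+`, `m_-` as means of a truncated square -/

namespace RandomWalk

/-- The integral `∫_0^y (s - u)^+ du`, for `s, y ≥ 0`. -/
noncomputable def hub (s y : ℝ) : ℝ := min s y * s - min s y ^ 2 / 2

lemma hub_of_le {s y : ℝ} (h : s ≤ y) : hub s y = s ^ 2 / 2 := by
  rw [hub, min_eq_left h]; ring

lemma hub_of_ge {s y : ℝ} (h : y ≤ s) : hub s y = y * s - y ^ 2 / 2 := by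
  rw [hub, min_eq_right h]

lemma hub_nonneg {s y : ℝ} (hs : 0 ≤ s) (hy : 0 ≤ y) : 0 ≤ hub s y := by
  rcases le_total s y with h | h
  · rw [hub_of_le h]; positivity
  · rw [hub_of_ge h]; nlinarith

lemma hub_le {s y : ℝ} (hs : 0 ≤ s) (hy : 0 ≤ y) : hub s y ≤ y * s := by
  rcases le_total s y with h | h
  · rw [hub_of_le h]; nlinarith
  · rw [hub_of_ge h]; nlinarith

lemma hub_mono {s y y' : ℝ} (h : y ≤ y') : hub s y ≤ hub s y' := by
  rcases le_total s y with h1 | h1 <;> rcases le_total s y' with h2 | h2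
  · rw [hub_of_le h1, hub_of_le h2]
  · rw [hub_of_le h1, hub_of_ge h2]; nlinarith
  · rw [hub_of_ge h1, hub_of_le h2]; nlinarith [sq_nonneg (s - y)]
  · rw [hub_of_ge h1, hub_of_ge h2]; nlinarith

/-- For `s ≥ 0`, `hub s` is concave in `y` and vanishes at `0`, so `hub s y / y` decreases. After
integration this makes `m(y)/y` decreasing. -/
lemma hub_mul_le {s y y' : ℝ} (hy : 0 ≤ y) (h : y ≤ y') :
    hub s y' * y ≤ hub s y * y' := by
  rcases le_total s y with h1 | h1
  · rw [hub_of_le h1, hub_of_le (h1.trans h)]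
    nlinarith [sq_nonneg s]
  · rcases le_total s y' with h2 | h2
    · rw [hub_of_ge h1, hub_of_le h2]
      nlinarith [mul_nonneg hy (sub_nonneg.2 h2),
        mul_nonneg hy (sub_nonneg.2 h1),
        mul_nonneg (mul_nonneg hy (sub_nonneg.2 h1)) (sub_nonneg.2 h2)]
    · rw [hub_of_ge h1, hub_of_ge h2]
      nlinarith [mul_nonneg (mul_nonneg hy (hy.trans h)) (sub_nonneg.2 h)]

lemma min_mul_le_hub {s y : ℝ} (hy : 0 ≤ y) : min s y * s ≤ 2 * hub s y := by
  rcases le_total s y with h | h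
  · rw [hub_of_le h, min_eq_left h]; nlinarith
  · rw [hub_of_ge h, min_eq_right h]; nlinarith

lemma abs_hub_add_sub_le (s y h : ℝ) : |hub s (y + h) - hub s y - h * max (s - y) 0| ≤ h ^ 2 := by
  rw [abs_le]
  rcases le_total s y with h1 | h1 <;> rcases le_total s (y + h) with h2 | h2
  · rw [hub_of_le h1, hub_of_le h2, max_eq_right (by linarith)]
    constructor <;> nlinarith
  · rw [hub_of_le h1, hub_of_ge h2, max_eq_right (by linarith)]
    constructor <;> nlinarith
  · rw [hub_of_ge h1, hub_of_le h2, max_eq_left (by linarith)]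
    constructor <;> nlinarith
  · rw [hub_of_ge h1, hub_of_ge h2, max_eq_left (by linarith)]
    constructor <;> nlinarith

/-- The pointwise form of `m(y) - y m'(y) = E[min(|X|,y)²]/2`, which gives the derivative of
`y/m(y)`. -/
lemma hub_sub_mul_max {s y : ℝ} : hub s y - y * max (s - y) 0 = min s y ^ 2 / 2 := by
  rcases le_total s y with h | h
  · rw [hub_of_le h, min_eq_left h, max_eq_right (by linarith)]; ring
  · rw [hub_of_ge h, min_eq_right h, max_eq_left (by linarith)]; ring

section

variable {ξ : Measure ℤ} [IsProbabilityMeasure ξ]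

/-- The mean of `hub (g X) y`. -/
noncomputable def hubMean (ξ : Measure ℤ) (g : ℤ → ℝ) (y : ℝ) : ℝ := ∫ k, hub (g k) y ∂ξ

/-- The function `m`. -/
noncomputable def bigM (ξ : Measure ℤ) : ℝ → ℝ := hubMean ξ fun k => |(k : ℝ)|

/-- The function `m_+`. -/
noncomputable def bigMp (ξ : Measure ℤ) : ℝ → ℝ := hubMean ξ fun k => max (k : ℝ) 0

/-- The function `m_-`. -/
noncomputable def bigMm (ξ : Measure ℤ) : ℝ → ℝ := hubMean ξ fun k => max (-(k : ℝ)) 0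

lemma integrable_of_le_abs (hξ : Integrable (fun k : ℤ => (k : ℝ)) ξ) {g : ℤ → ℝ} (C : ℝ)
    (hg : ∀ k : ℤ, |g k| ≤ C * |(k : ℝ)|) : Integrable g ξ :=
  Integrable.mono' (hξ.abs.const_mul C) (measurable_of_countable g).aestronglyMeasurable
    (Eventually.of_forall hg)

variable {g : ℤ → ℝ}

lemma integrable_hub (hξ : Integrable (fun k : ℤ => (k : ℝ)) ξ) (hg0 : ∀ k, 0 ≤ g k)
    (hg : ∀ k : ℤ, g k ≤ |(k : ℝ)|) (y : ℝ) : Integrable (fun k => hub (g k) y) ξ := by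
  rcases le_total 0 y with hy | hy
  · refine integrable_of_le_abs hξ y fun k => ?_
    rw [abs_of_nonneg (hub_nonneg (hg0 k) hy)]
    exact (hub_le (hg0 k) hy).trans (mul_le_mul_of_nonneg_left (hg k) hy)
  · simp_rw [fun k => hub_of_ge (hy.trans (hg0 k))]
    refine (Integrable.const_mul (integrable_of_le_abs hξ 1 fun k => ?_) _).sub
      (integrable_const _)
    rw [abs_of_nonneg (hg0 k), one_mul]
    exact hg k

lemma hubMean_nonneg (hg0 : ∀ k, 0 ≤ g k) {y : ℝ} (hy : 0 ≤ y) : 0 ≤ hubMean ξ g y :=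
  integral_nonneg fun k => hub_nonneg (hg0 k) hy

lemma hubMean_mono (hξ : Integrable (fun k : ℤ => (k : ℝ)) ξ) (hg0 : ∀ k, 0 ≤ g k)
    (hg : ∀ k : ℤ, g k ≤ |(k : ℝ)|) : Monotone (hubMean ξ g) := fun _ _ h =>
  integral_mono (integrable_hub hξ hg0 hg _) (integrable_hub hξ hg0 hg _) fun _ => hub_mono h

lemma hubMean_mul_le (hξ : Integrable (fun k : ℤ => (k : ℝ)) ξ) (hg0 : ∀ k, 0 ≤ g k)
    (hg : ∀ k : ℤ, g k ≤ |(k : ℝ)|) {y y' : ℝ} (hy : 0 ≤ y) (h : y ≤ y') :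
    hubMean ξ g y' * y ≤ hubMean ξ g y * y' := by
  rw [hubMean, hubMean, ← integral_mul_const, ← integral_mul_const]
  exact integral_mono ((integrable_hub hξ hg0 hg _).mul_const _)
    ((integrable_hub hξ hg0 hg _).mul_const _) fun k => hub_mul_le hy h

lemma integrable_min_mul (hξ : Integrable (fun k : ℤ => (k : ℝ)) ξ) (hg0 : ∀ k, 0 ≤ g k)
    (hg : ∀ k : ℤ, g k ≤ |(k : ℝ)|) {y : ℝ} (hy : 0 ≤ y) :
    Integrable (fun k => min (g k) y * g k) ξ := by
  refine integrable_of_le_abs hξ y fun k => ?_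
  rw [abs_of_nonneg (mul_nonneg (le_min (hg0 k) hy) (hg0 k))]
  exact mul_le_mul (min_le_right _ _) (hg k) (hg0 k) hy

lemma integral_min_mul_le (hξ : Integrable (fun k : ℤ => (k : ℝ)) ξ) (hg0 : ∀ k, 0 ≤ g k)
    (hg : ∀ k : ℤ, g k ≤ |(k : ℝ)|) {y : ℝ} (hy : 0 ≤ y) :
    ∫ k, min (g k) y * g k ∂ξ ≤ 2 * hubMean ξ g y := by
  rw [hubMean, ← integral_const_mul]
  exact integral_mono (integrable_min_mul hξ hg0 hg hy)
    ((integrable_hub hξ hg0 hg _).const_mul _) fun k => min_mul_le_hub hy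

lemma hubMean_zero (hg0 : ∀ k, 0 ≤ g k) : hubMean ξ g 0 = 0 := by
  simp [hubMean, hub_of_ge (hg0 _)]

lemma integrable_max_sub (hξ : Integrable (fun k : ℤ => (k : ℝ)) ξ) (hg0 : ∀ k, 0 ≤ g k)
    (hg : ∀ k : ℤ, g k ≤ |(k : ℝ)|) (y : ℝ) : Integrable (fun k => max (g k - y) 0) ξ := by
  have : Integrable g ξ := integrable_of_le_abs hξ 1 fun k => by
    rw [abs_of_nonneg (hg0 k), one_mul]; exact hg k
  exact (this.sub (integrable_const y)).sup (integrable_const 0)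

lemma hasDerivAt_hubMean (hξ : Integrable (fun k : ℤ => (k : ℝ)) ξ) (hg0 : ∀ k, 0 ≤ g k)
    (hg : ∀ k : ℤ, g k ≤ |(k : ℝ)|) (y : ℝ) :
    HasDerivAt (hubMean ξ g) (∫ k, max (g k - y) 0 ∂ξ) y := by
  rw [hasDerivAt_iff_isLittleO_nhds_zero]
  have hO : (fun h => hubMean ξ g (y + h) - hubMean ξ g y - h • ∫ k, max (g k - y) 0 ∂ξ)
      =O[𝓝 0] fun h : ℝ => h ^ 2 := by
    refine Asymptotics.IsBigO.of_bound 1 (Eventually.of_forall fun h => ?_)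
    have e : hubMean ξ g (y + h) - hubMean ξ g y - h • ∫ k, max (g k - y) 0 ∂ξ
        = ∫ k, (hub (g k) (y + h) - hub (g k) y - h * max (g k - y) 0) ∂ξ := by
      have i1 := integrable_hub hξ hg0 hg (y + h)
      have i2 := integrable_hub hξ hg0 hg y
      have i3 := (integrable_max_sub hξ hg0 hg y).const_mul h
      have i4 : Integrable (fun k => hub (g k) (y + h) - hub (g k) y) ξ := i1.sub i2
      rw [integral_sub i4 i3, integral_sub i1 i2, integral_const_mul]
      rfl
    rw [e, one_mul]
    refine (norm_integral_le_of_norm_le_const (C := h ^ 2) (Eventually.of_forall fun k => ?_)).trans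
      ?_
    · exact abs_hub_add_sub_le _ _ _
    · simp
  refine hO.trans_isLittleO ?_
  simpa using Asymptotics.isLittleO_pow_pow (𝕜 := ℝ) (show 1 < 2 by norm_num)

lemma hubMean_sub_mul (hξ : Integrable (fun k : ℤ => (k : ℝ)) ξ) (hg0 : ∀ k, 0 ≤ g k)
    (hg : ∀ k : ℤ, g k ≤ |(k : ℝ)|) (y : ℝ) :
    hubMean ξ g y - y * ∫ k, max (g k - y) 0 ∂ξ = ∫ k, min (g k) y ^ 2 / 2 ∂ξ := by
  rw [hubMean, ← integral_const_mul, ← integral_sub (integrable_hub hξ hg0 hg _)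
    ((integrable_max_sub hξ hg0 hg y).const_mul y)]
  simp_rw [hub_sub_mul_max]

lemma pos_nonneg (k : ℤ) : 0 ≤ max (k : ℝ) 0 := le_max_right _ _
lemma pos_le_abs (k : ℤ) : max (k : ℝ) 0 ≤ |(k : ℝ)| := max_le (le_abs_self _) (abs_nonneg _)
lemma neg_nonneg' (k : ℤ) : 0 ≤ max (-(k : ℝ)) 0 := le_max_right _ _
lemma neg_le_abs' (k : ℤ) : max (-(k : ℝ)) 0 ≤ |(k : ℝ)| := max_le (neg_le_abs _) (abs_nonneg _)

lemma bigM_eq_add (hξ : Integrable (fun k : ℤ => (k : ℝ)) ξ) {y : ℝ} (hy : 0 ≤ y) :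
    bigM ξ y = bigMp ξ y + bigMm ξ y := by
  rw [bigMp, bigMm, hubMean, hubMean, ← integral_add (integrable_hub hξ pos_nonneg pos_le_abs _)
    (integrable_hub hξ neg_nonneg' neg_le_abs' _)]
  refine integral_congr_ae (Eventually.of_forall fun k => ?_)
  have h0 : hub 0 y = 0 := by rw [hub_of_le hy]; simp
  rcases le_total 0 (k : ℝ) with h | h
  · simp [abs_of_nonneg h, max_eq_left h, max_eq_right (neg_nonpos.2 h), h0]
  · simp [abs_of_nonpos h, max_eq_right h, max_eq_left (neg_nonneg.2 h), h0]

lemma bigM_nonneg {y : ℝ} (hy : 0 ≤ y) : 0 ≤ bigM ξ y := hubMean_nonneg (fun _ => abs_nonneg _) hy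

lemma bigM_mono (hξ : Integrable (fun k : ℤ => (k : ℝ)) ξ) : Monotone (bigM ξ) :=
  hubMean_mono hξ (fun _ => abs_nonneg _) fun _ => le_rfl

lemma bigM_mul_le (hξ : Integrable (fun k : ℤ => (k : ℝ)) ξ) {y y' : ℝ} (hy : 0 ≤ y)
    (h : y ≤ y') : bigM ξ y' * y ≤ bigM ξ y * y' :=
  hubMean_mul_le hξ (fun _ => abs_nonneg _) (fun _ => le_rfl) hy h

/-- By monotone convergence `m(y)` increases to `E X²/2`, which is infinite. -/
lemma tendsto_bigM (hξ : Integrable (fun k : ℤ => (k : ℝ)) ξ)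
    (hsq : ∫⁻ k : ℤ, ENNReal.ofReal ((k : ℝ) ^ 2) ∂ξ = ⊤) : Tendsto (bigM ξ) atTop atTop := by
  refine tendsto_atTop_atTop_of_monotone (bigM_mono hξ) fun C => ?_
  by_contra! hC
  have h1 : ∀ n : ℕ, ∫⁻ k : ℤ, ENNReal.ofReal (hub |(k : ℝ)| n) ∂ξ ≤ ENNReal.ofReal C := by
    intro n
    rw [← ofReal_integral_eq_lintegral_ofReal
      (integrable_hub hξ (fun _ => abs_nonneg _) (fun _ => le_rfl) _)
      (Eventually.of_forall fun k => hub_nonneg (abs_nonneg _) (Nat.cast_nonneg n))]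
    exact ENNReal.ofReal_le_ofReal (hC n).le
  have h2 : ∫⁻ k : ℤ, ENNReal.ofReal ((k : ℝ) ^ 2) ∂ξ
      ≤ 2 * ⨆ n : ℕ, ∫⁻ k : ℤ, ENNReal.ofReal (hub |(k : ℝ)| n) ∂ξ := by
    rw [← lintegral_iSup (f := fun (n : ℕ) (k : ℤ) => ENNReal.ofReal (hub |(k : ℝ)| n))
      (fun n => measurable_of_countable _) fun n m hnm k =>
      ENNReal.ofReal_le_ofReal (hub_mono (by exact_mod_cast hnm)),
      ← lintegral_const_mul _ (measurable_of_countable _)]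
    refine lintegral_mono fun k => ?_
    obtain ⟨n, hn⟩ := exists_nat_ge |(k : ℝ)|
    refine le_trans ?_ (mul_le_mul_right (le_iSup _ n) _)
    rw [hub_of_le hn, sq_abs, ← ENNReal.ofReal_ofNat, ← ENNReal.ofReal_mul (by norm_num)]
    exact ENNReal.ofReal_le_ofReal (by linarith)
  have h3 : 2 * ⨆ n : ℕ, ∫⁻ k : ℤ, ENNReal.ofReal (hub |(k : ℝ)| n) ∂ξ
      ≤ 2 * ENNReal.ofReal C := mul_le_mul_right (iSup_le h1) _
  rw [hsq] at h2
  exact absurd (h2.trans h3) (not_le.2 (ENNReal.mul_lt_top (by simp) ENNReal.ofReal_lt_top))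

/-- Dominated convergence: `hub |X| y / y` is at most `|X|` and is `X²/(2y)` once `y ≥ |X|`. -/
lemma tendsto_bigM_div (hξ : Integrable (fun k : ℤ => (k : ℝ)) ξ) :
    Tendsto (fun y => bigM ξ y / y) atTop (𝓝 0) := by
  have h : Tendsto (fun y : ℝ => ∫ k : ℤ, hub |(k : ℝ)| y / y ∂ξ) atTop (𝓝 (∫ _ : ℤ, (0 : ℝ) ∂ξ)) := by
    refine tendsto_integral_filter_of_dominated_convergence (fun k : ℤ => |(k : ℝ)|)
      (Eventually.of_forall fun y => (measurable_of_countable _).aestronglyMeasurable) ?_ hξ.abs ?_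
    · filter_upwards [eventually_gt_atTop 0] with y hy
      refine Eventually.of_forall fun k => ?_
      rw [Real.norm_of_nonneg (div_nonneg (hub_nonneg (abs_nonneg _) hy.le) hy.le),
        div_le_iff₀ hy, mul_comm]
      exact hub_le (abs_nonneg _) hy.le
    · refine Eventually.of_forall fun k => ?_
      have : Tendsto (fun y : ℝ => |(k : ℝ)| ^ 2 / 2 / y) atTop (𝓝 0) :=
        tendsto_const_nhds.div_atTop tendsto_id
      refine this.congr' ?_
      filter_upwards [eventually_ge_atTop |(k : ℝ)|] with y hy
      rw [hub_of_le hy]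
  simpa [integral_div, bigM, hubMean] using h

/-- `E[X; X ≥ y]`. -/
noncomputable def upMean (ξ : Measure ℤ) (y : ℝ) : ℝ := ∫ k in {k : ℤ | y ≤ k}, (k : ℝ) ∂ξ

lemma mul_upMean_le (hξ : Integrable (fun k : ℤ => (k : ℝ)) ξ) {y : ℝ} (hy : 0 ≤ y) :
    y * upMean ξ y ≤ 2 * bigMp ξ y := by
  refine le_trans ?_ (integral_min_mul_le hξ pos_nonneg pos_le_abs hy)
  rw [upMean, ← integral_const_mul, ← integral_indicator .of_discrete]
  refine integral_mono ((hξ.const_mul y).indicator .of_discrete)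
    (integrable_min_mul hξ pos_nonneg pos_le_abs hy) fun k => ?_
  by_cases hk : y ≤ (k : ℝ)
  · rw [Set.indicator_of_mem (by exact hk), max_eq_left (hy.trans hk), min_eq_right hk]
  · rw [Set.indicator_of_notMem (by exact hk)]
    exact mul_nonneg (le_min (pos_nonneg k) hy) (pos_nonneg k)

lemma integral_sq_le (hξ : Integrable (fun k : ℤ => (k : ℝ)) ξ) {y : ℝ} (hy : 0 ≤ y) :
    ∫ k in {k : ℤ | 0 ≤ k ∧ (k : ℝ) ≤ y}, (k : ℝ) ^ 2 ∂ξ ≤ 2 * bigMp ξ y := by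
  refine le_trans ?_ (integral_min_mul_le hξ pos_nonneg pos_le_abs hy)
  rw [← integral_indicator .of_discrete]
  have hle : ∀ k : ℤ, Set.indicator {k : ℤ | 0 ≤ k ∧ (k : ℝ) ≤ y} (fun k : ℤ => (k : ℝ) ^ 2) k
      ≤ min (max (k : ℝ) 0) y * max (k : ℝ) 0 := by
    intro k
    by_cases hk : 0 ≤ k ∧ (k : ℝ) ≤ y
    · have h0 : (0 : ℝ) ≤ k := by exact_mod_cast hk.1
      rw [Set.indicator_of_mem (by exact hk), max_eq_left h0, min_eq_left hk.2, sq]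
    · rw [Set.indicator_of_notMem (by exact hk)]
      exact mul_nonneg (le_min (pos_nonneg k) hy) (pos_nonneg k)
  refine integral_mono_of_nonneg (Eventually.of_forall fun k => ?_)
    (integrable_min_mul hξ pos_nonneg pos_le_abs hy) (Eventually.of_forall hle)
  exact Set.indicator_nonneg (fun k _ => sq_nonneg _) k

end

end RandomWalk

/-! ### The characteristic function -/

namespace RandomWalk

/-- The law of the walk started at `0` at time `n`. -/
noncomputable def walkLaw (ξ : Measure ℤ) (n : ℕ) : Measure ℤ := aliveLaw ξ Set.univ 0 n

/-- The standing assumptions, as assumptions on the law of the increments. -/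
structure IsStepLaw (ξ : Measure ℤ) : Prop where
  integrable : Integrable (fun k : ℤ => (k : ℝ)) ξ
  mean_zero : ∫ k : ℤ, (k : ℝ) ∂ξ = 0
  sq_infinite : ∫⁻ k : ℤ, ENNReal.ofReal ((k : ℝ) ^ 2) ∂ξ = ⊤
  irreducible : ∀ y : ℤ, ∃ n : ℕ, 0 < walkLaw ξ n {y}
  small_plus : Tendsto (fun y => bigMp ξ y / bigM ξ y) atTop (𝓝 0)

/-- The characteristic function of the increments. -/
noncomputable def phi (ξ : Measure ℤ) (t : ℝ) : ℂ := ∫ k : ℤ, Complex.exp ((t * k : ℝ) * Complex.I) ∂ξ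

section

variable {ξ : Measure ℤ} [IsProbabilityMeasure ξ]

lemma walkLaw_zero : walkLaw ξ 0 = Measure.dirac 0 := rfl

lemma walkLaw_succ (n : ℕ) : walkLaw ξ (n + 1) = walkLaw ξ n ∗ ξ := by
  rw [walkLaw, aliveLaw_succ, Measure.restrict_univ]; rfl

instance isProbabilityMeasure_walkLaw (n : ℕ) : IsProbabilityMeasure (walkLaw ξ n) := by
  induction n with
  | zero => rw [walkLaw_zero]; infer_instance
  | succ n ih => rw [walkLaw_succ]; infer_instance

lemma integrable_cexp (ν : Measure ℤ) [IsFiniteMeasure ν] (t : ℝ) :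
    Integrable (fun k : ℤ => Complex.exp ((t * k : ℝ) * Complex.I)) ν :=
  Integrable.of_bound (measurable_of_countable _).aestronglyMeasurable 1
    (Eventually.of_forall fun _ => (Complex.norm_exp_ofReal_mul_I _).le)

lemma integrable_cos (ν : Measure ℤ) [IsFiniteMeasure ν] (t u : ℝ) :
    Integrable (fun k : ℤ => Real.cos (t * k - u)) ν :=
  Integrable.of_bound (measurable_of_countable _).aestronglyMeasurable 1
    (Eventually.of_forall fun _ => Real.abs_cos_le_one _)

lemma integral_cexp_walkLaw (t : ℝ) (n : ℕ) :
    ∫ k : ℤ, Complex.exp ((t * k : ℝ) * Complex.I) ∂(walkLaw ξ n) = phi ξ t ^ n := by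
  induction n with
  | zero => simp [walkLaw_zero]
  | succ n ih =>
    rw [walkLaw_succ, integral_conv (integrable_cexp _ t), pow_succ, ← ih, ← integral_mul_const]
    congr 1
    ext z
    rw [phi, ← integral_const_mul]
    congr 1
    ext k
    rw [← Complex.exp_add]
    push_cast
    ring_nf

lemma re_phi_pow_mul (t u : ℝ) (n : ℕ) :
    (phi ξ t ^ n * Complex.exp ((-u : ℝ) * Complex.I)).re
      = ∫ k : ℤ, Real.cos (t * k - u) ∂(walkLaw ξ n) := by
  rw [← integral_cexp_walkLaw, ← integral_mul_const]
  have h := integral_re (𝕜 := ℂ) ((integrable_cexp (walkLaw ξ n) t).mul_const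
    (Complex.exp ((-u : ℝ) * Complex.I)))
  refine h.symm.trans (integral_congr_ae (Eventually.of_forall fun k => ?_))
  simp only [RCLike.re_to_complex]
  rw [← Complex.exp_add, ← add_mul, ← Complex.ofReal_add, Complex.exp_ofReal_mul_I_re]
  rfl

lemma continuous_phi : Continuous (phi ξ) := by
  refine continuous_of_dominated (bound := fun _ => 1)
    (fun t => (measurable_of_countable _).aestronglyMeasurable)
    (fun t => Eventually.of_forall fun k => (Complex.norm_exp_ofReal_mul_I _).le)
    (integrable_const _) (Eventually.of_forall fun k => by fun_prop)

lemma norm_phi_le (t : ℝ) : ‖phi ξ t‖ ≤ 1 := by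
  refine (norm_integral_le_of_norm_le_const (C := 1) (Eventually.of_forall fun k =>
    (Complex.norm_exp_ofReal_mul_I _).le)).trans ?_
  simp

lemma integral_cos_int (m : ℤ) : ∫ t in (0 : ℝ)..Real.pi, Real.cos (t * m) =
    if m = 0 then Real.pi else 0 := by
  split_ifs with h
  · simp [h]
  · have hm : (m : ℝ) ≠ 0 := by exact_mod_cast h
    rw [intervalIntegral.integral_comp_mul_right (f := Real.cos) hm, integral_cos]
    simp [mul_comm Real.pi, Real.sin_int_mul_pi]

/-- Fourier inversion. -/
lemma walkLaw_real_eq (n : ℕ) (y : ℤ) : (walkLaw ξ n).real {y} =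
    (1 / Real.pi) * ∫ t in (0 : ℝ)..Real.pi,
      (phi ξ t ^ n * Complex.exp ((-(t * y) : ℝ) * Complex.I)).re := by
  simp_rw [re_phi_pow_mul]
  rw [intervalIntegral.integral_of_le Real.pi_pos.le, integral_integral_swap]
  · simp_rw [← intervalIntegral.integral_of_le Real.pi_pos.le]
    have : ∀ k : ℤ, ∫ t in (0 : ℝ)..Real.pi, Real.cos (t * k - t * y)
        = Set.indicator {y} (fun _ => Real.pi) k := by
      intro k
      have h := integral_cos_int (k - y)
      push_cast at h
      simp_rw [mul_sub] at h
      rw [h]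
      by_cases hk : k = y
      · simp [hk]
      · simp [hk, sub_eq_zero]
    simp_rw [this]
    rw [integral_indicator .of_discrete]
    simp
    field_simp
    rfl
  · refine Integrable.of_bound ?_ 1 (Eventually.of_forall fun p => Real.abs_cos_le_one _)
    refine Measurable.aestronglyMeasurable ?_
    have : Measurable fun p : ℝ × ℤ => p.1 * (p.2 : ℝ) - p.1 * y := by
      have : Measurable fun k : ℤ => (k : ℝ) := measurable_of_countable _
      fun_prop
    exact Real.measurable_cos.comp this

lemma re_one_sub_phi (t : ℝ) : (1 - phi ξ t).re = ∫ k : ℤ, (1 - Real.cos (t * k)) ∂ξ := by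
  have hi : Integrable (fun k : ℤ => Real.cos (t * k)) ξ := by simpa using integrable_cos ξ t 0
  rw [integral_sub (integrable_const _) hi, Complex.sub_re, phi]
  have h := integral_re (𝕜 := ℂ) (integrable_cexp ξ t)
  simp only [RCLike.re_to_complex, Complex.exp_ofReal_mul_I_re] at h
  rw [h]
  simp

lemma im_one_sub_phi (hξ : IsStepLaw ξ) (t : ℝ) :
    (1 - phi ξ t).im = ∫ k : ℤ, (t * k - Real.sin (t * k)) ∂ξ := by
  have hi : Integrable (fun k : ℤ => Real.sin (t * k)) ξ :=
    Integrable.of_bound (measurable_of_countable _).aestronglyMeasurable 1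
    (Eventually.of_forall fun k => Real.abs_sin_le_one _)
  rw [integral_sub (hξ.integrable.const_mul t) hi, Complex.sub_im, phi, integral_const_mul,
    hξ.mean_zero]
  have h := integral_im (𝕜 := ℂ) (integrable_cexp ξ t)
  simp only [RCLike.im_to_complex, Complex.exp_ofReal_mul_I_im] at h
  rw [h]
  simp

/-- For negative jumps the integrands of `Re(1-φ)` and `-Im(1-φ)` have the same sign, and their sum
dominates the truncated square at all scales. -/
lemma hub_le_cos_sin {v : ℝ} (hv : 0 ≤ v) :
    hub v 1 / 4 ≤ 1 - Real.cos v + (v - Real.sin v) := by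
  have hs := Real.sin_le hv
  rcases le_total v 1 with h | h
  · rw [hub_of_le h]
    have hc := Real.cos_le_one_sub_mul_cos_sq (x := v) (by
      rw [abs_of_nonneg hv]; linarith [Real.pi_gt_three])
    have hp : 1 / 8 ≤ 2 / Real.pi ^ 2 := by
      rw [div_le_div_iff₀ (by norm_num) (by positivity)]
      nlinarith [Real.pi_gt_three, Real.pi_le_four]
    nlinarith [mul_le_mul_of_nonneg_right hp (sq_nonneg v)]
  · rw [hub_of_ge h]
    have : Real.cos v + Real.sin v ≤ 3 / 2 := by
      nlinarith [Real.sin_sq_add_cos_sq v, sq_nonneg (Real.cos v - Real.sin v),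
        sq_nonneg (Real.cos v + Real.sin v - 3 / 2)]
    linarith

lemma cos_sin_ge {v : ℝ} (hv : 0 ≤ v) : -(4 * hub v 1) ≤ 1 - Real.cos v - (v - Real.sin v) := by
  have hc := Real.cos_le_one v
  rcases le_total v 1 with h | h
  · rw [hub_of_le h]
    rcases hv.eq_or_lt with rfl | hv
    · simp
    have := Real.sin_gt_sub_cube hv
    nlinarith [mul_nonneg hv.le (sq_nonneg v), mul_nonneg (sub_nonneg.2 h) (sq_nonneg v)]
  · rw [hub_of_ge h]
    linarith [Real.neg_one_le_sin v]

lemma hub_mul_left {s t : ℝ} (ht : 0 < t) : hub (t * s) 1 = t ^ 2 * hub s (1 / t) := by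
  rcases le_total (t * s) 1 with h | h
  · rw [hub_of_le h, hub_of_le (by rw [le_div_iff₀ ht]; linarith)]; ring
  · rw [hub_of_ge h, hub_of_ge (by rw [div_le_iff₀ ht]; linarith)]; field_simp

/-- The difference `Re - Im` of `1 - φ` is at most `2‖1 - φ‖`. Negative jumps contribute to it at
least a quarter of their truncated square, and positive jumps cost at most four times theirs. -/
lemma norm_one_sub_phi_ge (hξ : IsStepLaw ξ) {t : ℝ} (ht : 0 < t) :
    t ^ 2 * (bigMm ξ (1 / t) / 8 - 2 * bigMp ξ (1 / t)) ≤ ‖1 - phi ξ t‖ := by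
  have h1 := Complex.abs_re_le_norm (1 - phi ξ t)
  have h2 := Complex.abs_im_le_norm (1 - phi ξ t)
  have hi1 : Integrable (fun k : ℤ => 1 - Real.cos (t * k)) ξ :=
    (integrable_const _).sub (by simpa using integrable_cos ξ t 0)
  have hi2 : Integrable (fun k : ℤ => t * k - Real.sin (t * k)) ξ :=
    (hξ.integrable.const_mul t).sub (Integrable.of_bound
      (measurable_of_countable _).aestronglyMeasurable 1
      (Eventually.of_forall fun k => Real.abs_sin_le_one _))
  have hm := (integrable_hub hξ.integrable neg_nonneg' neg_le_abs' (1 / t)).div_const 4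
  have hp := (integrable_hub hξ.integrable pos_nonneg pos_le_abs (1 / t)).const_mul 4
  have key : t ^ 2 * (bigMm ξ (1 / t) / 4 - 4 * bigMp ξ (1 / t))
      ≤ (1 - phi ξ t).re - (1 - phi ξ t).im := by
    rw [re_one_sub_phi, im_one_sub_phi hξ, ← integral_sub hi1 hi2, bigMm, bigMp, hubMean, hubMean,
      ← integral_div, ← integral_const_mul, ← integral_sub hm hp, ← integral_const_mul]
    refine integral_mono ((hm.sub hp).const_mul _) (hi1.sub hi2) fun k => ?_
    have h0 : hub 0 (1 / t) = 0 := by rw [hub_of_le (by positivity)]; simp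
    rcases le_total 0 (k : ℝ) with h | h
    · have := cos_sin_ge (mul_nonneg ht.le h)
      rw [hub_mul_left ht] at this
      simp only [max_eq_left h, max_eq_right (neg_nonpos.2 h), h0]
      linarith
    · have := hub_le_cos_sin (mul_nonneg ht.le (neg_nonneg.2 h))
      rw [hub_mul_left ht, mul_neg, Real.cos_neg, Real.sin_neg] at this
      simp only [max_eq_left (neg_nonneg.2 h), max_eq_right h, h0]
      linarith
  have := abs_le.1 h1
  have := abs_le.1 h2
  linarith

/-- If `φ(t) = 1`, then `φ(t)^n = 1`, so every site `k` reached at time `n` has `cos(tk) = 1`.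
Irreducibility lets `k = 1` be reached, which is impossible for `0 < t ≤ π`. -/
lemma phi_ne_one (hξ : IsStepLaw ξ) {t : ℝ} (ht : 0 < t) (ht' : t ≤ Real.pi) : 1 - phi ξ t ≠ 0 := by
  intro h
  have h1 : phi ξ t = 1 := (sub_eq_zero.1 h).symm
  obtain ⟨n, hn⟩ := hξ.irreducible 1
  have h2 := re_phi_pow_mul (ξ := ξ) t 0 n
  simp only [h1, one_pow, neg_zero, Complex.ofReal_zero, zero_mul, Complex.exp_zero, mul_one,
    Complex.one_re, sub_zero] at h2
  have hi : Integrable (fun k : ℤ => Real.cos (t * k)) (walkLaw ξ n) := by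
    simpa using integrable_cos (walkLaw ξ n) t 0
  have h3 : ∫ k : ℤ, (1 - Real.cos (t * k)) ∂(walkLaw ξ n) = 0 := by
    rw [integral_sub (integrable_const _) hi, ← h2]; simp
  replace h3 := (integral_eq_zero_iff_of_nonneg (μ := walkLaw ξ n)
    (f := fun k : ℤ => 1 - Real.cos (t * k)) (fun k => by simpa using Real.cos_le_one _)
    ((integrable_const _).sub hi)).1 h3
  have h4 := (ae_iff_of_countable.1 h3) 1 hn.ne'
  have h5 : Real.cos t < Real.cos 0 := Real.cos_lt_cos_of_nonneg_of_le_pi le_rfl ht' ht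
  simp at h4 h5
  linarith

lemma bigM_pos (hξ : IsStepLaw ξ) {y : ℝ} (hy : 0 < y) : 0 < bigM ξ y := by
  obtain ⟨z, hz, hz'⟩ := ((tendsto_bigM hξ.integrable hξ.sq_infinite).eventually_gt_atTop 0
    |>.and (eventually_ge_atTop y)).exists
  have := bigM_mul_le hξ.integrable hy.le hz'
  have h2 : 0 < bigM ξ y * z := (mul_pos hz hy).trans_le this
  exact pos_of_mul_pos_left h2 (hy.trans_le hz').le

lemma eventually_bigMp_le (hξ : IsStepLaw ξ) {ε : ℝ} (hε : 0 < ε) :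
    ∃ K : ℝ, 1 ≤ K ∧ ∀ y, K ≤ y → bigMp ξ y ≤ ε * bigM ξ y := by
  obtain ⟨K, hK⟩ := eventually_atTop.1 (hξ.small_plus.eventually_lt_const hε)
  refine ⟨max K 1, le_max_right _ _, fun y hy => ?_⟩
  have h := hK y ((le_max_left _ _).trans hy)
  rw [div_lt_iff₀ (bigM_pos hξ (by linarith [le_max_right K 1]))] at h
  exact h.le

lemma exists_norm_one_sub_phi_ge (hξ : IsStepLaw ξ) : ∃ c : ℝ, 0 < c ∧ ∀ t : ℝ, 0 < t →
    t ≤ Real.pi → c * (t ^ 2 * bigM ξ (1 / t)) ≤ ‖1 - phi ξ t‖ := by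
  obtain ⟨K, hK1, hK⟩ := eventually_bigMp_le hξ (ε := 1 / 128) (by norm_num)
  have hcpt : IsCompact (Set.Icc (1 / K) Real.pi) := isCompact_Icc
  have hKpos : 0 < 1 / K := by positivity
  have hne : (Set.Icc (1 / K) Real.pi).Nonempty := by
    refine ⟨1 / K, le_rfl, ?_⟩
    have : 1 / K ≤ 1 := by rw [div_le_one (by linarith)]; exact hK1
    linarith [Real.pi_gt_three]
  have hcont : ContinuousOn (fun t => ‖1 - phi ξ t‖) (Set.Icc (1 / K) Real.pi) :=
    (continuous_const.sub continuous_phi).norm.continuousOn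
  obtain ⟨t0, ht0, hmin⟩ := hcpt.exists_isMinOn hne hcont
  set d := ‖1 - phi ξ t0‖
  have hd : 0 < d := norm_pos_iff.2 (phi_ne_one hξ (hKpos.trans_le ht0.1) ht0.2)
  set I := ∫ k : ℤ, |(k : ℝ)| ∂ξ
  have hI : 0 ≤ I := integral_nonneg fun _ => abs_nonneg _
  refine ⟨min (1 / 16) (d / (Real.pi * (I + 1))), lt_min (by norm_num)
    (div_pos hd (mul_pos Real.pi_pos (by linarith))), fun t ht htpi => ?_⟩
  have hM0 := bigM_nonneg (ξ := ξ) (y := 1 / t) (by positivity)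
  rcases le_total t (1 / K) with h | h
  · have hy : K ≤ 1 / t := by
      rw [le_div_iff₀ ht]; rw [le_div_iff₀ (by linarith)] at h; linarith
    have h1 := hK _ hy
    have h2 := norm_one_sub_phi_ge hξ ht
    have h3 := bigM_eq_add hξ.integrable (y := 1 / t) (by positivity)
    refine le_trans ?_ h2
    have : min (1 / 16) (d / (Real.pi * (I + 1))) * (t ^ 2 * bigM ξ (1 / t))
        ≤ 1 / 16 * (t ^ 2 * bigM ξ (1 / t)) :=
      mul_le_mul_of_nonneg_right (min_le_left _ _) (by positivity)
    refine this.trans ?_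
    have : bigM ξ (1 / t) / 16 ≤ bigMm ξ (1 / t) / 8 - 2 * bigMp ξ (1 / t) := by linarith
    nlinarith [mul_le_mul_of_nonneg_left this (sq_nonneg t)]
  · have h1 : d ≤ ‖1 - phi ξ t‖ := hmin ⟨h, htpi⟩
    refine le_trans ?_ h1
    have hMle : bigM ξ (1 / t) ≤ 1 / t * I := by
      rw [bigM, hubMean, ← integral_const_mul]
      exact integral_mono (integrable_hub hξ.integrable (fun _ => abs_nonneg _) (fun _ => le_rfl) _)
        (hξ.integrable.abs.const_mul _) fun k => hub_le (abs_nonneg _) (by positivity)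
    have hle : t ^ 2 * bigM ξ (1 / t) ≤ Real.pi * (I + 1) := by
      calc t ^ 2 * bigM ξ (1 / t) ≤ t ^ 2 * (1 / t * I) := by gcongr
        _ = t * I := by field_simp
        _ ≤ Real.pi * (I + 1) := by gcongr; linarith
    calc min (1 / 16) (d / (Real.pi * (I + 1))) * (t ^ 2 * bigM ξ (1 / t))
        ≤ d / (Real.pi * (I + 1)) * (Real.pi * (I + 1)) := by
          gcongr
          exact min_le_right _ _
      _ = d := div_mul_cancel₀ _ (mul_pos Real.pi_pos (by linarith)).ne'

lemma exists_two_atoms (hξ : IsStepLaw ξ) : ∃ k l : ℤ, k ≠ l ∧ ξ {k} ≠ 0 ∧ ξ {l} ≠ 0 := by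
  obtain ⟨k, hk⟩ : ∃ k : ℤ, ξ {k} ≠ 0 := by
    by_contra! h
    have : ∀ᵐ k ∂ξ, False := ae_iff_of_countable.2 fun k hk => hk (h k)
    exact absurd (Filter.eventually_false_iff_eq_bot.1 this) (ae_neBot.2 (NeZero.ne ξ)).ne
  by_contra! h
  have h1 : ∀ᵐ l ∂ξ, l = k := ae_iff_of_countable.2 fun l hl => by
    by_contra hne
    exact hl (h k l (Ne.symm hne) hk)
  have h2 := hξ.sq_infinite
  rw [lintegral_congr_ae (g := fun _ => ENNReal.ofReal ((k : ℝ) ^ 2))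
    (by filter_upwards [h1] with l hl; rw [hl])] at h2
  simp at h2

/-- If `|φ(t)| = 1`, then `tX` is constant modulo `2π`. With two atoms `k ≠ l` this forces `t(k-l) ∈
2πℤ`, a countable set of `t`. -/
lemma ae_norm_phi_lt_one (hξ : IsStepLaw ξ) : ∀ᵐ t : ℝ, ‖phi ξ t‖ < 1 := by
  obtain ⟨k, l, hkl, hk, hl⟩ := exists_two_atoms hξ
  have hkl' : (k : ℝ) - l ≠ 0 := sub_ne_zero.2 (by exact_mod_cast hkl)
  have hc : (Set.range fun m : ℤ => m * (2 * Real.pi) / ((k : ℝ) - l)).Countable :=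
    Set.countable_range _
  have h0 : ∀ᵐ t : ℝ, t ∉ Set.range fun m : ℤ => m * (2 * Real.pi) / ((k : ℝ) - l) :=
    compl_mem_ae_iff.2 (hc.measure_zero _)
  filter_upwards [h0] with t ht
  refine lt_of_le_of_ne (norm_phi_le t) fun h => ht ?_
  set θ := (phi ξ t).arg
  have h1 : phi ξ t = Complex.exp (θ * Complex.I) := by
    have := Complex.norm_mul_exp_arg_mul_I (phi ξ t)
    rw [h] at this
    simpa using this.symm
  have h2 := re_phi_pow_mul (ξ := ξ) t θ 1
  rw [pow_one, h1, ← Complex.exp_add, ← add_mul, ← Complex.ofReal_add, add_neg_cancel] at h2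
  have h3 : walkLaw ξ 1 = ξ := by rw [walkLaw_succ, walkLaw_zero, Measure.dirac_zero_conv]
  simp only [Complex.ofReal_zero, zero_mul, Complex.exp_zero, Complex.one_re, h3] at h2
  have hi := integrable_cos ξ t θ
  have h4 : ∫ k : ℤ, (1 - Real.cos (t * k - θ)) ∂ξ = 0 := by
    rw [integral_sub (integrable_const _) hi, ← h2]; simp
  replace h4 := (integral_eq_zero_iff_of_nonneg (μ := ξ)
    (f := fun k : ℤ => 1 - Real.cos (t * k - θ)) (fun k => by simpa using Real.cos_le_one _)
    ((integrable_const _).sub hi)).1 h4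
  have h5 := ae_iff_of_countable.1 h4
  have h6 : Real.cos (t * k - θ) = 1 := by have := h5 k hk; simp at this; linarith
  have h7 : Real.cos (t * l - θ) = 1 := by have := h5 l hl; simp at this; linarith
  obtain ⟨a, ha⟩ := (Real.cos_eq_one_iff _).1 h6
  obtain ⟨b, hb⟩ := (Real.cos_eq_one_iff _).1 h7
  refine ⟨a - b, ?_⟩
  simp only
  rw [div_eq_iff hkl']
  push_cast
  linarith

/-- The point probabilities of the walk tend to `0` uniformly. -/
lemma exists_walkLaw_le (hξ : IsStepLaw ξ) : ∃ s : ℕ → ℝ, Tendsto s atTop (𝓝 0) ∧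
    ∀ n y, (walkLaw ξ n).real {y} ≤ s n := by
  refine ⟨fun n => (1 / Real.pi) * ∫ t in (0 : ℝ)..Real.pi, ‖phi ξ t‖ ^ n, ?_, fun n y => ?_⟩
  · have : Tendsto (fun n : ℕ => ∫ t in (0 : ℝ)..Real.pi, ‖phi ξ t‖ ^ n) atTop
        (𝓝 (∫ t in (0 : ℝ)..Real.pi, (0 : ℝ))) := by
      refine intervalIntegral.tendsto_integral_filter_of_dominated_convergence (fun _ => 1)
        (Eventually.of_forall fun n => ?_) (Eventually.of_forall fun n => ?_)
        intervalIntegrable_const ?_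
      · exact (continuous_phi.norm.pow n).aestronglyMeasurable
      · refine Eventually.of_forall fun t _ => ?_
        rw [norm_pow, norm_norm]
        exact pow_le_one₀ (norm_nonneg _) (norm_phi_le t)
      · filter_upwards [ae_norm_phi_lt_one hξ] with t ht _
        exact tendsto_pow_atTop_nhds_zero_of_lt_one (norm_nonneg _) ht
    simpa using this.const_mul (1 / Real.pi)
  · rw [walkLaw_real_eq]
    refine mul_le_mul_of_nonneg_left ?_ (by positivity)
    refine intervalIntegral.integral_mono_on Real.pi_pos.le ?_ ?_ fun t _ => ?_
    · refine Continuous.intervalIntegrable ?_ _ _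
      have := continuous_phi (ξ := ξ)
      fun_prop
    · exact (continuous_phi.norm.pow n).intervalIntegrable _ _
    · refine (Complex.re_le_norm _).trans ?_
      rw [norm_mul, norm_pow, Complex.norm_exp_ofReal_mul_I, mul_one]

end

end RandomWalk

/-! ### The symmetrised potential function and its upper bound -/

namespace RandomWalk

/-- The expected number of visits to `0` of the walk started at `z` before time `N`. -/
noncomputable def visits (ξ : Measure ℤ) (N : ℕ) (z : ℤ) : ℝ :=
  ∑ n ∈ Finset.range N, (walkLaw ξ n).real {-z}

/-- The partial sums of the potential function. -/
noncomputable def potSum (ξ : Measure ℤ) (N : ℕ) (x : ℤ) : ℝ := visits ξ N 0 - visits ξ N x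

/-- The function `x / m(x)`. -/
noncomputable def ratio (ξ : Measure ℤ) (y : ℝ) : ℝ := y / bigM ξ y

/-- The Fourier form of the symmetrised potential function. -/
noncomputable def symPot (ξ : Measure ℤ) (x : ℤ) : ℝ :=
  (1 / Real.pi) * ∫ t in (0 : ℝ)..Real.pi, (2 - 2 * Real.cos (t * x)) * (1 / (1 - phi ξ t)).re

section

variable {ξ : Measure ℤ} [IsProbabilityMeasure ξ]

lemma two_sub_cos_nonneg (v : ℝ) : 0 ≤ 2 - 2 * Real.cos v := by linarith [Real.cos_le_one v]

lemma two_sub_cos_le_sq (v : ℝ) : 2 - 2 * Real.cos v ≤ v ^ 2 := by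
  linarith [Real.one_sub_sq_div_two_le_cos (x := v)]

lemma two_sub_cos_le_four (v : ℝ) : 2 - 2 * Real.cos v ≤ 4 := by linarith [Real.neg_one_le_cos v]

lemma potSum_add_neg (N : ℕ) (x : ℤ) : potSum ξ N x + potSum ξ N (-x) =
    (1 / Real.pi) * ∫ t in (0 : ℝ)..Real.pi,
      (2 - 2 * Real.cos (t * x)) * (∑ n ∈ Finset.range N, phi ξ t ^ n).re := by
  have hc := continuous_phi (ξ := ξ)
  have hi : ∀ (n : ℕ) (y : ℤ), IntervalIntegrable (fun t : ℝ =>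
      (phi ξ t ^ n * Complex.exp ((-(t * y) : ℝ) * Complex.I)).re) volume 0 Real.pi := by
    intro n y
    refine Continuous.intervalIntegrable ?_ _ _
    fun_prop
  have h1 : ∀ n : ℕ, 2 * (walkLaw ξ n).real {0} - (walkLaw ξ n).real {-x} - (walkLaw ξ n).real {x}
      = (1 / Real.pi) * ∫ t in (0 : ℝ)..Real.pi,
        (2 - 2 * Real.cos (t * x)) * (phi ξ t ^ n).re := by
    intro n
    rw [walkLaw_real_eq, walkLaw_real_eq, walkLaw_real_eq, mul_left_comm, ← mul_sub, ← mul_sub,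
      ← intervalIntegral.integral_const_mul, ← intervalIntegral.integral_sub
      ((hi n 0).const_mul 2) (hi n (-x)), ← intervalIntegral.integral_sub
      (((hi n 0).const_mul 2).sub (hi n (-x))) (hi n x)]
    congr 1
    refine intervalIntegral.integral_congr fun t _ => ?_
    simp only [Complex.mul_re, Complex.exp_ofReal_mul_I_re, Complex.exp_ofReal_mul_I_im]
    push_cast
    simp only [mul_neg, neg_neg, Real.cos_neg, Real.sin_neg, mul_zero, neg_zero, Real.cos_zero,
      Real.sin_zero]
    ring
  have h2 : potSum ξ N x + potSum ξ N (-x) = ∑ n ∈ Finset.range N,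
      (2 * (walkLaw ξ n).real {0} - (walkLaw ξ n).real {-x} - (walkLaw ξ n).real {x}) := by
    simp only [potSum, visits, Finset.sum_sub_distrib, ← Finset.mul_sum, neg_neg, neg_zero]
    ring
  rw [h2, Finset.sum_congr rfl fun n _ => h1 n, ← Finset.mul_sum,
    ← intervalIntegral.integral_finsetSum]
  · congr 1
    refine intervalIntegral.integral_congr fun t _ => ?_
    simp only [Complex.re_sum, Finset.mul_sum]
  · intro n _
    refine Continuous.intervalIntegrable ?_ _ _
    fun_prop

lemma exists_sq_mul_inv_le (hξ : IsStepLaw ξ) : ∃ C : ℝ, 0 < C ∧ ∀ t : ℝ, 0 < t → t ≤ Real.pi →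
    t ^ 2 / ‖1 - phi ξ t‖ ≤ C := by
  obtain ⟨c, hc, h⟩ := exists_norm_one_sub_phi_ge hξ
  have hM : 0 < bigM ξ (1 / Real.pi) := bigM_pos hξ (by positivity)
  refine ⟨1 / (c * bigM ξ (1 / Real.pi)), by positivity, fun t ht htpi => ?_⟩
  have hM' : bigM ξ (1 / Real.pi) ≤ bigM ξ (1 / t) :=
    bigM_mono hξ.integrable (one_div_le_one_div_of_le ht htpi)
  have hpos : 0 < ‖1 - phi ξ t‖ := norm_pos_iff.2 (phi_ne_one hξ ht htpi)
  rw [div_le_div_iff₀ hpos (by positivity), one_mul]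
  refine le_trans ?_ (h t ht htpi)
  calc t ^ 2 * (c * bigM ξ (1 / Real.pi)) = c * (t ^ 2 * bigM ξ (1 / Real.pi)) := by ring
    _ ≤ _ := by gcongr

/-- Symmetrisation produces the factor `2 - 2cos(tx) ≤ t²x²`. The geometric sums are at most
`2/‖1-φ‖` and `t²/‖1-φ‖` is bounded, so dominated convergence applies. -/
lemma tendsto_potSum_add_neg (hξ : IsStepLaw ξ) (x : ℤ) :
    Tendsto (fun N => potSum ξ N x + potSum ξ N (-x)) atTop (𝓝 (symPot ξ x)) := by
  obtain ⟨C, hC, hbd⟩ := exists_sq_mul_inv_le hξ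
  have hcont := continuous_phi (ξ := ξ)
  simp_rw [potSum_add_neg]
  refine Tendsto.const_mul _ ?_
  refine intervalIntegral.tendsto_integral_filter_of_dominated_convergence
    (fun _ => (x : ℝ) ^ 2 * (2 * C)) (Eventually.of_forall fun N => ?_)
    (Eventually.of_forall fun N => ?_) intervalIntegrable_const ?_
  · refine Continuous.aestronglyMeasurable ?_
    fun_prop
  · refine Eventually.of_forall fun t ht => ?_
    rw [Set.uIoc_of_le Real.pi_pos.le] at ht
    have hne := phi_ne_one hξ ht.1 ht.2
    have hne' : phi ξ t ≠ 1 := fun h => hne (by rw [h, sub_self])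
    have hpos : 0 < ‖1 - phi ξ t‖ := norm_pos_iff.2 hne
    have hgeom : ‖∑ n ∈ Finset.range N, phi ξ t ^ n‖ ≤ 2 / ‖1 - phi ξ t‖ := by
      rw [geom_sum_eq hne', norm_div, norm_sub_rev (phi ξ t) 1]
      gcongr
      refine (norm_sub_le _ _).trans ?_
      rw [norm_pow, norm_one]
      linarith [pow_le_one₀ (n := N) (norm_nonneg _) (norm_phi_le (ξ := ξ) t)]
    rw [norm_mul, Real.norm_of_nonneg (two_sub_cos_nonneg _)]
    calc (2 - 2 * Real.cos (t * x)) * ‖(∑ n ∈ Finset.range N, phi ξ t ^ n).re‖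
        ≤ (t * x) ^ 2 * (2 / ‖1 - phi ξ t‖) := by
          gcongr
          · exact two_sub_cos_le_sq _
          · exact (Complex.abs_re_le_norm _).trans hgeom
      _ = x ^ 2 * (2 * (t ^ 2 / ‖1 - phi ξ t‖)) := by ring
      _ ≤ _ := by gcongr; exact hbd t ht.1 ht.2
  · filter_upwards [ae_norm_phi_lt_one hξ] with t ht _
    refine Tendsto.const_mul _ ?_
    refine (Complex.continuous_re.tendsto _).comp ?_
    have := (hasSum_geometric_of_norm_lt_one ht).tendsto_sum_nat
    simpa using this

/-- Pointwise, `1 - cos v ≤ min(v²/2, 2)`. -/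
lemma re_one_sub_phi_le {t : ℝ} (ht : 0 < t) : (1 - phi ξ t).re ≤
    4 * (t ^ 2 * ∫ k : ℤ, min |(k : ℝ)| (1 / t) ^ 2 / 2 ∂ξ) := by
  rw [re_one_sub_phi, ← integral_const_mul, ← integral_const_mul]
  have hi : Integrable (fun k : ℤ => min |(k : ℝ)| (1 / t) ^ 2 / 2) ξ := by
    refine Integrable.of_bound (measurable_of_countable _).aestronglyMeasurable ((1 / t) ^ 2 / 2)
      (Eventually.of_forall fun k => ?_)
    rw [Real.norm_of_nonneg (by positivity)]
    have : 0 ≤ min |(k : ℝ)| (1 / t) := le_min (abs_nonneg _) (by positivity)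
    gcongr
    exact min_le_right _ _
  refine integral_mono ((integrable_const _).sub (by simpa using integrable_cos ξ t 0))
    ((hi.const_mul _).const_mul _) fun k => ?_
  have h1 := two_sub_cos_le_sq (t * k)
  have h2 := two_sub_cos_le_four (t * k)
  rcases le_total |(k : ℝ)| (1 / t) with h | h
  · simp only [min_eq_left h, sq_abs]
    nlinarith [sq_nonneg (t * k)]
  · simp only [min_eq_right h]
    have : 4 * (t ^ 2 * ((1 / t) ^ 2 / 2)) = 2 := by field_simp; norm_num
    linarith

/-- The derivative, up to sign, of `ratio ξ (1 / t)`. -/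
noncomputable def ratioDeriv (ξ : Measure ℤ) (t : ℝ) : ℝ :=
  (∫ k : ℤ, min |(k : ℝ)| (1 / t) ^ 2 / 2 ∂ξ) / (t ^ 2 * bigM ξ (1 / t) ^ 2)

/-- The derivative of `y/m(y)` is `(m - y m')/m²`, whose numerator is `E[min(|X|,y)²]/2`; the chain
rule at `y = 1/t` gives the factor `1/t²`. -/
lemma hasDerivAt_ratio_inv (hξ : IsStepLaw ξ) {t : ℝ} (ht : 0 < t) :
    HasDerivAt (fun t => -ratio ξ (1 / t)) (ratioDeriv ξ t) t := by
  have hM : 0 < bigM ξ (1 / t) := bigM_pos hξ (by positivity)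
  have h1 : HasDerivAt (bigM ξ) _ (1 / t) :=
    hasDerivAt_hubMean hξ.integrable (fun _ => abs_nonneg _) (fun _ => le_rfl) (1 / t)
  have h2 : HasDerivAt (fun t : ℝ => 1 / t) (-(1 / t ^ 2)) t := by
    simpa using hasDerivAt_inv ht.ne'
  have h3 := hubMean_sub_mul hξ.integrable (g := fun k : ℤ => |(k : ℝ)|)
    (fun _ => abs_nonneg _) (fun _ => le_rfl) (1 / t)
  have h4 := (h2.div (h1.comp t h2) hM.ne').neg
  refine h4.congr_deriv ?_
  rw [ratioDeriv, ← h3]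
  simp only [Function.comp]
  change _ = (bigM ξ (1 / t) - _) / _
  field_simp
  ring

lemma ratioDeriv_nonneg (t : ℝ) : 0 ≤ ratioDeriv ξ t :=
  div_nonneg (integral_nonneg fun k => by positivity) (by positivity)

lemma ratio_nonneg {y : ℝ} (hy : 0 ≤ y) : 0 ≤ ratio ξ y := div_nonneg hy (bigM_nonneg hy)

lemma ratioDeriv_le (hξ : IsStepLaw ξ) {t : ℝ} (ht : 0 < t) :
    t ^ 2 * ratioDeriv ξ t ≤ 1 / bigM ξ (1 / t) := by
  have hM : 0 < bigM ξ (1 / t) := bigM_pos hξ (by positivity)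
  have h3 := hubMean_sub_mul hξ.integrable (g := fun k : ℤ => |(k : ℝ)|)
    (fun _ => abs_nonneg _) (fun _ => le_rfl) (1 / t)
  have h4 : 0 ≤ ∫ k : ℤ, max (|(k : ℝ)| - 1 / t) 0 ∂ξ := integral_nonneg fun k => le_max_right _ _
  rw [ratioDeriv, ← h3]
  have h5 : bigM ξ (1 / t) - 1 / t * ∫ k : ℤ, max (|(k : ℝ)| - 1 / t) 0 ∂ξ ≤ bigM ξ (1 / t) := by
    have : 0 ≤ 1 / t * ∫ k : ℤ, max (|(k : ℝ)| - 1 / t) 0 ∂ξ := by positivity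
    linarith
  change t ^ 2 * ((bigM ξ (1 / t) - _) / _) ≤ _
  rw [← mul_div_assoc, mul_div_mul_left _ _ (by positivity), div_le_div_iff₀ (by positivity) hM,
    one_mul, sq]
  exact mul_le_mul_of_nonneg_right h5 hM.le

/-- In `Re(1-φ)/‖1-φ‖²` the numerator is at most a multiple of `t² E[min(|X|,1/t)²]` and the
denominator at least a multiple of `(t² m(1/t))²`. The quotient is exactly the shape of
`ratioDeriv`. -/
lemma exists_re_inv_le (hξ : IsStepLaw ξ) : ∃ C : ℝ, 0 < C ∧ ∀ t : ℝ, 0 < t → t ≤ Real.pi →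
    (1 / (1 - phi ξ t)).re ≤ C * ratioDeriv ξ t := by
  obtain ⟨c, hc, h⟩ := exists_norm_one_sub_phi_ge hξ
  refine ⟨4 / c ^ 2, by positivity, fun t ht htpi => ?_⟩
  have hM : 0 < bigM ξ (1 / t) := bigM_pos hξ (by positivity)
  have hpos : 0 < ‖1 - phi ξ t‖ := norm_pos_iff.2 (phi_ne_one hξ ht htpi)
  have h1 := re_one_sub_phi_le (ξ := ξ) ht
  have h0 : 0 ≤ (1 - phi ξ t).re := by
    rw [re_one_sub_phi]; exact integral_nonneg fun k => by simpa using Real.cos_le_one _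
  rw [one_div, Complex.inv_re, Complex.normSq_eq_norm_sq]
  calc (1 - phi ξ t).re / ‖1 - phi ξ t‖ ^ 2
      ≤ (4 * (t ^ 2 * ∫ k : ℤ, min |(k : ℝ)| (1 / t) ^ 2 / 2 ∂ξ))
        / (c * (t ^ 2 * bigM ξ (1 / t))) ^ 2 := by
        gcongr
        exact h t ht htpi
    _ = 4 / c ^ 2 * ratioDeriv ξ t := by
        rw [ratioDeriv]
        field_simp

lemma ratio_mono (hξ : IsStepLaw ξ) {y y' : ℝ} (hy : 0 ≤ y) (h : y ≤ y') :
    ratio ξ y ≤ ratio ξ y' := by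
  rcases hy.eq_or_lt with rfl | hy
  · simpa [ratio] using ratio_nonneg (ξ := ξ) h
  · rw [ratio, ratio, div_le_div_iff₀ (bigM_pos hξ hy) (bigM_pos hξ (hy.trans_le h))]
    linarith [bigM_mul_le hξ.integrable hy.le h]

lemma ratio_pos (hξ : IsStepLaw ξ) {y : ℝ} (hy : 0 < y) : 0 < ratio ξ y :=
  div_pos hy (bigM_pos hξ hy)

/-- The upper bound for the symmetrised potential function. -/
lemma exists_symPot_le (hξ : IsStepLaw ξ) : ∃ C : ℝ, 0 < C ∧ ∀ x : ℕ, 1 ≤ x →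
    symPot ξ x ≤ C * ratio ξ x := by
  obtain ⟨C, hC, hre⟩ := exists_re_inv_le hξ
  obtain ⟨C', hC', hbd⟩ := exists_sq_mul_inv_le hξ
  have hcont := continuous_phi (ξ := ξ)
  refine ⟨1 / Real.pi * (5 * C), by positivity, fun x hx => ?_⟩
  have hx' : (1 : ℝ) ≤ x := by exact_mod_cast hx
  have hx0 : (0 : ℝ) < 1 / x := by positivity
  have hxpi : 1 / (x : ℝ) ≤ Real.pi := by
    have : 1 / (x : ℝ) ≤ 1 := by rw [div_le_one (by linarith)]; exact hx'
    linarith [Real.pi_gt_three]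
  rw [symPot, mul_assoc]
  refine mul_le_mul_of_nonneg_left ?_ (by positivity)
  set F : ℝ → ℝ := fun t => (2 - 2 * Real.cos (t * x)) * (1 / (1 - phi ξ t)).re
  have hF : IntervalIntegrable F volume 0 Real.pi := by
    rw [intervalIntegrable_iff_integrableOn_Ioc_of_le Real.pi_pos.le]
    refine Integrable.mono' (g := fun _ => (x : ℝ) ^ 2 * C')
      (integrableOn_const (by simp)) ?_ ?_
    · refine Measurable.aestronglyMeasurable ?_
      have h1 : Measurable fun t : ℝ => (1 / (1 - phi ξ t)).re := by
        have : Measurable fun t : ℝ => 1 / (1 - phi ξ t) :=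
          measurable_const.div (measurable_const.sub hcont.measurable)
        exact Complex.measurable_re.comp this
      exact (by fun_prop : Measurable fun t : ℝ => 2 - 2 * Real.cos (t * x)).mul h1
    · rw [ae_restrict_iff' measurableSet_Ioc]
      refine Eventually.of_forall fun t ht => ?_
      rw [norm_mul, Real.norm_of_nonneg (two_sub_cos_nonneg _)]
      have : ‖(1 / (1 - phi ξ t)).re‖ ≤ 1 / ‖1 - phi ξ t‖ := by
        refine (Complex.abs_re_le_norm _).trans ?_
        rw [norm_div, norm_one]
      calc (2 - 2 * Real.cos (t * x)) * ‖(1 / (1 - phi ξ t)).re‖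
          ≤ (t * x) ^ 2 * (1 / ‖1 - phi ξ t‖) := by
            gcongr
            exact two_sub_cos_le_sq _
        _ = x ^ 2 * (t ^ 2 / ‖1 - phi ξ t‖) := by ring
        _ ≤ _ := by gcongr; exact hbd t ht.1 ht.2
  have hF1 : IntervalIntegrable F volume 0 (1 / x) := hF.mono_set (by
    rw [Set.uIcc_of_le hx0.le, Set.uIcc_of_le Real.pi_pos.le]; exact Set.Icc_subset_Icc_right hxpi)
  have hF2 : IntervalIntegrable F volume (1 / x) Real.pi := hF.mono_set (by
    rw [Set.uIcc_of_le hxpi, Set.uIcc_of_le Real.pi_pos.le]; exact Set.Icc_subset_Icc_left hx0.le)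
  have hsplit := intervalIntegral.integral_add_adjacent_intervals hF1 hF2
  have hMx : 0 < bigM ξ x := bigM_pos hξ (by linarith)
  -- Below `1/x`: use `2 - 2cos v ≤ v²` and `t² ratioDeriv ≤ 1/m(1/t) ≤ 1/m(x)`.
  have b1 : ∫ t in (0 : ℝ)..(1 / x), F t ≤ C * ratio ξ x := by
    have : ∫ t in (0 : ℝ)..(1 / x), F t ≤ ∫ t in (0 : ℝ)..(1 / x), (x : ℝ) ^ 2 * (C / bigM ξ x) := by
      refine intervalIntegral.integral_mono_on_of_le_Ioo hx0.le hF1 intervalIntegrable_const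
        fun t ht => ?_
      have ht0 := ht.1
      have h1 := hre t ht0 (ht.2.le.trans hxpi)
      have h2 := ratioDeriv_le hξ ht0
      have h3 : bigM ξ x ≤ bigM ξ (1 / t) := bigM_mono hξ.integrable (by
        rw [le_div_iff₀ ht0]
        have := ht.2
        rw [lt_div_iff₀ (by linarith)] at this
        linarith)
      calc F t ≤ (2 - 2 * Real.cos (t * x)) * (C * ratioDeriv ξ t) :=
            mul_le_mul_of_nonneg_left h1 (two_sub_cos_nonneg _)
        _ ≤ (t * x) ^ 2 * (C * ratioDeriv ξ t) :=
            mul_le_mul_of_nonneg_right (two_sub_cos_le_sq _)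
              (mul_nonneg hC.le (ratioDeriv_nonneg t))
        _ = x ^ 2 * (C * (t ^ 2 * ratioDeriv ξ t)) := by ring
        _ ≤ x ^ 2 * (C * (1 / bigM ξ x)) := by
            gcongr
            exact h2.trans (one_div_le_one_div_of_le hMx h3)
        _ = _ := by ring
    refine this.trans (le_of_eq ?_)
    rw [intervalIntegral.integral_const, ratio]
    simp
    field_simp
  -- Above `1/x`: bound `2 - 2cos` by `4` and integrate the derivative exactly; the boundary term at
  -- `π` has a favourable sign.
  have b2 : ∫ t in (1 / x : ℝ)..Real.pi, F t ≤ 4 * C * ratio ξ x := by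
    have hderiv : ∀ t ∈ Set.Ioo (1 / (x : ℝ)) Real.pi,
        HasDerivAt (fun t => -ratio ξ (1 / t)) (ratioDeriv ξ t) t := fun t ht =>
      hasDerivAt_ratio_inv hξ (hx0.trans ht.1)
    have hc : ContinuousOn (fun t => -ratio ξ (1 / t)) (Set.Icc (1 / (x : ℝ)) Real.pi) :=
      fun t ht => (hasDerivAt_ratio_inv hξ (hx0.trans_le ht.1)).continuousAt.continuousWithinAt
    have hint : IntervalIntegrable (ratioDeriv ξ) volume (1 / x) Real.pi := by
      rw [intervalIntegrable_iff_integrableOn_Ioc_of_le hxpi]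
      exact intervalIntegral.integrableOn_deriv_of_nonneg hc hderiv fun t _ => ratioDeriv_nonneg t
    have heq := intervalIntegral.integral_eq_sub_of_hasDerivAt_of_le hxpi hc hderiv hint
    have : ∫ t in (1 / x : ℝ)..Real.pi, F t ≤ ∫ t in (1 / x : ℝ)..Real.pi,
        4 * C * ratioDeriv ξ t := by
      refine intervalIntegral.integral_mono_on hxpi hF2 (hint.const_mul _) fun t ht => ?_
      have ht0 := hx0.trans_le ht.1
      calc F t ≤ (2 - 2 * Real.cos (t * x)) * (C * ratioDeriv ξ t) :=
            mul_le_mul_of_nonneg_left (hre t ht0 ht.2) (two_sub_cos_nonneg _)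
        _ ≤ 4 * (C * ratioDeriv ξ t) :=
            mul_le_mul_of_nonneg_right (two_sub_cos_le_four _)
              (mul_nonneg hC.le (ratioDeriv_nonneg t))
        _ = _ := by ring
    refine this.trans ?_
    rw [intervalIntegral.integral_const_mul, heq]
    refine mul_le_mul_of_nonneg_left ?_ (by positivity)
    have := ratio_nonneg (ξ := ξ) (y := 1 / Real.pi) (by positivity)
    rw [one_div_one_div]
    linarith
  change ∫ t in (0 : ℝ)..Real.pi, F t ≤ _
  linarith

end

end RandomWalk

/-! ### Bounds for the partial sums, and recurrence -/

namespace RandomWalk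

section

variable {ξ : Measure ℤ} [IsProbabilityMeasure ξ]

lemma LinGrowth.integrable_add (hξ : Integrable (fun k : ℤ => (k : ℝ)) ξ) {f : ℤ → ℝ}
    (hf : LinGrowth f) (z : ℤ) : Integrable (fun k => f (z + k)) ξ := by
  simpa only [add_comm] using (hf.translate z).integrable hξ

lemma avg_add (hξ : Integrable (fun k : ℤ => (k : ℝ)) ξ) {f g : ℤ → ℝ} (hf : LinGrowth f)
    (hg : LinGrowth g) (z : ℤ) : avg ξ (fun z => f z + g z) z = avg ξ f z + avg ξ g z :=
  integral_add (hf.integrable_add hξ z) (hg.integrable_add hξ z)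

lemma avg_sub (hξ : Integrable (fun k : ℤ => (k : ℝ)) ξ) {f g : ℤ → ℝ} (hf : LinGrowth f)
    (hg : LinGrowth g) (z : ℤ) : avg ξ (fun z => f z - g z) z = avg ξ f z - avg ξ g z :=
  integral_sub (hf.integrable_add hξ z) (hg.integrable_add hξ z)

lemma avg_const (c : ℝ) (z : ℤ) : avg ξ (fun _ => c) z = c := by simp [avg]

lemma avg_const_mul (c : ℝ) (f : ℤ → ℝ) (z : ℤ) : avg ξ (fun z => c * f z) z = c * avg ξ f z :=
  integral_const_mul _ _

lemma avg_translate (f : ℤ → ℝ) (y z : ℤ) : avg ξ (fun z => f (z + y)) z = avg ξ f (z + y) := by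
  simp only [avg, add_right_comm]

lemma walkLaw_succ_real (n : ℕ) (z : ℤ) :
    (walkLaw ξ (n + 1)).real {-z} = avg ξ (fun z => (walkLaw ξ n).real {-z}) z := by
  have hi : Integrable (Set.indicator {-z} fun _ => (1 : ℝ)) (ξ ∗ walkLaw ξ n) :=
    (integrable_const 1).indicator .of_discrete
  rw [walkLaw_succ, Measure.conv_comm, ← integral_indicator_one .of_discrete]
  refine (integral_conv hi).trans (integral_congr_ae (Eventually.of_forall fun k => ?_))
  change _ = (walkLaw ξ n).real {-(z + k)}
  rw [← integral_indicator_one .of_discrete]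
  refine integral_congr_ae (Eventually.of_forall fun s => ?_)
  have : k + s = -z ↔ s = -(z + k) := by constructor <;> intro h <;> linarith
  simp only [Set.indicator, Set.mem_singleton_iff, this]
  rfl

lemma visits_nonneg (N : ℕ) (z : ℤ) : 0 ≤ visits ξ N z :=
  Finset.sum_nonneg fun _ _ => measureReal_nonneg

lemma visits_succ_eq (N : ℕ) (z : ℤ) :
    visits ξ (N + 1) z = visits ξ N z + (walkLaw ξ N).real {-z} := Finset.sum_range_succ _ _

lemma visits_le_card (N : ℕ) (z : ℤ) : visits ξ N z ≤ N := by
  refine (Finset.sum_le_sum fun n _ => measureReal_le_one).trans ?_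
  simp

lemma linGrowth_visits (N : ℕ) : LinGrowth (visits ξ N) :=
  linGrowth_of_bounded (C := N) fun z => by
    rw [abs_of_nonneg (visits_nonneg N z)]; exact visits_le_card N z

lemma visits_succ (N : ℕ) (z : ℤ) :
    visits ξ (N + 1) z = (if z = 0 then 1 else 0) + avg ξ (visits ξ N) z := by
  unfold visits
  rw [Finset.sum_range_succ']
  have h : ∀ n, Integrable (fun k => (walkLaw ξ n).real {-(z + k)}) ξ := fun n =>
    Integrable.of_bound (measurable_of_countable _).aestronglyMeasurable 1
      (Eventually.of_forall fun k => by simp [abs_of_nonneg, measureReal_le_one])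
  have : avg ξ (fun z => ∑ n ∈ Finset.range N, (walkLaw ξ n).real {-z}) z
      = ∑ n ∈ Finset.range N, avg ξ (fun z => (walkLaw ξ n).real {-z}) z :=
    integral_finsetSum _ fun n _ => h n
  rw [this, add_comm]
  congr 1
  · rw [walkLaw_zero, measureReal_def, Measure.dirac_apply' _ .of_discrete]
    by_cases hz : z = 0 <;> simp [hz, eq_comm]
  · exact Finset.sum_congr rfl fun n _ => walkLaw_succ_real n z

lemma avg_visits (N : ℕ) (z : ℤ) : avg ξ (visits ξ N) z =
    visits ξ N z + (walkLaw ξ N).real {-z} - (if z = 0 then 1 else 0) := by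
  have h1 := visits_succ (ξ := ξ) N z
  have h2 := visits_succ_eq (ξ := ξ) N z
  linarith

/-- A walk started off `0` at best reaches `0` later, with less time left. Conditioning on the first
step turns this into an induction on `N`. -/
lemma visits_le (N : ℕ) (z : ℤ) : visits ξ N z ≤ visits ξ N 0 := by
  induction N generalizing z with
  | zero => simp [visits]
  | succ N ih =>
    by_cases hz : z = 0
    · rw [hz]
    rw [visits_succ, if_neg hz, zero_add, visits_succ_eq N 0]
    have h1 : avg ξ (visits ξ N) z ≤ ∫ _ : ℤ, visits ξ N 0 ∂ξ := by
      refine integral_mono_of_nonneg (Eventually.of_forall fun k => visits_nonneg _ _)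
        (integrable_const _) (Eventually.of_forall fun k => ih _)
    have h2 : 0 ≤ (walkLaw ξ N).real {-0} := measureReal_nonneg
    simp only [integral_const, probReal_univ, one_smul] at h1
    linarith

lemma potSum_nonneg (N : ℕ) (x : ℤ) : 0 ≤ potSum ξ N x := sub_nonneg.2 (visits_le N x)

lemma potSum_zero_right (N : ℕ) : potSum ξ N 0 = 0 := sub_self _

/-- The symmetrised sums converge, hence are bounded, and both of their summands are nonnegative. -/
lemma exists_potSum_le (hξ : IsStepLaw ξ) (x : ℤ) : ∃ K : ℝ, ∀ N, potSum ξ N x ≤ K := by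
  obtain ⟨K, hK⟩ := (tendsto_potSum_add_neg hξ x).bddAbove_range
  refine ⟨K, fun N => ?_⟩
  have : potSum ξ N x + potSum ξ N (-x) ≤ K := hK (Set.mem_range_self N)
  linarith [potSum_nonneg (ξ := ξ) N (-x)]

lemma linGrowth_potSum (N : ℕ) : LinGrowth (potSum ξ N) :=
  (linGrowth_const _).sub (linGrowth_visits N)

lemma avg_potSum (hξ : IsStepLaw ξ) (N : ℕ) (z : ℤ) : avg ξ (potSum ξ N) z =
    potSum ξ N z - (walkLaw ξ N).real {-z} + (if z = 0 then 1 else 0) := by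
  have := avg_sub hξ.integrable (linGrowth_const (visits ξ N 0)) (linGrowth_visits (ξ := ξ) N) z
  rw [avg_const, avg_visits] at this
  refine Eq.trans this ?_
  rw [potSum]
  ring

/-- A maximum principle in `N`: off `0` and `R` the difference at stage `N + 1` is the average of
the difference at stage `N`, and at these two points it reduces to a single partial sum, already
bounded. The uniformity in `N` provides the domination for passing to the limit. -/
lemma exists_abs_potSum_sub_le (hξ : IsStepLaw ξ) (R : ℤ) : ∃ K : ℝ, 0 ≤ K ∧
    ∀ N z, |potSum ξ N z - potSum ξ N (z - R)| ≤ K := by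
  obtain ⟨K1, h1⟩ := exists_potSum_le hξ R
  obtain ⟨K2, h2⟩ := exists_potSum_le hξ (-R)
  have hK1 := (potSum_nonneg (ξ := ξ) 0 R).trans (h1 0)
  have hK2 := (potSum_nonneg (ξ := ξ) 0 (-R)).trans (h2 0)
  refine ⟨max K1 K2, hK1.trans (le_max_left _ _), fun N => ?_⟩
  have base : ∀ N, ∀ z : ℤ, z = 0 ∨ z = R →
      |potSum ξ N z - potSum ξ N (z - R)| ≤ max K1 K2 := by
    rintro N z (rfl | rfl)
    · rw [potSum_zero_right, zero_sub, zero_sub, abs_neg, abs_of_nonneg (potSum_nonneg _ _)]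
      exact (h2 N).trans (le_max_right _ _)
    · rw [sub_self, potSum_zero_right, sub_zero, abs_of_nonneg (potSum_nonneg _ _)]
      exact (h1 N).trans (le_max_left _ _)
  induction N with
  | zero => intro z; simp [potSum, visits, hK1]
  | succ N ih =>
    intro z
    by_cases hz : z = 0 ∨ z = R
    · exact base _ z hz
    push Not at hz
    have hz2 : z - R ≠ 0 := sub_ne_zero.2 hz.2
    have e : potSum ξ (N + 1) z - potSum ξ (N + 1) (z - R)
        = avg ξ (fun z => potSum ξ N z - potSum ξ N (z + -R)) z := by
      rw [avg_sub hξ.integrable (linGrowth_potSum N) ((linGrowth_potSum N).translate (-R)),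
        avg_translate, avg_potSum hξ, avg_potSum hξ, ← sub_eq_add_neg, if_neg hz.1, if_neg hz2]
      simp only [potSum, visits_succ_eq]
      ring
    rw [e]
    have h3 : ∀ k, ‖potSum ξ N (z + k) - potSum ξ N (z + k + -R)‖ ≤ max K1 K2 := fun k => by
      rw [← sub_eq_add_neg]
      exact ih (z + k)
    have h4 := norm_integral_le_of_norm_le_const (μ := ξ) (Eventually.of_forall h3)
    simpa [avg] using h4

lemma abs_le_mul_abs_of_lipschitz {f : ℤ → ℝ} {K : ℝ} (h0 : f 0 = 0)
    (h : ∀ z, |f z - f (z - 1)| ≤ K) (z : ℤ) : |f z| ≤ K * |(z : ℝ)| := by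
  induction z using Int.induction_on with
  | zero => simp [h0]
  | succ n ih =>
    have h1 := h (n + 1)
    rw [add_sub_cancel_right] at h1
    have hn : (0 : ℝ) ≤ n := n.cast_nonneg
    push_cast at ih ⊢
    rw [abs_of_nonneg hn] at ih
    rw [abs_of_nonneg (by linarith : (0 : ℝ) ≤ n + 1)]
    have h2 := abs_add_le (f (n + 1) - f n) (f n)
    rw [sub_add_cancel] at h2
    linarith
  | pred n ih =>
    have h1 := h (-n)
    have hn : (0 : ℝ) ≤ n := n.cast_nonneg
    push_cast at ih ⊢
    rw [abs_neg, abs_of_nonneg hn] at ih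
    rw [abs_of_nonpos (by linarith : -(n : ℝ) - 1 ≤ 0)]
    have h2 := abs_sub (f (-n)) (f (-n) - f (-n - 1))
    rw [sub_sub_cancel] at h2
    linarith

/-- `hub |y| K` as a supremum of linear functions. -/
lemma mul_sub_le_hub {y c K : ℝ} (hc : |c| ≤ K) : y * c - c ^ 2 / 2 ≤ hub |y| K := by
  have h1 : y * c ≤ |y| * |c| := (le_abs_self _).trans (abs_mul _ _).le
  have h2 : c ^ 2 = |c| ^ 2 := (sq_abs c).symm
  rw [h2]
  have h3 := abs_nonneg c
  rcases le_total |y| K with h | h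
  · rw [hub_of_le h]; nlinarith [sq_nonneg (|y| - |c|)]
  · rw [hub_of_ge h]; nlinarith [mul_nonneg (sub_nonneg.2 hc) (sub_nonneg.2 h)]

lemma hub_eq_clamp {y K : ℝ} (hK : 0 ≤ K) :
    hub |y| K = y * max (-K) (min y K) - max (-K) (min y K) ^ 2 / 2 := by
  rcases le_total |y| K with h | h
  · have := abs_le.1 h
    rw [hub_of_le h, min_eq_left this.2, max_eq_right this.1, sq_abs]; ring
  · rw [hub_of_ge h]
    rcases le_total 0 y with h0 | h0
    · rw [abs_of_nonneg h0] at h ⊢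
      rw [min_eq_right h, max_eq_right (by linarith)]; ring
    · rw [abs_of_nonpos h0] at h ⊢
      rw [min_eq_left (by linarith), max_eq_left (by linarith)]; ring

/-- `y ↦ hub |y| K` is convex, with derivative `y` clamped to `[-K,K]`. A step `k` moves the clamped
value by at most `2 min(|k|,K)`, which bounds the second order term. -/
lemma hub_add_le {y k K : ℝ} (hK : 0 ≤ K) : hub |y + k| K ≤
    hub |y| K + k * max (-K) (min y K) + 2 * (min |k| K * |k|) := by
  set c := max (-K) (min y K) with hc
  set d := max (-K) (min (y + k) K) with hd
  have hdK : |d| ≤ K := abs_le.2 ⟨le_max_left _ _, max_le (by linarith) (min_le_right _ _)⟩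
  have hcK : |c| ≤ K := abs_le.2 ⟨le_max_left _ _, max_le (by linarith) (min_le_right _ _)⟩
  have h1 := mul_sub_le_hub (y := y) hdK
  have h2 := hub_eq_clamp (y := y + k) hK
  rw [← hd] at h2
  have h3 : |d - c| ≤ |k| := by
    refine (abs_max_sub_max_le_max _ _ _ _).trans (max_le (by simp) ?_)
    refine (abs_min_sub_min_le_max _ _ _ _).trans (max_le (by simp) (by simp))
  have h4 : |d - c| ≤ 2 * K := (abs_sub _ _).trans (by linarith)
  have h5 : k * (d - c) ≤ |k| * |d - c| := (le_abs_self _).trans (abs_mul _ _).le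
  have h6 : |d - c| ≤ 2 * min |k| K := by
    rcases le_total |k| K with h | h
    · rw [min_eq_left h]; linarith [abs_nonneg k]
    · rw [min_eq_right h]; exact h4
  nlinarith [mul_le_mul_of_nonneg_left h6 (abs_nonneg k)]

lemma linGrowth_hub {K : ℝ} (hK : 0 ≤ K) : LinGrowth (fun z : ℤ => hub |(z : ℝ)| K) :=
  ⟨K, fun z => by
    rw [abs_of_nonneg (hub_nonneg (abs_nonneg _) hK)]
    exact (hub_le (abs_nonneg _) hK).trans (by nlinarith [abs_nonneg (z : ℝ)])⟩

/-- The linear term of `hub_add_le` has mean zero, and `E[min(|X|,K)|X|] ≤ 2m(K)`. Thus the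
truncated square gains at most `4m(K)` per step on average. -/
lemma avg_hub_le (hξ : IsStepLaw ξ) {K : ℝ} (hK : 0 ≤ K) (z : ℤ) :
    avg ξ (fun z : ℤ => hub |(z : ℝ)| K) z ≤ hub |(z : ℝ)| K + 4 * bigM ξ K := by
  have hi := integrable_min_mul hξ.integrable (g := fun k : ℤ => |(k : ℝ)|)
    (fun _ => abs_nonneg _) (fun _ => le_rfl) hK
  have h1 : avg ξ (fun z : ℤ => hub |(z : ℝ)| K) z ≤ ∫ k : ℤ, (hub |(z : ℝ)| K
      + k * max (-K) (min (z : ℝ) K) + 2 * (min |(k : ℝ)| K * |(k : ℝ)|)) ∂ξ := by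
    refine integral_mono ((linGrowth_hub hK).integrable_add hξ.integrable z)
      (((integrable_const _).add (hξ.integrable.mul_const _)).add (hi.const_mul 2)) fun k => ?_
    simp only [Int.cast_add]
    exact hub_add_le hK
  have e : ∫ k : ℤ, (hub |(z : ℝ)| K + k * max (-K) (min (z : ℝ) K)
      + 2 * (min |(k : ℝ)| K * |(k : ℝ)|)) ∂ξ
      = hub |(z : ℝ)| K + 2 * ∫ k : ℤ, min |(k : ℝ)| K * |(k : ℝ)| ∂ξ := by
    have i1 : Integrable (fun k : ℤ => hub |(z : ℝ)| K + k * max (-K) (min (z : ℝ) K)) ξ :=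
      (integrable_const _).add (hξ.integrable.mul_const _)
    rw [integral_add i1 (hi.const_mul 2), integral_add (integrable_const _)
      (hξ.integrable.mul_const _), integral_mul_const, hξ.mean_zero, integral_const_mul]
    simp
  have h2 := integral_min_mul_le hξ.integrable (g := fun k : ℤ => |(k : ℝ)|)
    (fun _ => abs_nonneg _) (fun _ => le_rfl) hK
  change _ ≤ 2 * bigM ξ K at h2
  linarith

lemma tendsto_ratio (hξ : IsStepLaw ξ) : Tendsto (ratio ξ) atTop atTop := by
  have h1 : Tendsto (fun y => bigM ξ y / y) atTop (𝓝[>] 0) :=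
    tendsto_nhdsWithin_iff.2 ⟨tendsto_bigM_div hξ.integrable, by
      filter_upwards [eventually_gt_atTop 0] with y hy using div_pos (bigM_pos hξ hy) hy⟩
  refine (h1.inv_tendsto_nhdsGT_zero).congr fun y => ?_
  simp [ratio]

lemma integrable_id_walkLaw (hξ : IsStepLaw ξ) (n : ℕ) :
    Integrable (fun k : ℤ => (k : ℝ)) (walkLaw ξ n) := integrable_id_aliveLaw hξ.integrable _ _ _

lemma integral_hub_walkLaw_le (hξ : IsStepLaw ξ) {K : ℝ} (hK : 0 ≤ K) (n : ℕ) :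
    ∫ z : ℤ, hub |(z : ℝ)| K ∂(walkLaw ξ n) ≤ n * (4 * bigM ξ K) := by
  induction n with
  | zero => simp [walkLaw_zero, hub_of_le hK]
  | succ n ih =>
    have hi := integrable_id_walkLaw hξ n
    rw [walkLaw_succ, integral_conv_eq hi hξ.integrable (linGrowth_hub hK)]
    have : ∫ z : ℤ, avg ξ (fun z : ℤ => hub |(z : ℝ)| K) z ∂(walkLaw ξ n)
        ≤ ∫ z : ℤ, (hub |(z : ℝ)| K + 4 * bigM ξ K) ∂(walkLaw ξ n) :=
      integral_mono (((linGrowth_hub hK).avg hξ.integrable).integrable hi)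
        (((linGrowth_hub hK).integrable hi).add (integrable_const _)) (avg_hub_le hξ hK)
    rw [integral_add ((linGrowth_hub hK).integrable hi) (integrable_const _)] at this
    simp only [integral_const, probReal_univ, one_smul] at this
    push_cast
    linarith

/-- Markov's inequality: the truncated square is at least `K²/2` outside `(-K,K)`, and its mean at
time `n` is at most `4n m(K) ≤ K²/4`. -/
lemma half_le_walkLaw (hξ : IsStepLaw ξ) {K : ℕ} (hK : 1 ≤ K) {n : ℕ}
    (hn : n * (16 * bigM ξ K) ≤ (K : ℝ) ^ 2) :
    1 / 2 ≤ (walkLaw ξ n).real (Set.Ioo (-(K : ℤ)) K) := by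
  have hK0 : (0 : ℝ) < K := by exact_mod_cast hK
  have h1 := integral_hub_walkLaw_le hξ hK0.le n
  have hi := (linGrowth_hub hK0.le).integrable (integrable_id_walkLaw hξ n)
  have h2 := mul_meas_ge_le_integral_of_nonneg (μ := walkLaw ξ n)
    (Eventually.of_forall fun z : ℤ => hub_nonneg (abs_nonneg (z : ℝ)) hK0.le) hi ((K : ℝ) ^ 2 / 2)
  have h3 : (Set.Ioo (-(K : ℤ)) K)ᶜ ⊆ {z : ℤ | (K : ℝ) ^ 2 / 2 ≤ hub |(z : ℝ)| K} := by
    intro z hz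
    have hz' : (K : ℝ) ≤ |(z : ℝ)| := by
      by_contra! h
      have := abs_lt.1 h
      exact hz ⟨by exact_mod_cast this.1, by exact_mod_cast this.2⟩
    rw [Set.mem_ofPred_eq, hub_of_ge hz']
    nlinarith
  have h4 := (measureReal_mono h3 : (walkLaw ξ n).real _ ≤ _)
  have h5 := probReal_add_probReal_compl (μ := walkLaw ξ n)
    (s := Set.Ioo (-(K : ℤ)) K) .of_discrete
  have h6 : (K : ℝ) ^ 2 / 2 * (walkLaw ξ n).real {z : ℤ | (K : ℝ) ^ 2 / 2 ≤ hub |(z : ℝ)| K}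
      ≤ (K : ℝ) ^ 2 / 2 * (1 / 2) := h2.trans (h1.trans (by linarith))
  have h7 := le_of_mul_le_mul_left h6 (by positivity)
  linarith

lemma sum_walkLaw_le (N K : ℕ) : ∑ n ∈ Finset.range N, (walkLaw ξ n).real (Set.Ioo (-(K : ℤ)) K)
    ≤ 2 * K * visits ξ N 0 := by
  have h1 : ∀ n, (walkLaw ξ n).real (Set.Ioo (-(K : ℤ)) K)
      = ∑ z ∈ Finset.Ioo (-(K : ℤ)) K, (walkLaw ξ n).real {z} := fun n => by
    rw [sum_measureReal_singleton, Finset.coe_Ioo]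
  simp_rw [h1]
  rw [Finset.sum_comm]
  have h2 : ∀ z ∈ Finset.Ioo (-(K : ℤ)) K, ∑ n ∈ Finset.range N, (walkLaw ξ n).real {z}
      ≤ visits ξ N 0 := fun z _ => by
    have := visits_le (ξ := ξ) N (-z)
    rwa [visits, neg_neg] at this
  refine (Finset.sum_le_sum h2).trans ?_
  rw [Finset.sum_const, nsmul_eq_mul, Int.card_Ioo]
  refine mul_le_mul_of_nonneg_right ?_ (visits_nonneg _ _)
  have : ((K : ℤ) - -K - 1).toNat ≤ 2 * K := by omega
  exact_mod_cast this

/-- Up to time `N ≈ K²/(16m(K))` the walk is in `(-K,K)` with probability at least `1/2`, and each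
of these fewer than `2K` sites gets at most as many visits as `0`. So the visits to `0` are at least
of order `N/K ≈ K/m(K)`, which is unbounded. -/
lemma tendsto_visits_zero (hξ : IsStepLaw ξ) : Tendsto (fun N => visits ξ N 0) atTop atTop := by
  have hmono : Monotone fun N => visits ξ N 0 := monotone_nat_of_le_succ fun N => by
    rw [visits_succ_eq]; linarith [measureReal_nonneg (μ := walkLaw ξ N) (s := {-0})]
  refine tendsto_atTop_atTop_of_monotone hmono fun U => ?_
  obtain ⟨K, hK, hK1⟩ := (((tendsto_ratio hξ).comp tendsto_natCast_atTop_atTop).eventually_ge_atTop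
    (64 * (|U| + 1)) |>.and (eventually_ge_atTop 1)).exists
  have hK0 : (1 : ℝ) ≤ K := by exact_mod_cast hK1
  have hM := bigM_pos hξ (y := K) (by linarith)
  simp only [Function.comp, ratio] at hK
  rw [le_div_iff₀ hM] at hK
  refine ⟨⌊(K : ℝ) ^ 2 / (16 * bigM ξ K)⌋₊, ?_⟩
  set N := ⌊(K : ℝ) ^ 2 / (16 * bigM ξ K)⌋₊ with hN
  have hN1 : (N : ℝ) * (16 * bigM ξ K) ≤ (K : ℝ) ^ 2 := by
    rw [← le_div_iff₀ (by positivity)]; exact Nat.floor_le (by positivity)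
  have hN2 : (K : ℝ) ^ 2 < (N + 1) * (16 * bigM ξ K) := by
    rw [← div_lt_iff₀ (by positivity)]; exact Nat.lt_floor_add_one _
  have h1 : (N : ℝ) * (1 / 2) ≤ 2 * K * visits ξ N 0 := by
    refine le_trans ?_ (sum_walkLaw_le N K)
    rw [← nsmul_eq_mul, ← Finset.card_range N, ← Finset.sum_const]
    rw [Finset.card_range]
    refine Finset.sum_le_sum fun n hn => half_le_walkLaw hξ hK1 (le_trans ?_ hN1)
    have : (n : ℝ) ≤ N := by exact_mod_cast (Finset.mem_range.1 hn).le
    gcongr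
  by_contra! hU
  have hU' : visits ξ N 0 < |U| := hU.trans_le (le_abs_self U)
  have h2 : (N : ℝ) + 1 ≤ 4 * K * (|U| + 1) := by nlinarith [abs_nonneg U]
  nlinarith [mul_le_mul_of_nonneg_right h2 hM.le]

lemma conv_mono_left {μ ν : Measure ℤ} [IsFiniteMeasure μ] [IsFiniteMeasure ν] (h : μ ≤ ν) :
    μ ∗ ξ ≤ ν ∗ ξ := by
  refine Measure.le_iff.2 fun A hA => ?_
  rw [← lintegral_indicator_one hA, ← lintegral_indicator_one hA, lintegral_conv_eq,
    lintegral_conv_eq]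
  exact lintegral_mono' h le_rfl

lemma aliveLaw_le (D : Set ℤ) (x : ℤ) (n : ℕ) :
    aliveLaw ξ D x n ≤ Measure.dirac x ∗ walkLaw ξ n := by
  induction n with
  | zero => rw [walkLaw_zero, Measure.conv_dirac_zero, aliveLaw_zero]
  | succ n ih =>
    rw [aliveLaw_succ, walkLaw_succ, ← Measure.conv_assoc]
    exact Measure.restrict_le_self.trans (conv_mono_left ih)

lemma aliveLaw_mono {D D' : Set ℤ} (h : D ⊆ D') (x : ℤ) (n : ℕ) :
    aliveLaw ξ D x n ≤ aliveLaw ξ D' x n := by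
  induction n with
  | zero => exact le_rfl
  | succ n ih => exact Measure.restrict_mono h (conv_mono_left ih)

lemma aliveLaw_singleton_le (D : Set ℤ) (x y : ℤ) (n : ℕ) :
    aliveLaw ξ D x n {y} ≤ walkLaw ξ n {y - x} := by
  refine (aliveLaw_le D x n {y}).trans (le_of_eq ?_)
  rw [Measure.dirac_conv, Measure.map_apply (by fun_prop) .of_discrete]
  congr 1
  ext z
  simp only [Set.mem_preimage, Set.mem_singleton_iff]
  omega

/-- Each site carries mass at most `s` at time `n`, and the values of `visits ξ M (z - y)` sum to
`M` over `z`. -/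
lemma lintegral_visits_le (D : Set ℤ) (x y : ℤ) (M n : ℕ) {s : ℝ}
    (hs : ∀ z, (walkLaw ξ n).real {z} ≤ s) :
    ∫ z, visits ξ M (z - y) ∂(aliveLaw ξ D x n) ≤ s * M := by
  have hs0 : 0 ≤ s := measureReal_nonneg.trans (hs 0)
  have h0 : ∀ z, 0 ≤ visits ξ M (z - y) := fun z => visits_nonneg _ _
  rw [integral_eq_lintegral_of_nonneg_ae (Eventually.of_forall h0)
    (measurable_of_countable _).aestronglyMeasurable]
  refine ENNReal.toReal_le_of_le_ofReal (by positivity) ?_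
  rw [lintegral_countable', ENNReal.ofReal_mul hs0, ENNReal.ofReal_natCast]
  have h1 : ∀ z, ENNReal.ofReal (visits ξ M (z - y)) * aliveLaw ξ D x n {z}
      ≤ ENNReal.ofReal s * ENNReal.ofReal (visits ξ M (z - y)) := fun z => by
    rw [mul_comm]
    refine mul_le_mul_left ?_ _
    refine (aliveLaw_singleton_le D x z n).trans ?_
    rw [← ENNReal.ofReal_toReal (measure_ne_top (walkLaw ξ n) {z - x})]
    exact ENNReal.ofReal_le_ofReal (hs _)
  refine (ENNReal.tsum_le_tsum h1).trans ?_
  rw [ENNReal.tsum_mul_left]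
  refine mul_le_mul_right ?_ _
  have h2 : ∀ z, ENNReal.ofReal (visits ξ M (z - y))
      = ∑ n ∈ Finset.range M, walkLaw ξ n {y - z} := fun z => by
    rw [visits, ENNReal.ofReal_sum_of_nonneg fun _ _ => measureReal_nonneg]
    refine Finset.sum_congr rfl fun n _ => ?_
    rw [neg_sub, ofReal_measureReal]
  simp_rw [h2]
  rw [Summable.tsum_finsetSum fun _ _ => ENNReal.summable]
  have h3 : ∀ n, ∑' z, walkLaw ξ n {y - z} = 1 := fun n => by
    refine ((Equiv.subLeft y).tsum_eq (fun z => walkLaw ξ n {z})).trans ?_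
    have := lintegral_countable' (μ := walkLaw ξ n) (fun _ : ℤ => (1 : ENNReal))
    simpa using this.symm
  simp [h3]

lemma sum_exit_mass (hξ : IsStepLaw ξ) (D : Set ℤ) (x : ℤ) (N : ℕ) :
    ∑ n ∈ Finset.range N, (aliveLaw ξ D x n ∗ ξ).real Dᶜ + (aliveLaw ξ D x N).real Set.univ
      = 1 := by
  have h := sum_exit_add_alive hξ.integrable (linGrowth_const 1) D x N
  simpa [avg_const] using h

/-- Recurrence: the walk leaves every proper subset of `ℤ`. -/
lemma tendsto_aliveLaw (hξ : IsStepLaw ξ) {D : Set ℤ} (hD : D ≠ Set.univ) (x : ℤ) :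
    Tendsto (fun N => (aliveLaw ξ D x N).real Set.univ) atTop (𝓝 0) := by
  obtain ⟨y, hy⟩ := (Set.ne_univ_iff_exists_notMem D).1 hD
  have hsub : D ⊆ {y}ᶜ := fun z hz h => hy (h ▸ hz)
  refine squeeze_zero (g := fun N => (aliveLaw ξ {y}ᶜ x N).real Set.univ)
    (fun _ => measureReal_nonneg) (fun N => ?_) ?_
  · exact ENNReal.toReal_mono (measure_ne_top _ _) (aliveLaw_mono hsub x N _)
  obtain ⟨s, hs, hs'⟩ := exists_walkLaw_le hξ
  obtain ⟨K, hK⟩ := exists_potSum_le hξ (x - y)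
  -- Dynkin's formula for the number of visits to `y` before time `M`: the part that has hit `y`
  -- carries the value `visits ξ M 0`, the surviving part at most `s N * M`. The only negative drift
  -- is at time `0` when `x = y`, whence the `1`.
  have key : ∀ M N : ℕ, visits ξ M 0 * (aliveLaw ξ {y}ᶜ x N).real Set.univ
      ≤ K + 1 + s N * M := by
    intro M N
    have h1 := sum_exit_mass hξ {y}ᶜ x N
    have hlg : LinGrowth fun z => visits ξ M (z + -y) := (linGrowth_visits M).translate (-y)
    have h2 := sum_exit_add_alive hξ.integrable hlg {y}ᶜ x N
    have h3 : ∀ n, ∫ z in ({y}ᶜ : Set ℤ)ᶜ, visits ξ M (z + -y) ∂(aliveLaw ξ {y}ᶜ x n ∗ ξ)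
        = visits ξ M 0 * (aliveLaw ξ {y}ᶜ x n ∗ ξ).real ({y}ᶜ : Set ℤ)ᶜ := fun n => by
      rw [compl_compl, Measure.restrict_singleton, integral_smul_measure, integral_dirac,
        add_neg_cancel, smul_eq_mul, mul_comm]
      rfl
    simp_rw [h3] at h2
    rw [← Finset.mul_sum] at h2
    have h4 : -1 ≤ ∑ n ∈ Finset.range N, ∫ z, (avg ξ (fun z => visits ξ M (z + -y)) z
        - visits ξ M (z + -y)) ∂(aliveLaw ξ {y}ᶜ x n) := by
      have e : ∀ z, avg ξ (fun z => visits ξ M (z + -y)) z - visits ξ M (z + -y)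
          = (walkLaw ξ M).real {-(z + -y)} - (if z + -y = 0 then 1 else 0) := fun z => by
        rw [avg_translate, avg_visits]; ring
      simp_rw [e]
      rcases N with _ | N
      · simp
      rw [Finset.sum_range_succ', aliveLaw_zero, integral_dirac]
      have : 0 ≤ ∑ n ∈ Finset.range N, ∫ z, ((walkLaw ξ M).real {-(z + -y)}
          - (if z + -y = 0 then 1 else 0)) ∂(aliveLaw ξ {y}ᶜ x (n + 1)) := by
        refine Finset.sum_nonneg fun n _ => integral_nonneg_of_ae ?_
        filter_upwards [aliveLaw_ae_mem {y}ᶜ x n] with z hz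
        have : z + -y ≠ 0 := fun h => hz (by simp only [Set.mem_singleton_iff]; omega)
        rw [if_neg this, sub_zero]
        exact measureReal_nonneg
      have h5 : 0 ≤ (walkLaw ξ M).real {-(x + -y)} := measureReal_nonneg
      split_ifs <;> linarith
    have h5 := lintegral_visits_le (ξ := ξ) {y}ᶜ x y M N (hs' N)
    simp_rw [← sub_eq_add_neg] at h2 h4
    have h6 := hK M
    rw [potSum] at h6
    have h7 : ∑ n ∈ Finset.range N, (aliveLaw ξ {y}ᶜ x n ∗ ξ).real ({y}ᶜ : Set ℤ)ᶜ
        = 1 - (aliveLaw ξ {y}ᶜ x N).real Set.univ := by linarith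
    rw [h7] at h2
    linarith
  rw [Metric.tendsto_atTop]
  intro ε hε
  -- `M` is fixed first, to make `visits ξ M 0` large; then `N` grows until `s N * M < 1`.
  obtain ⟨M, hM, hM0⟩ := ((tendsto_visits_zero hξ).eventually_gt_atTop (2 * (|K| + 1) / ε)
    |>.and ((tendsto_visits_zero hξ).eventually_gt_atTop 0)).exists
  have hsM : Tendsto (fun N => s N * M) atTop (𝓝 0) := by simpa using hs.mul_const (M : ℝ)
  obtain ⟨N0, hN0⟩ := eventually_atTop.1 (hsM.eventually_lt_const (show (0 : ℝ) < 1 by norm_num))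
  refine ⟨N0, fun N hN => ?_⟩
  rw [Real.dist_eq, sub_zero, abs_of_nonneg measureReal_nonneg]
  have h1 := key M N
  have h2 := hN0 N hN
  rw [div_lt_iff₀ hε] at hM
  by_contra! h
  have h3 := mul_le_mul_of_nonneg_left h hM0.le
  linarith [le_abs_self K, abs_nonneg K]

end

end RandomWalk

/-! ### Existence of the potential function; the Green function -/

namespace RandomWalk

/-- The potential function in terms of the law of the increments. -/
noncomputable def pot (ξ : Measure ℤ) (x : ℤ) : ℝ := limUnder atTop fun N => potSum ξ N x

section

variable {ξ : Measure ℤ} [IsProbabilityMeasure ξ]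

lemma exitLaw_real_univ (hξ : IsStepLaw ξ) {D : Set ℤ} (hD : D ≠ Set.univ) (x : ℤ) :
    (exitLaw ξ D x).real Set.univ = 1 := by
  have := integral_exitLaw_eq hξ.integrable (f := fun _ => 1) (C := 1) (by simp)
    (fun z _ => avg_const 1 z) x (tendsto_aliveLaw hξ hD x)
  simpa [avg_const] using this

/-- Subsequential limits of the partial sums of the potential function. -/
structure IsPotLimit (ξ : Measure ℤ) (f : ℤ → ℝ) : Prop where
  nonneg : ∀ x, 0 ≤ f x
  zero : f 0 = 0
  add_neg : ∀ x, f x + f (-x) = symPot ξ x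
  lipschitz : ∀ R : ℤ, ∃ K : ℝ, ∀ z, |f z - f (z - R)| ≤ K
  avg_eq : ∀ z, avg ξ f z = f z + if z = 0 then 1 else 0

lemma IsPotLimit.linGrowth {f : ℤ → ℝ} (hf : IsPotLimit ξ f) : LinGrowth f := by
  obtain ⟨K, hK⟩ := hf.lipschitz 1
  have hK0 : 0 ≤ K := (abs_nonneg _).trans (hK 0)
  refine ⟨K, fun z => (abs_le_mul_abs_of_lipschitz hf.zero hK z).trans ?_⟩
  nlinarith

lemma isPotLimit_of_tendsto (hξ : IsStepLaw ξ) {f : ℤ → ℝ} {ns : ℕ → ℕ}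
    (hns : Tendsto ns atTop atTop)
    (hf : ∀ x, Tendsto (fun n => potSum ξ (ns n) x) atTop (𝓝 (f x))) : IsPotLimit ξ f := by
  have hlip : ∀ R : ℤ, ∃ K : ℝ, ∀ z, |f z - f (z - R)| ≤ K := fun R => by
    obtain ⟨K, -, hK⟩ := exists_abs_potSum_sub_le hξ R
    exact ⟨K, fun z => le_of_tendsto ((hf z).sub (hf (z - R))).abs
      (Eventually.of_forall fun n => hK _ _)⟩
  refine ⟨fun x => ge_of_tendsto' (hf x) fun n => potSum_nonneg _ _,
    tendsto_nhds_unique (hf 0) (by simp [potSum_zero_right]),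
    fun x => tendsto_nhds_unique ((hf x).add (hf (-x)))
      ((tendsto_potSum_add_neg hξ x).comp hns), hlip, fun z => ?_⟩
  obtain ⟨K, hK0, hK⟩ := exists_abs_potSum_sub_le hξ 1
  obtain ⟨s, hs, hs'⟩ := exists_walkLaw_le hξ
  have hp : Tendsto (fun n => (walkLaw ξ (ns n)).real {-z}) atTop (𝓝 0) :=
    squeeze_zero (fun _ => measureReal_nonneg) (fun n => hs' (ns n) (-z)) (hs.comp hns)
  have h1 : Tendsto (fun n => avg ξ (potSum ξ (ns n)) z) atTop (𝓝 (avg ξ f z)) := by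
    refine tendsto_integral_of_dominated_convergence (fun k : ℤ => K * (|(z : ℝ)| + |(k : ℝ)|))
      (fun n => (measurable_of_countable _).aestronglyMeasurable)
      (((integrable_const _).add hξ.integrable.abs).const_mul K)
      (fun n => Eventually.of_forall fun k => ?_) (Eventually.of_forall fun k => hf (z + k))
    refine (abs_le_mul_abs_of_lipschitz (potSum_zero_right _) (hK (ns n)) (z + k)).trans ?_
    refine mul_le_mul_of_nonneg_left ?_ hK0
    push_cast
    exact abs_add_le _ _
  refine tendsto_nhds_unique h1 ?_
  simp_rw [avg_potSum hξ]
  simpa using ((hf z).sub hp).add_const (if z = 0 then (1 : ℝ) else 0)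

lemma eq_linear_of_diff {h : ℤ → ℝ} {d : ℝ} (h0 : h 0 = 0) (hd : ∀ z, h (z + 1) - h z = d)
    (z : ℤ) : h z = d * z := by
  induction z using Int.induction_on with
  | zero => simp [h0]
  | succ n ih => have := hd n; push_cast at ih ⊢; linarith
  | pred n ih =>
    have := hd (-n - 1)
    rw [sub_add_cancel] at this
    push_cast at ih ⊢
    linarith

/-- The difference of two limits is harmonic, since the defects at `0` cancel, with bounded
increments. The increments are bounded and harmonic, hence constant by recurrence, so the difference
is linear. Being at most `symPot`, which is `O(x/m(x)) = o(x)`, it vanishes. -/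
lemma IsPotLimit.unique (hξ : IsStepLaw ξ) {f g : ℤ → ℝ} (hf : IsPotLimit ξ f)
    (hg : IsPotLimit ξ g) : f = g := by
  set h : ℤ → ℝ := fun z => f z - g z with hh
  have hlg : LinGrowth h := hf.linGrowth.sub hg.linGrowth
  have hav : ∀ z, avg ξ h z = h z := fun z => by
    rw [hh, avg_sub hξ.integrable hf.linGrowth hg.linGrowth, hf.avg_eq, hg.avg_eq]; ring
  obtain ⟨K1, hK1⟩ := hf.lipschitz 1
  obtain ⟨K2, hK2⟩ := hg.lipschitz 1
  set d : ℤ → ℝ := fun z => h (z + 1) - h z with hd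
  have hdb : ∀ z, |d z| ≤ K1 + K2 := fun z => by
    have h1 := hK1 (z + 1)
    have h2 := hK2 (z + 1)
    rw [add_sub_cancel_right] at h1 h2
    calc |d z| = |(f (z + 1) - f z) - (g (z + 1) - g z)| := by simp only [hd, hh]; ring_nf
      _ ≤ _ := (abs_sub _ _).trans (add_le_add h1 h2)
  have hdav : ∀ z, avg ξ d z = d z := fun z => by
    rw [hd, avg_sub hξ.integrable (hlg.translate 1) hlg, avg_translate, hav, hav]
  have hne : ({0}ᶜ : Set ℤ) ≠ Set.univ := by simp
  have hconst : ∀ z, d z = d 0 := fun z => by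
    have h1 := integral_exitLaw_eq hξ.integrable hdb (D := {0}ᶜ) (fun z _ => hdav z) z
      (tendsto_aliveLaw hξ hne z)
    have h2 : ∫ w, d w ∂(exitLaw ξ {0}ᶜ z) = ∫ _, d 0 ∂(exitLaw ξ {0}ᶜ z) := by
      refine integral_congr_ae ?_
      filter_upwards [exitLaw_ae_mem {0}ᶜ z] with w hw
      rw [compl_compl, Set.mem_singleton_iff] at hw
      rw [hw]
    rw [h2, integral_const, exitLaw_real_univ hξ hne, one_smul, hdav] at h1
    exact h1.symm
  have hlin : ∀ z : ℤ, h z = d 0 * z :=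
    eq_linear_of_diff (by simp [hh, hf.zero, hg.zero]) hconst
  obtain ⟨C, hC, hCb⟩ := exists_symPot_le hξ
  have hbound : ∀ x : ℕ, 1 ≤ x → |d 0| ≤ C * (bigM ξ x)⁻¹ := fun x hx => by
    have hx' : (0 : ℝ) < x := by exact_mod_cast hx
    have h1 : |h x| ≤ symPot ξ x := by
      have e1 := hf.add_neg x
      have e2 := hg.add_neg x
      exact abs_le.2 ⟨by simp only [hh]; linarith [hf.nonneg x, hg.nonneg (-x)],
        by simp only [hh]; linarith [hg.nonneg x, hf.nonneg (-x)]⟩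
    have h2 := h1.trans (hCb x hx)
    rw [hlin, abs_mul, ratio, Int.cast_natCast, abs_of_pos hx', div_eq_mul_inv, mul_left_comm,
      mul_comm] at h2
    exact le_of_mul_le_mul_left h2 hx'
  have hlim : Tendsto (fun x : ℕ => C * (bigM ξ x)⁻¹) atTop (𝓝 0) := by
    have := ((tendsto_bigM hξ.integrable hξ.sq_infinite).comp
      tendsto_natCast_atTop_atTop).inv_tendsto_atTop.const_mul C
    simpa using this
  have hd0 : |d 0| ≤ 0 := ge_of_tendsto hlim (by
    filter_upwards [eventually_ge_atTop 1] with x hx using hbound x hx)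
  have hd00 : d 0 = 0 := abs_nonpos_iff.1 hd0
  funext z
  have := hlin z
  rw [hd00, zero_mul] at this
  exact sub_eq_zero.1 this

/-- Tychonoff's theorem, in a product of intervals that contain the partial sums. -/
lemma exists_subseq_limit (hξ : IsStepLaw ξ) {ns : ℕ → ℕ} (hns : Tendsto ns atTop atTop) :
    ∃ (f : ℤ → ℝ) (ms : ℕ → ℕ), IsPotLimit ξ f ∧
      ∀ x, Tendsto (fun n => potSum ξ (ns (ms n)) x) atTop (𝓝 (f x)) := by
  choose K hK using exists_potSum_le hξ
  have hcpt : IsCompact (Set.univ.pi fun x : ℤ => Set.Icc (0 : ℝ) (K x)) :=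
    isCompact_univ_pi fun x => isCompact_Icc
  obtain ⟨f, -, ms, hms, hlim⟩ := hcpt.tendsto_subseq (x := fun n => potSum ξ (ns n))
    fun n x _ => ⟨potSum_nonneg _ _, hK x _⟩
  have hlim' := tendsto_pi_nhds.1 hlim
  exact ⟨f, ms, isPotLimit_of_tendsto hξ (hns.comp hms.tendsto_atTop) hlim', hlim'⟩

lemma exists_tendsto_potSum (hξ : IsStepLaw ξ) : ∃ f : ℤ → ℝ, IsPotLimit ξ f ∧
    ∀ x, Tendsto (fun N => potSum ξ N x) atTop (𝓝 (f x)) := by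
  obtain ⟨f, -, hf, -⟩ := exists_subseq_limit hξ (ns := id) tendsto_id
  refine ⟨f, hf, fun x => tendsto_of_subseq_tendsto fun ns hns => ?_⟩
  obtain ⟨g, ms, hg, hlim⟩ := exists_subseq_limit hξ hns
  rw [hf.unique hξ hg]
  exact ⟨ms, hlim x⟩

lemma isPotLimit_pot (hξ : IsStepLaw ξ) : IsPotLimit ξ (pot ξ) := by
  obtain ⟨f, hf, hlim⟩ := exists_tendsto_potSum hξ
  have : pot ξ = f := funext fun x => (hlim x).limUnder_eq
  rwa [this]

lemma pot_nonneg (hξ : IsStepLaw ξ) (x : ℤ) : 0 ≤ pot ξ x := (isPotLimit_pot hξ).nonneg x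

lemma pot_zero (hξ : IsStepLaw ξ) : pot ξ 0 = 0 := (isPotLimit_pot hξ).zero

lemma linGrowth_pot (hξ : IsStepLaw ξ) : LinGrowth (pot ξ) := (isPotLimit_pot hξ).linGrowth

lemma avg_pot (hξ : IsStepLaw ξ) (z : ℤ) : avg ξ (pot ξ) z = pot ξ z + if z = 0 then 1 else 0 :=
  (isPotLimit_pot hξ).avg_eq z

/-- The Green function of the walk killed at `0`. -/
noncomputable def green (ξ : Measure ℤ) (x y : ℤ) : ℝ := pot ξ x + pot ξ (-y) - pot ξ (x - y)

/-- The symmetrised potential function. -/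
noncomputable def rho (ξ : Measure ℤ) (x : ℤ) : ℝ := pot ξ x + pot ξ (-x)

lemma rho_neg (x : ℤ) : rho ξ (-x) = rho ξ x := by rw [rho, rho, neg_neg, add_comm]

lemma rho_nonneg (hξ : IsStepLaw ξ) (x : ℤ) : 0 ≤ rho ξ x :=
  add_nonneg (pot_nonneg hξ _) (pot_nonneg hξ _)

lemma green_self (hξ : IsStepLaw ξ) (x : ℤ) : green ξ x x = rho ξ x := by
  rw [green, sub_self, pot_zero hξ, sub_zero, rho]

lemma green_zero (y : ℤ) : green ξ 0 y = pot ξ 0 := by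
  rw [green, zero_sub]; ring

lemma avg_green (hξ : IsStepLaw ξ) (z y : ℤ) : avg ξ (fun z => green ξ z y) z =
    green ξ z y + (if z = 0 then 1 else 0) - (if z = y then 1 else 0) := by
  have hl := linGrowth_pot hξ
  have h1 := avg_sub hξ.integrable (hl.add (linGrowth_const (pot ξ (-y)))) (hl.translate (-y)) z
  rw [avg_add hξ.integrable hl (linGrowth_const _), avg_const, avg_translate, avg_pot hξ,
    avg_pot hξ] at h1
  have e : (z + -y = 0) ↔ z = y := by constructor <;> intro h <;> omega
  simp only [e] at h1
  simp only [green, sub_eq_add_neg] at h1 ⊢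
  rw [h1]
  ring

lemma abs_green_le (hξ : IsStepLaw ξ) (y : ℤ) : ∃ C, ∀ z, |green ξ z y| ≤ C := by
  obtain ⟨K, hK⟩ := (isPotLimit_pot hξ).lipschitz y
  refine ⟨K + |pot ξ (-y)|, fun z => ?_⟩
  calc |green ξ z y| = |(pot ξ z - pot ξ (z - y)) + pot ξ (-y)| := by rw [green]; ring_nf
    _ ≤ _ := (abs_add_le _ _).trans (add_le_add (hK z) le_rfl)

/-- `green ξ · y` is bounded and harmonic off `{0,y}`, so optional stopping applies on any `D` that
avoids both points. The start may lie outside `D`, but must differ from both poles for its one-step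
mean to be its value. -/
lemma green_eq_exit (hξ : IsStepLaw ξ) {y z : ℤ} (D : Set ℤ) (hz0 : z ≠ 0) (hzy : z ≠ y)
    (h0 : 0 ∉ D) (hy : y ∉ D) : ∫ w, green ξ w y ∂(exitLaw ξ D z) = green ξ z y := by
  obtain ⟨C, hC⟩ := abs_green_le hξ y
  have hne : D ≠ Set.univ := fun h => h0 (h ▸ Set.mem_univ _)
  rw [integral_exitLaw_eq hξ.integrable hC (D := D) (fun w hw => ?_) z (tendsto_aliveLaw hξ hne z),
    avg_green hξ, if_neg hz0, if_neg hzy]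
  · ring
  · have e0 : w ≠ 0 := fun h => h0 (h ▸ hw)
    have e1 : w ≠ y := fun h => hy (h ▸ hw)
    rw [avg_green hξ, if_neg e0, if_neg e1]
    ring

/-- Stopped on `{0,y}`, the value is an average of `g(0,y) = 0` and `g(y,y) = ρ(y)`. -/
lemma green_mem_Icc (hξ : IsStepLaw ξ) (z y : ℤ) : green ξ z y ∈ Set.Icc 0 (rho ξ y) := by
  by_cases hz0 : z = 0
  · rw [hz0, green_zero, pot_zero hξ]
    exact ⟨le_rfl, rho_nonneg hξ y⟩
  by_cases hzy : z = y
  · rw [hzy, green_self hξ]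
    exact ⟨rho_nonneg hξ y, le_rfl⟩
  have h1 := green_eq_exit hξ ({0, y}ᶜ) hz0 hzy (by simp) (by simp)
  have hae : ∀ᵐ w ∂(exitLaw ξ {0, y}ᶜ z), green ξ w y ∈ Set.Icc 0 (rho ξ y) := by
    filter_upwards [exitLaw_ae_mem {0, y}ᶜ z] with w hw
    rw [compl_compl] at hw
    rcases hw with rfl | rfl
    · rw [green_zero, pot_zero hξ]
      exact ⟨le_rfl, rho_nonneg hξ y⟩
    · rw [green_self hξ]
      exact ⟨rho_nonneg hξ _, le_rfl⟩
  have hfin := isFiniteMeasure_exitLaw hξ.integrable ({0, y}ᶜ) z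
  obtain ⟨C, hC⟩ := abs_green_le hξ y
  rw [← h1]
  refine ⟨integral_nonneg_of_ae (hae.mono fun w hw => hw.1), ?_⟩
  have hne : ({0, y}ᶜ : Set ℤ) ≠ Set.univ := fun h => by
    have : (0 : ℤ) ∈ ({0, y}ᶜ : Set ℤ) := h ▸ Set.mem_univ _
    simp at this
  have h2 : ∫ w, green ξ w y ∂(exitLaw ξ {0, y}ᶜ z) ≤ ∫ _, rho ξ y ∂(exitLaw ξ {0, y}ᶜ z) :=
    integral_mono_ae (Integrable.of_bound (measurable_of_countable _).aestronglyMeasurable C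
      (Eventually.of_forall hC)) (integrable_const _) (hae.mono fun w hw => hw.2)
  rwa [integral_const, exitLaw_real_univ hξ hne, one_smul] at h2

lemma green_nonneg (hξ : IsStepLaw ξ) (z y : ℤ) : 0 ≤ green ξ z y := (green_mem_Icc hξ z y).1

lemma green_le (hξ : IsStepLaw ξ) (z y : ℤ) : green ξ z y ≤ rho ξ y := (green_mem_Icc hξ z y).2

/-- The potential function is subadditive. -/
lemma pot_add_le (hξ : IsStepLaw ξ) (x y : ℤ) : pot ξ (x + y) ≤ pot ξ x + pot ξ y := by
  have := green_nonneg hξ x (-y)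
  rw [green, neg_neg, sub_neg_eq_add] at this
  linarith

lemma green_le_left (hξ : IsStepLaw ξ) (z y : ℤ) : green ξ z y ≤ rho ξ z := by
  have := pot_add_le hξ (z - y) (-z)
  rw [show z - y + -z = -y by ring] at this
  rw [green, rho]
  linarith

lemma exists_rho_le (hξ : IsStepLaw ξ) : ∃ C : ℝ, 0 < C ∧ ∀ x : ℕ, rho ξ x ≤ C * ratio ξ x := by
  obtain ⟨C, hC, h⟩ := exists_symPot_le hξ
  refine ⟨C, hC, fun x => ?_⟩
  rcases Nat.eq_zero_or_pos x with rfl | hx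
  · simp [rho, pot_zero hξ, ratio]
  · rw [rho, (isPotLimit_pot hξ).add_neg]
    exact h x hx

end

end RandomWalk

/-! ### Lower bound for `ρ`, and the law of an upward crossing of `0` -/

namespace RandomWalk

section

variable {ξ : Measure ℤ} [IsProbabilityMeasure ξ]

/-- The Green function of `D` is bounded by the Green function of the complement of a point. -/
lemma sum_alive_singleton_le (hξ : IsStepLaw ξ) {D : Set ℤ} {x c y : ℤ} (hc : c ∉ D)
    (hx : x ≠ c) (N : ℕ) :
    ∑ n ∈ Finset.range N, (aliveLaw ξ D x n).real {y} ≤ green ξ (x - c) (y - c) := by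
  set g : ℤ → ℝ := fun z => green ξ (z + -c) (y - c) with hg
  obtain ⟨C, hC⟩ := abs_green_le hξ (y - c)
  have hlg : LinGrowth g := linGrowth_of_bounded (C := C) fun z => hC _
  have h := sum_exit_add_alive hξ.integrable hlg D x N
  have h1 : ∀ n, ∫ z, (avg ξ g z - g z) ∂(aliveLaw ξ D x n) = -(aliveLaw ξ D x n).real {y} := by
    intro n
    have hne : ∀ᵐ z ∂(aliveLaw ξ D x n), z ≠ c := by
      cases n with
      | zero =>
        rw [aliveLaw_zero, ae_dirac_iff .of_discrete]
        exact hx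
      | succ n =>
        filter_upwards [aliveLaw_ae_mem D x n] with z hz hzc
        exact hc (hzc ▸ hz)
    -- Off the pole `c`, the only drift of the Green function is `-1` at `y`, so Dynkin's formula
    -- counts the visits to `y`.
    have e : ∀ᵐ z ∂(aliveLaw ξ D x n), avg ξ g z - g z = -(Set.indicator {y} 1 z) := by
      filter_upwards [hne] with z hz
      have e0 : z + -c ≠ 0 := by omega
      rw [hg, avg_translate (fun z => green ξ z (y - c)), avg_green hξ, if_neg e0]
      by_cases hzy : z = y
      · simp [hzy, sub_eq_add_neg]
      · have : z + -c ≠ y - c := by omega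
        simp [hzy, this]
    rw [integral_congr_ae e, integral_neg, integral_indicator_one .of_discrete]
  simp_rw [h1] at h
  rw [Finset.sum_neg_distrib] at h
  have h2 : 0 ≤ ∑ n ∈ Finset.range N, ∫ z in Dᶜ, g z ∂(aliveLaw ξ D x n ∗ ξ) :=
    Finset.sum_nonneg fun n _ => integral_nonneg fun z => green_nonneg hξ _ _
  have h3 : 0 ≤ ∫ z, g z ∂(aliveLaw ξ D x N) := integral_nonneg fun z => green_nonneg hξ _ _
  have h4 : g x = green ξ (x - c) (y - c) := by rw [hg, sub_eq_add_neg x]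
  linarith

/-- The mean time spent in `(-x,x)`: this interval misses `x`, so each of its `2x - 1` sites is
visited at most `g(-x, y-x) ≤ ρ(x)` times on average. -/
lemma sum_alive_mass_le (hξ : IsStepLaw ξ) {x : ℕ} (hx : 1 ≤ x) (N : ℕ) :
    ∑ n ∈ Finset.range N, (aliveLaw ξ (Set.Ioo (-(x : ℤ)) x) 0 n).real Set.univ
      ≤ 2 * x * rho ξ x := by
  set D := Set.Ioo (-(x : ℤ)) x with hD
  have h1 : ∀ n, (aliveLaw ξ D 0 n).real Set.univ
      = ∑ y ∈ Finset.Ioo (-(x : ℤ)) x, (aliveLaw ξ D 0 n).real {y} := fun n => by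
    rw [sum_measureReal_singleton, Finset.coe_Ioo, measureReal_def, measureReal_def]
    congr 1
    refine (measure_congr ?_).symm
    have : ∀ᵐ z ∂(aliveLaw ξ D 0 n), z ∈ D := by
      cases n with
      | zero =>
        rw [aliveLaw_zero, ae_dirac_iff .of_discrete]
        exact ⟨by omega, by omega⟩
      | succ n => exact aliveLaw_ae_mem D 0 n
    exact eventuallyEq_univ.2 this
  simp_rw [h1]
  rw [Finset.sum_comm]
  have h2 : ∀ y ∈ Finset.Ioo (-(x : ℤ)) x,
      ∑ n ∈ Finset.range N, (aliveLaw ξ D 0 n).real {y} ≤ rho ξ x := fun y _ => by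
    refine (sum_alive_singleton_le hξ (c := x) (by simp [hD]) (by omega) N).trans ?_
    refine (green_le_left hξ _ _).trans (le_of_eq ?_)
    rw [zero_sub, rho_neg]
  refine (Finset.sum_le_sum h2).trans ?_
  rw [Finset.sum_const, nsmul_eq_mul, Int.card_Ioo]
  refine mul_le_mul_of_nonneg_right ?_ (rho_nonneg hξ _)
  have : ((x : ℤ) - -x - 1).toNat ≤ 2 * x := by omega
  exact_mod_cast this

/-- The lower bound for the symmetrised potential function. -/
lemma rho_ge (hξ : IsStepLaw ξ) (x : ℕ) : 1 / 16 * ratio ξ x ≤ rho ξ x := by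
  rcases Nat.eq_zero_or_pos x with rfl | hx
  · simp [rho, pot_zero hξ, ratio]
  have hx0 : (0 : ℝ) < x := by exact_mod_cast hx
  have hM := bigM_pos hξ hx0
  set D := Set.Ioo (-(x : ℤ)) x with hD
  have hne : D ≠ Set.univ := fun h => by
    have : (x : ℤ) ∈ D := h ▸ Set.mem_univ _
    simp [hD] at this
  have hlg := linGrowth_hub hx0.le
  -- The truncated square gains at most `4m(x)` per step, over a mean time of at most `2xρ(x)`, and
  -- must be at least `x²/2` on exit. Letting `N` grow gives `ρ(x) ≥ x/(16m(x))`.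
  have key : ∀ N, (x : ℝ) ^ 2 / 2 * (1 - (aliveLaw ξ D 0 N).real Set.univ)
      ≤ 4 * bigM ξ x * (2 * x * rho ξ x) := by
    intro N
    have h1 := sum_exit_add_alive hξ.integrable hlg D 0 N
    have h2 := sum_exit_mass hξ D 0 N
    have h3 := sum_alive_mass_le hξ hx N
    have h4 : ∀ n, ∫ z, (avg ξ (fun z : ℤ => hub |(z : ℝ)| x) z - hub |(z : ℝ)| x)
        ∂(aliveLaw ξ D 0 n) ≤ 4 * bigM ξ x * (aliveLaw ξ D 0 n).real Set.univ := fun n => by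
      have hi := integrable_id_aliveLaw hξ.integrable D 0 n
      have : ∫ z, (avg ξ (fun z : ℤ => hub |(z : ℝ)| x) z - hub |(z : ℝ)| x)
          ∂(aliveLaw ξ D 0 n) ≤ ∫ _, 4 * bigM ξ x ∂(aliveLaw ξ D 0 n) :=
        integral_mono (((hlg.avg hξ.integrable).integrable hi).sub (hlg.integrable hi))
          (integrable_const _) fun z => by have := avg_hub_le hξ hx0.le z; simp only; linarith
      rwa [integral_const, smul_eq_mul, mul_comm] at this
    have h5 : ∀ n, (x : ℝ) ^ 2 / 2 * (aliveLaw ξ D 0 n ∗ ξ).real Dᶜ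
        ≤ ∫ z in Dᶜ, hub |(z : ℝ)| x ∂(aliveLaw ξ D 0 n ∗ ξ) := fun n => by
      have hi := integrable_id_conv (integrable_id_aliveLaw hξ.integrable D 0 n) hξ.integrable
      have : ∫ z in Dᶜ, (x : ℝ) ^ 2 / 2 ∂(aliveLaw ξ D 0 n ∗ ξ)
          ≤ ∫ z in Dᶜ, hub |(z : ℝ)| x ∂(aliveLaw ξ D 0 n ∗ ξ) := by
        refine setIntegral_mono_on (integrable_const _) (hlg.integrable hi).restrict .of_discrete
          fun z hz => ?_
        have hz' : (x : ℝ) ≤ |(z : ℝ)| := by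
          by_contra! h
          have := abs_lt.1 h
          exact hz ⟨by exact_mod_cast this.1, by exact_mod_cast this.2⟩
        rw [hub_of_ge hz']
        nlinarith
      rwa [setIntegral_const, smul_eq_mul, mul_comm] at this
    have h6 : 0 ≤ ∫ z : ℤ, hub |(z : ℝ)| x ∂(aliveLaw ξ D 0 N) :=
      integral_nonneg fun z => hub_nonneg (abs_nonneg _) hx0.le
    have h7 : hub |((0 : ℤ) : ℝ)| x = 0 := by simp [hub_of_le hx0.le]
    have h8 := Finset.sum_le_sum fun n (_ : n ∈ Finset.range N) => h4 n
    have h9 := Finset.sum_le_sum fun n (_ : n ∈ Finset.range N) => h5 n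
    rw [← Finset.mul_sum] at h8 h9
    have h10 : 1 - (aliveLaw ξ D 0 N).real Set.univ
        = ∑ n ∈ Finset.range N, (aliveLaw ξ D 0 n ∗ ξ).real Dᶜ := by linarith
    rw [h10]
    have h11 := mul_le_mul_of_nonneg_left h3 (by positivity : 0 ≤ 4 * bigM ξ x)
    linarith
  have hlim : Tendsto (fun N => (x : ℝ) ^ 2 / 2 * (1 - (aliveLaw ξ D 0 N).real Set.univ)) atTop
      (𝓝 ((x : ℝ) ^ 2 / 2 * (1 - 0))) :=
    (tendsto_const_nhds.sub (tendsto_aliveLaw hξ hne 0)).const_mul _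
  have h := le_of_tendsto' hlim key
  rw [ratio, ← mul_div_assoc, div_le_iff₀ hM]
  nlinarith

/-- The exit law of the negative half-line, in terms of bounds for its Green function. -/
lemma lintegral_upcross_le (hξ : IsStepLaw ξ) {w : ℕ} (hw : 1 ≤ w) (f : ℤ → ENNReal)
    (c : ℤ → ENNReal) (θ : ENNReal) (S : Set ℤ)
    (hc : ∀ z < 0, ENNReal.ofReal (green ξ (-w) z) ≤ c z)
    (hS : ∀ k ∈ S, ∀ v, 0 ≤ v → v < k → f v ≤ θ) :
    ∫⁻ v, f v ∂(exitLaw ξ (Set.Iio 0) (-w)) ≤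
      θ + ∫⁻ k in Sᶜ, ∑ v ∈ Finset.Ico 0 k, c (v - k) * f v ∂ξ := by
  set D : Set ℤ := Set.Iio 0 with hD
  set G : Measure ℤ := Measure.sum (aliveLaw ξ D (-w)) with hG
  have hGle : ∀ z < 0, G {z} ≤ c z := fun z hz => by
    refine le_trans ?_ (hc z hz)
    rw [hG, Measure.sum_apply _ .of_discrete]
    refine ENNReal.tsum_le_of_sum_range_le fun N => ?_
    have h1 := sum_alive_singleton_le hξ (D := D) (x := -w) (c := 0) (y := z) (by simp [hD])
      (by omega) N
    rw [sub_zero, sub_zero] at h1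
    refine le_trans (le_of_eq ?_) (ENNReal.ofReal_le_ofReal h1)
    rw [ENNReal.ofReal_sum_of_nonneg fun _ _ => measureReal_nonneg]
    exact Finset.sum_congr rfl fun n _ => (ofReal_measureReal).symm
  have hGae : ∀ᵐ z ∂G, z < 0 := by
    rw [hG, Measure.ae_sum_eq, Filter.eventually_iSup]
    intro n
    cases n with
    | zero =>
      rw [aliveLaw_zero, ae_dirac_iff .of_discrete]
      omega
    | succ n => exact aliveLaw_ae_mem D _ n
  have hexit : ∀ F : ℤ → ENNReal, ∫⁻ v, F v ∂(exitLaw ξ D (-w))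
      = ∫⁻ z, ∫⁻ k, Set.indicator Dᶜ F (z + k) ∂ξ ∂G := fun F => by
    rw [lintegral_exitLaw, hG, lintegral_sum_measure]
    congr 1
    ext n
    rw [← lintegral_indicator .of_discrete, lintegral_conv_eq]
  have hsplit : ∀ z, ∫⁻ k, Set.indicator Dᶜ f (z + k) ∂ξ
      = ∫⁻ k in S, Set.indicator Dᶜ f (z + k) ∂ξ + ∫⁻ k in Sᶜ, Set.indicator Dᶜ f (z + k) ∂ξ :=
    fun z => (lintegral_add_compl _ .of_discrete).symm
  rw [hexit]
  simp_rw [hsplit]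
  rw [lintegral_add_left (measurable_of_countable _)]
  refine add_le_add ?_ ?_
  -- Jumps in `S` only land where `f ≤ θ`, and the exit law has mass at most `1`.
  · have h1 : ∫⁻ z, ∫⁻ k in S, Set.indicator Dᶜ f (z + k) ∂ξ ∂G
        ≤ ∫⁻ z, ∫⁻ k, Set.indicator Dᶜ (fun _ => θ) (z + k) ∂ξ ∂G := by
      refine lintegral_mono_ae ?_
      filter_upwards [hGae] with z hz
      refine (setLIntegral_mono' (g := fun k => Set.indicator Dᶜ (fun _ => θ) (z + k))
        .of_discrete fun k hk => ?_).trans (setLIntegral_le_lintegral _ _)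
      by_cases hzk : z + k ∈ Dᶜ
      · rw [Set.indicator_of_mem hzk, Set.indicator_of_mem hzk]
        refine hS k hk _ ?_ (by omega)
        simpa [hD] using hzk
      · rw [Set.indicator_of_notMem hzk]
        exact bot_le
    refine h1.trans ?_
    rw [← hexit, lintegral_const]
    calc θ * exitLaw ξ D (-w) Set.univ ≤ θ * 1 :=
          mul_le_mul_right (exitLaw_univ_le hξ.integrable D _) _
      _ = θ := mul_one θ
  · rw [lintegral_countable']
    have h1 : ∀ z : ℤ, (∫⁻ k in Sᶜ, Set.indicator Dᶜ f (z + k) ∂ξ) * G {z}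
        ≤ ∫⁻ k in Sᶜ, Set.indicator (Set.Iio 0) c z * Set.indicator Dᶜ f (z + k) ∂ξ := fun z => by
      rw [lintegral_const_mul _ (measurable_of_countable _), mul_comm]
      refine mul_le_mul_left ?_ _
      by_cases hz : z < 0
      · rw [Set.indicator_of_mem (by exact hz)]
        exact hGle z hz
      · rw [Set.indicator_of_notMem (by exact hz)]
        have : ∀ᵐ y ∂G, y ∉ ({z} : Set ℤ) := by
          filter_upwards [hGae] with y hy hyz
          exact hz (Set.mem_singleton_iff.1 hyz ▸ hy)
        exact (measure_eq_zero_iff_ae_notMem.2 this).le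
    refine (ENNReal.tsum_le_tsum h1).trans ?_
    rw [← lintegral_tsum fun z => (measurable_of_countable _).aemeasurable]
    refine lintegral_mono fun k => ?_
    simp only
    -- Reindex by the landing point `v = z + k`. A jump `k` crosses `0` from `v - k < 0` exactly
    -- when `0 ≤ v < k`.
    rw [← (Equiv.subRight k).tsum_eq (fun z => Set.indicator (Set.Iio 0) c z
      * Set.indicator Dᶜ f (z + k))]
    simp only [Equiv.subRight_apply, sub_add_cancel]
    rw [tsum_eq_sum (s := Finset.Ico 0 k)]
    · refine Finset.sum_le_sum fun v hv => ?_
      exact mul_le_mul' (Set.indicator_le_self _ _ _) (Set.indicator_le_self _ _ _)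
    · intro v hv
      by_cases h1 : v - k < 0
      · have : v ∉ Dᶜ := fun h => hv (Finset.mem_Ico.2 ⟨by simpa [hD] using h, by omega⟩)
        rw [Set.indicator_of_notMem this, mul_zero]
      · rw [Set.indicator_of_notMem (by exact h1), zero_mul]

/-- The truncated mean of the upward jumps whose `ratio` is above `ℓ`. -/
lemma exists_tail_mean_le (hξ : IsStepLaw ξ) {ε : ℝ} (hε : 0 < ε) : ∃ ℓ₀ : ℝ, 0 < ℓ₀ ∧
    ∀ ℓ, ℓ₀ ≤ ℓ → ∫ k in {k : ℤ | 0 < k ∧ ℓ < ratio ξ k}, (k : ℝ) ∂ξ ≤ ε / ℓ := by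
  obtain ⟨K, hK1, hK⟩ := eventually_bigMp_le hξ (half_pos hε)
  refine ⟨ratio ξ K, ratio_pos hξ (by linarith), fun ℓ hℓ => ?_⟩
  have hℓ0 : 0 < ℓ := (ratio_pos hξ (by linarith)).trans_le hℓ
  have hex : ∃ n : ℕ, ℓ < ratio ξ n :=
    (((tendsto_ratio hξ).comp tendsto_natCast_atTop_atTop).eventually_gt_atTop ℓ).exists
  classical
  -- Since `ratio` is monotone, the jumps in question are at least this `y`. Then `y · upMean(y) ≤
  -- 2m_+(y) ≤ ε m(y)`, and `ℓ < y/m(y)` gives the bound.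
  set y := Nat.find hex with hy
  have hy1 : ℓ < ratio ξ y := Nat.find_spec hex
  have hyK : K ≤ y := by
    by_contra! h
    have := ratio_mono hξ (Nat.cast_nonneg y) h.le
    linarith
  have hy0 : (0 : ℝ) < y := by linarith
  have hM := bigM_pos hξ hy0
  have h1 : ∫ k in {k : ℤ | 0 < k ∧ ℓ < ratio ξ k}, (k : ℝ) ∂ξ ≤ upMean ξ y := by
    refine setIntegral_mono_set hξ.integrable.integrableOn ?_ (Eventually.of_forall ?_)
    · rw [Filter.EventuallyLE, ae_restrict_iff' .of_discrete]
      refine Eventually.of_forall fun k hk => ?_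
      have : (0 : ℝ) ≤ y := hy0.le
      exact this.trans hk
    · rintro k ⟨hk0, hk⟩
      lift k to ℕ using hk0.le
      rw [Int.cast_natCast] at hk
      have : y ≤ k := Nat.find_min' hex hk
      change (y : ℝ) ≤ ((k : ℤ) : ℝ)
      exact_mod_cast this
  have h2 := mul_upMean_le hξ.integrable hy0.le
  have h3 := hK y hyK
  refine h1.trans ?_
  rw [le_div_iff₀ hℓ0]
  have h4 : 0 ≤ upMean ξ y := by
    refine integral_nonneg_of_ae ?_
    rw [Filter.EventuallyLE, ae_restrict_iff' .of_discrete]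
    exact Eventually.of_forall fun k hk => hy0.le.trans hk
  have h5 : upMean ξ y ≤ ε * bigM ξ y / y := by
    rw [le_div_iff₀ hy0]; linarith
  calc upMean ξ y * ℓ ≤ ε * bigM ξ y / y * ratio ξ y :=
        mul_le_mul h5 hy1.le hℓ0.le (by positivity)
    _ = ε := by rw [ratio]; field_simp

lemma setIntegral_id_nonneg (A : Set ℤ) (hA : ∀ k ∈ A, 0 ≤ k) : 0 ≤ ∫ k in A, (k : ℝ) ∂ξ := by
  refine integral_nonneg_of_ae ?_
  rw [Filter.EventuallyLE, ae_restrict_iff' .of_discrete]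
  exact Eventually.of_forall fun k hk => by
    have h := hA k hk
    show (0 : ℝ) ≤ (k : ℝ)
    exact_mod_cast h

end

end RandomWalk

/-! ### The potential function is negligible on the negative side -/

namespace RandomWalk

section

variable {ξ : Measure ℤ} [IsProbabilityMeasure ξ]

lemma integral_upcross_le (hξ : IsStepLaw ξ) {w : ℕ} (hw : 1 ≤ w) {f c h : ℤ → ℝ} {θ : ℝ}
    {S : Set ℤ} (hf : ∀ v, 0 ≤ f v) (hθ : 0 ≤ θ) (hc0 : ∀ z, 0 ≤ c z)
    (hc : ∀ z < 0, green ξ (-w) z ≤ c z) (hS : ∀ k ∈ S, ∀ v, 0 ≤ v → v < k → f v ≤ θ)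
    (hI : IntegrableOn h Sᶜ ξ) (hh : ∀ k ∈ Sᶜ, ∑ v ∈ Finset.Ico 0 k, c (v - k) * f v ≤ h k) :
    Integrable f (exitLaw ξ (Set.Iio 0) (-w)) ∧
      ∫ v, f v ∂(exitLaw ξ (Set.Iio 0) (-w)) ≤ θ + ∫ k in Sᶜ, h k ∂ξ := by
  have hh0 : ∀ k ∈ Sᶜ, 0 ≤ h k := fun k hk =>
    (Finset.sum_nonneg fun v _ => mul_nonneg (hc0 _) (hf v)).trans (hh k hk)
  have hint0 : 0 ≤ ∫ k in Sᶜ, h k ∂ξ := setIntegral_nonneg .of_discrete hh0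
  have key : ∫⁻ v, ENNReal.ofReal (f v) ∂(exitLaw ξ (Set.Iio 0) (-w)) ≤
      ENNReal.ofReal (θ + ∫ k in Sᶜ, h k ∂ξ) := by
    refine (lintegral_upcross_le hξ hw _ (fun z => ENNReal.ofReal (c z)) (ENNReal.ofReal θ) S
      (fun z hz => ENNReal.ofReal_le_ofReal (hc z hz))
      fun k hk v hv hvk => ENNReal.ofReal_le_ofReal (hS k hk v hv hvk)).trans ?_
    rw [ENNReal.ofReal_add hθ hint0, ofReal_integral_eq_lintegral_ofReal hI
      ((ae_restrict_iff' .of_discrete).2 (Eventually.of_forall hh0))]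
    refine add_le_add le_rfl ?_
    refine setLIntegral_mono' .of_discrete fun k hk => ?_
    simp_rw [← ENNReal.ofReal_mul (hc0 _)]
    rw [← ENNReal.ofReal_sum_of_nonneg fun v _ => mul_nonneg (hc0 _) (hf v)]
    exact ENNReal.ofReal_le_ofReal (hh k hk)
  refine ⟨⟨(measurable_of_countable f).aestronglyMeasurable, ?_⟩, ?_⟩
  · rw [hasFiniteIntegral_iff_ofReal (Eventually.of_forall hf)]
    exact key.trans_lt ENNReal.ofReal_lt_top
  · rw [integral_eq_lintegral_of_nonneg_ae (Eventually.of_forall hf)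
      (measurable_of_countable f).aestronglyMeasurable]
    exact ENNReal.toReal_le_of_le_ofReal (add_nonneg hθ hint0) key

lemma rho_le_ratio_abs {C : ℝ} (hC : ∀ x : ℕ, rho ξ x ≤ C * ratio ξ x) (v : ℤ) :
    rho ξ v ≤ C * ratio ξ |(v : ℝ)| := by
  obtain ⟨n, rfl | rfl⟩ := v.eq_nat_or_neg
  · simpa using hC n
  · simpa [rho_neg] using hC n

/-- The three terms handle `k ≤ w`, `w ≤ k ≤ Y` and `k ≥ Y`. Each is then integrable against a
quantity controlled by `m_+`. -/
lemma mul_min_ratio_le (hξ : IsStepLaw ξ) {w k Y : ℝ} (hw : 0 < w) (hwY : w ≤ Y) (hk : 0 < k) :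
    k * min (ratio ξ k) (ratio ξ Y) ≤ ratio ξ w * k + (if k ≤ Y then k ^ 2 else 0) / bigM ξ w
      + ratio ξ Y * (if Y ≤ k then k else 0) := by
  have hM := bigM_pos hξ hw
  have h1 := ratio_nonneg (ξ := ξ) hw.le
  have h2 := ratio_nonneg (ξ := ξ) (hw.le.trans hwY)
  have h4 : 0 ≤ (if k ≤ Y then k ^ 2 else 0) / bigM ξ w := by positivity
  have h5 : 0 ≤ ratio ξ Y * (if Y ≤ k then k else 0) := by positivity
  rcases le_total k w with hkw | hkw
  · have := mul_le_mul_of_nonneg_left ((min_le_left _ _).trans (ratio_mono hξ hk.le hkw) :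
      min (ratio ξ k) (ratio ξ Y) ≤ _) hk.le
    nlinarith
  rcases le_total k Y with hkY | hkY
  · have h6 : k * min (ratio ξ k) (ratio ξ Y) ≤ k ^ 2 / bigM ξ w := by
      refine (mul_le_mul_of_nonneg_left (min_le_left _ _) hk.le).trans ?_
      rw [ratio, sq, ← mul_div_assoc]
      exact div_le_div_of_nonneg_left (by positivity) hM (bigM_mono hξ.integrable hkw)
    rw [if_pos hkY] at h4 ⊢
    nlinarith
  · have := mul_le_mul_of_nonneg_left (min_le_right (ratio ξ k) (ratio ξ Y)) hk.le
    rw [if_pos hkY]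
    nlinarith

/-- The walk from `-w` can reach `R` only after crossing `0`. At the landing point `v`, `g(v,R)` is
at most `C min(ratio |v|, ratio Y)`, and each negative site is visited at most `ρ(w) ≤ C ratio(w)`
times. Jumps with `ratio k ≤ δ ratio w` contribute the first term; a longer jump `k` is summed over
its at most `k` landing points. -/
lemma green_neg_le (hξ : IsStepLaw ξ) {C : ℝ} (hC0 : 0 < C)
    (hC : ∀ x : ℕ, rho ξ x ≤ C * ratio ξ x) {w : ℕ} (hw : 1 ≤ w) {Y δ : ℝ} (hwY : w ≤ Y)
    (hδ : 0 ≤ δ) {R : ℕ} (hR : R ≤ Y) :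
    green ξ (-w) R ≤ C * (δ * ratio ξ w) + C ^ 2 * ratio ξ w * (ratio ξ w *
      (∫ k in {k : ℤ | 0 < k ∧ δ * ratio ξ w < ratio ξ k}, (k : ℝ) ∂ξ)
      + 2 * bigMp ξ Y / bigM ξ w + ratio ξ Y * upMean ξ Y) := by
  have hw0 : (0 : ℝ) < w := by exact_mod_cast hw
  have hY0 : 0 < Y := hw0.trans_le hwY
  have hM := bigM_pos hξ hw0
  have hrw := ratio_nonneg (ξ := ξ) hw0.le
  have hrY := ratio_nonneg (ξ := ξ) hY0.le
  set A : Set ℤ := {k : ℤ | 0 < k ∧ δ * ratio ξ w < ratio ξ k} with hA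
  set f : ℤ → ℝ := fun v => C * min (ratio ξ |(v : ℝ)|) (ratio ξ Y) with hf
  have hi1 : Integrable (fun k : ℤ => if (k : ℝ) ≤ Y then (k : ℝ) ^ 2 else 0)
      (ξ.restrict {k | 0 ≤ k}) := by
    refine Integrable.of_bound (measurable_of_countable _).aestronglyMeasurable (Y ^ 2) ?_
    refine (ae_restrict_iff' .of_discrete).2 (Eventually.of_forall fun k hk => ?_)
    have hk0 : (0 : ℝ) ≤ k := by exact_mod_cast (show 0 ≤ k from hk)
    split_ifs with h
    · rw [Real.norm_of_nonneg (sq_nonneg _)]; gcongr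
    · simp; positivity
  have hi2 : Integrable (fun k : ℤ => if Y ≤ (k : ℝ) then (k : ℝ) else 0) ξ := by
    refine integrable_of_le_abs hξ.integrable 1 fun k => ?_
    split_ifs <;> simp
  have hApos : A ⊆ {k | 0 ≤ k} := fun k hk => hk.1.le
  set h : ℤ → ℝ := fun k => C ^ 2 * ratio ξ w * (ratio ξ w * k
    + (if (k : ℝ) ≤ Y then (k : ℝ) ^ 2 else 0) / bigM ξ w
    + ratio ξ Y * (if Y ≤ (k : ℝ) then (k : ℝ) else 0)) with hh
  have hiA : Integrable (fun k : ℤ => (k : ℝ)) (ξ.restrict A) := hξ.integrable.restrict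
  have hi1A := hi1.mono_measure (Measure.restrict_mono hApos le_rfl)
  have hi2A := hi2.restrict (s := A)
  have hlow := (integral_upcross_le hξ hw (f := f) (c := fun _ => C * ratio ξ w) (h := h)
    (θ := C * (δ * ratio ξ w)) (S := Aᶜ) (fun v => ?_) (by positivity) (fun _ => by positivity)
    (fun z _ => ?_) ?_ ?_ ?_).2
  · have hg : green ξ (-w) R ≤ ∫ v, f v ∂(exitLaw ξ (Set.Iio 0) (-w)) := by
      rw [← green_eq_exit hξ (Set.Iio 0) (by omega) (by omega) (by simp) (by simp)]
      have := isFiniteMeasure_exitLaw hξ.integrable (Set.Iio 0) (-w : ℤ)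
      obtain ⟨K, hK⟩ := abs_green_le hξ R
      refine integral_mono (Integrable.of_bound
        (measurable_of_countable _).aestronglyMeasurable K (Eventually.of_forall hK))
        (Integrable.of_bound (measurable_of_countable _).aestronglyMeasurable (C * ratio ξ Y)
        (Eventually.of_forall fun v => ?_)) fun v => ?_
      · rw [Real.norm_of_nonneg (mul_nonneg hC0.le
          (le_min (ratio_nonneg (abs_nonneg _)) hrY))]
        exact mul_le_mul_of_nonneg_left (min_le_right _ _) hC0.le
      · change green ξ v R ≤ C * min _ _
        rw [mul_min_of_nonneg _ _ hC0.le]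
        exact le_min ((green_le_left hξ v R).trans (rho_le_ratio_abs hC v))
          ((green_le hξ v R).trans ((hC R).trans
          (mul_le_mul_of_nonneg_left (ratio_mono hξ (Nat.cast_nonneg R) hR) hC0.le)))
    refine hg.trans (hlow.trans ?_)
    have e1 := integral_add ((hiA.const_mul (ratio ξ w)).add (hi1A.div_const (bigM ξ w)))
      (hi2A.const_mul (ratio ξ Y))
    have e2 := integral_add (hiA.const_mul (ratio ξ w)) (hi1A.div_const (bigM ξ w))
    simp only [Pi.add_apply] at e1
    rw [compl_compl, hh, integral_const_mul, e1, e2, integral_const_mul, integral_const_mul,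
      integral_div]
    gcongr
    · refine le_trans ?_ (integral_sq_le hξ.integrable hY0.le)
      have : {k : ℤ | 0 ≤ k ∧ (k : ℝ) ≤ Y} = {k : ℤ | 0 ≤ k} ∩ {k : ℤ | (k : ℝ) ≤ Y} := rfl
      rw [this, ← setIntegral_indicator .of_discrete]
      exact setIntegral_mono_set hi1 (Eventually.of_forall fun k => by
        dsimp only [Pi.zero_apply]; positivity) (Eventually.of_forall hApos)
    · rw [upMean, ← integral_indicator (s := {k : ℤ | Y ≤ k}) .of_discrete]
      refine (setIntegral_le_integral hi2 (Eventually.of_forall fun k => ?_)).trans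
        (le_of_eq (integral_congr_ae (Eventually.of_forall fun k => ?_)))
      · dsimp only [Pi.zero_apply]
        split_ifs with hk
        · exact hY0.le.trans hk
        · exact le_rfl
      · simp [Set.indicator_apply]
  · exact mul_nonneg hC0.le (le_min (ratio_nonneg (abs_nonneg _)) hrY)
  · exact (green_le_left hξ _ _).trans (by rw [rho_neg]; exact hC w)
  · intro k hk v hv hvk
    have hk' : ratio ξ k ≤ δ * ratio ξ w := by
      by_contra! hlt
      exact hk ⟨by omega, hlt⟩
    have hv' : (0 : ℝ) ≤ v := by exact_mod_cast hv
    have hvk' : (v : ℝ) ≤ k := by exact_mod_cast hvk.le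
    refine mul_le_mul_of_nonneg_left ((min_le_left _ _).trans ?_) hC0.le
    rw [abs_of_nonneg hv']
    exact (ratio_mono hξ hv' hvk').trans hk'
  · rw [compl_compl]
    exact (((hiA.const_mul _).add (hi1A.div_const _)).add (hi2A.const_mul _)).const_mul _
  · rw [compl_compl]
    intro k hk
    have hk0 : (0 : ℝ) < k := by exact_mod_cast hk.1
    have hb : ∀ v ∈ Finset.Ico 0 k, C * ratio ξ w * f v ≤
        C * ratio ξ w * (C * min (ratio ξ k) (ratio ξ Y)) := fun v hv => by
      rw [Finset.mem_Ico] at hv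
      have hv' : (0 : ℝ) ≤ v := by exact_mod_cast hv.1
      have hvk' : (v : ℝ) ≤ k := by exact_mod_cast hv.2.le
      have := ratio_mono hξ hv' hvk'
      rw [hf]
      dsimp only
      rw [abs_of_nonneg hv']
      gcongr
    refine (Finset.sum_le_card_nsmul _ _ _ hb).trans ?_
    have hcard : ((Finset.Ico 0 k).card : ℝ) = k := by
      rw [Int.card_Ico, sub_zero]
      exact_mod_cast congrArg (Int.cast : ℤ → ℝ) (Int.toNat_of_nonneg hk.1.le)
    rw [nsmul_eq_mul, hcard]
    have := mul_le_mul_of_nonneg_left (mul_min_ratio_le hξ hw0 hwY hk0)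
      (show 0 ≤ C ^ 2 * ratio ξ w by positivity)
    rw [hh]
    dsimp only
    linarith

lemma bigM_two_mul_le (hξ : IsStepLaw ξ) {y : ℝ} (hy : 0 < y) :
    bigM ξ (2 * y) ≤ 2 * bigM ξ y := by
  have := bigM_mul_le hξ.integrable hy.le (show y ≤ 2 * y by linarith)
  nlinarith

/-- `N` is the first power of `2` at which `m(Nw)` reaches `m(w)/η`; it does not overshoot by more
than a factor `2`, because `m(2y) ≤ 2m(y)`. -/
lemma exists_doubling (hξ : IsStepLaw ξ) {w : ℕ} (hw : 1 ≤ w) {η : ℝ} (hη : 0 < η) (hη1 : η < 1) :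
    ∃ N : ℕ, 1 ≤ N ∧ bigM ξ w ≤ η * bigM ξ (N * w) ∧ η * bigM ξ (N * w) ≤ 2 * bigM ξ w := by
  have hw0 : (0 : ℝ) < w := by exact_mod_cast hw
  have hM := bigM_pos hξ hw0
  have hex : ∃ i : ℕ, bigM ξ w ≤ η * bigM ξ (2 ^ i * w) := by
    have h1 : Tendsto (fun i : ℕ => (2 : ℝ) ^ i * w) atTop atTop :=
      (tendsto_pow_atTop_atTop_of_one_lt one_lt_two).atTop_mul_const hw0
    obtain ⟨i, hi⟩ := (((tendsto_bigM hξ.integrable hξ.sq_infinite).comp h1).eventually_ge_atTop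
      (bigM ξ w / η)).exists
    exact ⟨i, by rw [mul_comm]; exact (div_le_iff₀ hη).1 hi⟩
  classical
  have hspec := Nat.find_spec hex
  rcases hi : Nat.find hex with _ | j
  · rw [hi, pow_zero, one_mul] at hspec
    nlinarith
  · rw [hi] at hspec
    have hmin := Nat.find_min hex (show j < Nat.find hex by omega)
    have h2 := bigM_two_mul_le hξ (show (0 : ℝ) < 2 ^ j * w by positivity)
    rw [← mul_assoc, ← pow_succ'] at h2
    refine ⟨2 ^ (j + 1), Nat.one_le_two_pow, by exact_mod_cast hspec, ?_⟩
    push_cast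
    nlinarith

/-- The potential function is negligible, on the negative half-line, against `ratio`. -/
lemma eventually_pot_neg_le (hξ : IsStepLaw ξ) {ε : ℝ} (hε : 0 < ε) :
    ∃ N₀ : ℕ, ∀ w : ℕ, N₀ ≤ w → pot ξ (-w) ≤ ε * ratio ξ w := by
  obtain ⟨C, hC0, hC⟩ := exists_rho_le hξ
  set η := min (ε / (4 * C)) (1 / 2) with hη
  have hη0 : 0 < η := lt_min (by positivity) (by norm_num)
  have hη1 : η < 1 := (min_le_right _ _).trans_lt (by norm_num)
  have hCη : C * η ≤ ε / 4 := by
    have := mul_le_mul_of_nonneg_left (min_le_left (ε / (4 * C)) (1 / 2)) hC0.le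
    rwa [← hη, show C * (ε / (4 * C)) = ε / 4 by field_simp] at this
  -- With this `τ` the three error terms of `green_neg_le`, at most `τ/η`, `4τ/η` and `2τ/η`, sum to
  -- `ε/2` after multiplication by `C²`.
  set τ := ε * η / (14 * C ^ 2) with hτ
  have hτ0 : 0 < τ := by positivity
  obtain ⟨ℓ, hℓ0, hℓ⟩ := exists_tail_mean_le hξ hτ0
  obtain ⟨K, hK1, hK⟩ := eventually_bigMp_le hξ hτ0
  obtain ⟨N₀, hN₀⟩ := eventually_atTop.1
    ((((tendsto_ratio hξ).comp tendsto_natCast_atTop_atTop).eventually_ge_atTop (ℓ / η)).and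
    ((tendsto_natCast_atTop_atTop (R := ℝ)).eventually_ge_atTop K))
  refine ⟨N₀, fun w hw => ?_⟩
  obtain ⟨h1, hKw⟩ := hN₀ w hw
  have h1 : ℓ ≤ η * ratio ξ w := by
    rw [mul_comm]; exact (div_le_iff₀ hη0).1 h1
  have hw0 : (0 : ℝ) < w := by linarith
  have hw1 : 1 ≤ w := by exact_mod_cast hw0
  have hM := bigM_pos hξ hw0
  have hr := ratio_pos hξ hw0
  obtain ⟨N, hN1, hNl, hNu⟩ := exists_doubling hξ hw1 hη0 hη1
  have hN0 : (1 : ℝ) ≤ N := by exact_mod_cast hN1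
  have hwY : (w : ℝ) ≤ N * w := by nlinarith
  have hY0 : (0 : ℝ) < N * w := by positivity
  have hMY := bigM_pos hξ hY0
  have hMp := hK _ (hKw.trans hwY)
  have t1 : ratio ξ w * (∫ k in {k : ℤ | 0 < k ∧ η * ratio ξ w < ratio ξ k}, (k : ℝ) ∂ξ)
      ≤ τ / η := by
    refine (mul_le_mul_of_nonneg_left (hℓ _ h1) hr.le).trans (le_of_eq ?_)
    field_simp
  have t2 : 2 * bigMp ξ (N * w) / bigM ξ w ≤ 4 * τ / η := by
    rw [div_le_div_iff₀ hM hη0]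
    nlinarith
  have t3 : ratio ξ (N * w) * upMean ξ (N * w) ≤ 2 * τ / η := by
    have := mul_upMean_le hξ.integrable hY0.le
    rw [ratio, div_mul_eq_mul_div, div_le_div_iff₀ hMY hη0]
    nlinarith [mul_pos hτ0 hMY]
  set κ := ε / 4 + ε / 2 with hκ
  have hgreen : ∀ i : ℕ, i ≤ N → green ξ (-w) ((i * w : ℕ) : ℤ) ≤ κ * ratio ξ w := fun i hi => by
    have hiY : ((i * w : ℕ) : ℝ) ≤ N * w := by exact_mod_cast Nat.mul_le_mul_right w hi
    refine (green_neg_le hξ hC0 hC hw1 hwY hη0.le hiY).trans ?_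
    have h7 : C ^ 2 * (τ / η + 4 * τ / η + 2 * τ / η) = ε / 2 := by
      rw [hτ]; field_simp; norm_num
    calc _ ≤ C * (η * ratio ξ w) + C ^ 2 * ratio ξ w * (τ / η + 4 * τ / η + 2 * τ / η) := by
          gcongr
      _ = (C * η + C ^ 2 * (τ / η + 4 * τ / η + 2 * τ / η)) * ratio ξ w := by ring
      _ ≤ κ * ratio ξ w := by rw [h7, hκ]; gcongr
  -- The bound on `g(-w, iw)` limits the defect of additivity of `a` between `-iw` and `-(i+1)w`, so
  -- `a(-iw)` grows almost linearly in `i`.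
  have hind : ∀ i : ℕ, i ≤ N → i * (pot ξ (-w) - κ * ratio ξ w) ≤ pot ξ (-((i * w : ℕ) : ℤ)) := by
    intro i hi
    induction i with
    | zero => simp [pot_zero hξ]
    | succ i ih =>
      have h8 := ih (by omega)
      have h9 := hgreen i (by omega)
      rw [green, show -(w : ℤ) - ((i * w : ℕ) : ℤ) = -(((i + 1) * w : ℕ) : ℤ) by push_cast; ring]
        at h9
      push_cast at h8 h9 ⊢
      linarith
  have h10 := hind N le_rfl
  have h11 : pot ξ (-((N * w : ℕ) : ℤ)) ≤ N * (C * η * ratio ξ w) := by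
    -- On the other hand `a(-Nw) ≤ C Nw/m(Nw) ≤ C η N · ratio(w)`, by the choice of `N`. Dividing by
    -- `N` bounds `a(-w)`.
    have h12 : pot ξ (-((N * w : ℕ) : ℤ)) ≤ rho ξ ((N * w : ℕ) : ℤ) :=
      le_add_of_nonneg_left (pot_nonneg hξ _)
    refine (h12.trans (hC _)).trans ?_
    push_cast
    rw [ratio, ratio, ← mul_div_assoc, ← mul_div_assoc, ← mul_div_assoc, div_le_div_iff₀ hMY hM]
    nlinarith [mul_le_mul_of_nonneg_left hNl (show 0 ≤ C * (N * w) by positivity)]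
  have h13 : (N : ℝ) * (pot ξ (-w)) ≤ N * (κ * ratio ξ w + C * η * ratio ξ w) := by
    linarith
  have h14 := le_of_mul_le_mul_left h13 (by linarith)
  refine h14.trans ?_
  rw [← add_mul]
  exact mul_le_mul_of_nonneg_right (by rw [hκ]; linarith) hr.le

end

end RandomWalk

/-! ### Crossings of `0` from far below -/

namespace RandomWalk

section

variable {ξ : Measure ℤ} [IsProbabilityMeasure ξ]

lemma eventually_pot_ge (hξ : IsStepLaw ξ) :
    ∃ N₀ : ℕ, ∀ v : ℕ, N₀ ≤ v → 1 / 32 * ratio ξ v ≤ pot ξ v := by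
  obtain ⟨N₀, h⟩ := eventually_pot_neg_le hξ (ε := 1 / 32) (by norm_num)
  refine ⟨N₀, fun v hv => ?_⟩
  have h1 := h v hv
  have h2 := rho_ge hξ v
  rw [rho] at h2
  linarith

/-- Take the first `Y` with `ratio Y > ℓ`; its predecessor `j ≥ 1` has `ratio j ≤ ℓ`, and `ratio (j
+ 1) ≤ ratio (2j) ≤ 2 ratio j`. -/
lemma exists_ratio_mem (hξ : IsStepLaw ξ) {Q : ℕ} (hQ : 1 ≤ Q) {ℓ : ℝ} (hℓ : ratio ξ Q ≤ ℓ) :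
    ∃ Y : ℕ, 1 ≤ Y ∧ ℓ < ratio ξ Y ∧ ratio ξ Y ≤ 2 * ℓ := by
  have hex : ∃ n : ℕ, ℓ < ratio ξ n :=
    (((tendsto_ratio hξ).comp tendsto_natCast_atTop_atTop).eventually_gt_atTop ℓ).exists
  classical
  have hspec := Nat.find_spec hex
  have hQY : Q < Nat.find hex := by
    by_contra! h
    have := ratio_mono hξ (Nat.cast_nonneg (Nat.find hex)) (Nat.cast_le.2 h)
    linarith
  refine ⟨Nat.find hex, by omega, hspec, ?_⟩
  obtain ⟨j, hj⟩ : ∃ j, Nat.find hex = j + 1 := ⟨Nat.find hex - 1, by omega⟩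
  have hmin := Nat.find_min hex (show j < Nat.find hex by omega)
  have hj1 : (1 : ℝ) ≤ j := by exact_mod_cast (show 1 ≤ j by omega)
  have h1 : ratio ξ (j + 1) ≤ ratio ξ (2 * j) := ratio_mono hξ (by linarith) (by linarith)
  have h2 : ratio ξ (2 * j) ≤ 2 * ratio ξ j := by
    rw [ratio, ratio, ← mul_div_assoc]
    exact div_le_div_of_nonneg_left (by linarith) (bigM_pos hξ (by linarith))
      (bigM_mono hξ.integrable (by linarith))
  rw [hj]
  push_cast
  linarith

/-- A jump `k` that lands in the range has `ratio k > l` and at most `min(k,Y)` landing points. The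
departure point is visited at most `C ratio(k)` times, whatever `w` is, and `min(k,Y) ratio(k) ≤
ratio(Y) k`. -/
lemma exitLaw_middle_le (hξ : IsStepLaw ξ) {C : ℝ} (hC0 : 0 < C)
    (hC : ∀ x : ℕ, rho ξ x ≤ C * ratio ξ x) {w Y : ℕ} (hw : 1 ≤ w) (hY : 1 ≤ Y) {l u : ℝ}
    (hu : u ≤ ratio ξ Y) :
    ∫ v, (if 0 ≤ v ∧ l < ratio ξ v ∧ ratio ξ v < u then 1 else 0)
        ∂(exitLaw ξ (Set.Iio 0) (-(w : ℤ))) ≤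
      C * ratio ξ Y * ∫ k in {k : ℤ | 0 < k ∧ l < ratio ξ k}, (k : ℝ) ∂ξ := by
  have hY0 : (0 : ℝ) < Y := by exact_mod_cast hY
  have hr0 : ∀ z : ℤ, 0 ≤ ratio ξ |(z : ℝ)| := fun z => ratio_nonneg (abs_nonneg _)
  set A : Set ℤ := {k : ℤ | 0 < k ∧ l < ratio ξ k} with hA
  have h := (integral_upcross_le hξ hw
    (f := fun v => if 0 ≤ v ∧ l < ratio ξ v ∧ ratio ξ v < u then 1 else 0)
    (c := fun z => C * ratio ξ |(z : ℝ)|) (h := fun k => C * ratio ξ Y * k) (θ := 0)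
    (S := Aᶜ) (fun v => ?_) le_rfl (fun z => mul_nonneg hC0.le (hr0 z))
    (fun z _ => (green_le hξ _ _).trans (rho_le_ratio_abs hC z)) ?_
    ((hξ.integrable.const_mul _).restrict) ?_).2
  · rwa [compl_compl, zero_add, integral_const_mul] at h
  · positivity
  · intro k hk v hv hvk
    rw [if_neg]
    rintro ⟨-, h1, -⟩
    refine hk ⟨by omega, h1.trans_le (ratio_mono hξ ?_ ?_)⟩
    · exact_mod_cast hv
    · exact_mod_cast hvk.le
  · rw [compl_compl]
    intro k hk
    have hk0 : (0 : ℝ) < k := by exact_mod_cast hk.1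
    have hkM := bigM_pos hξ hk0
    have hYM := bigM_pos hξ hY0
    have hb : ∀ v ∈ Finset.Ico 0 k, C * ratio ξ |((v - k : ℤ) : ℝ)| *
        (if 0 ≤ v ∧ l < ratio ξ v ∧ ratio ξ v < u then 1 else 0) ≤
        if v ∈ Finset.Ico 0 (min k Y) then C * ratio ξ k else 0 := fun v hv => by
      rw [Finset.mem_Ico] at hv
      have hv0 : (0 : ℝ) ≤ v := by exact_mod_cast hv.1
      have hvk : (v : ℝ) ≤ k := by exact_mod_cast hv.2.le
      have hle : ratio ξ |((v - k : ℤ) : ℝ)| ≤ ratio ξ k := by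
        refine ratio_mono hξ (abs_nonneg _) ?_
        push_cast
        rw [abs_of_nonpos (by linarith)]
        linarith
      by_cases hvu : 0 ≤ v ∧ l < ratio ξ v ∧ ratio ξ v < u
      · have hvY : v < Y := by
          by_contra! hYv
          have := ratio_mono hξ hY0.le (show (Y : ℝ) ≤ v by exact_mod_cast hYv)
          linarith [hvu.2.2]
        rw [if_pos hvu, if_pos (Finset.mem_Ico.2 ⟨hv.1, lt_min hv.2 hvY⟩), mul_one]
        gcongr
      · rw [if_neg hvu, mul_zero]
        have := ratio_nonneg (ξ := ξ) hk0.le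
        positivity
    refine (Finset.sum_le_sum hb).trans ?_
    have hsub : Finset.Ico 0 (min k Y) ⊆ Finset.Ico 0 k :=
      Finset.Ico_subset_Ico le_rfl (min_le_left _ _)
    rw [Finset.sum_ite_mem, Finset.inter_eq_right.2 hsub, Finset.sum_const, nsmul_eq_mul,
      Int.card_Ico, sub_zero]
    have hcard : (((min k (Y : ℤ)).toNat : ℕ) : ℝ) = min (k : ℝ) Y := by
      have := congrArg (Int.cast : ℤ → ℝ)
        (Int.toNat_of_nonneg (show 0 ≤ min k (Y : ℤ) from le_min hk.1.le (by positivity)))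
      push_cast at this
      exact this
    rw [hcard]
    have hmain : min (k : ℝ) Y * ratio ξ k ≤ ratio ξ Y * k := by
      rcases le_total (k : ℝ) Y with h1 | h1
      · rw [min_eq_left h1, mul_comm]
        gcongr
        exact ratio_mono hξ hk0.le h1
      · rw [min_eq_right h1, ratio, ratio, ← mul_div_assoc, div_mul_eq_mul_div]
        exact div_le_div_of_nonneg_left (by positivity) hYM (bigM_mono hξ.integrable h1)
    nlinarith

-- Split according to the point `v` where the walk from `-w` first is nonnegative. If `v` is close
-- to `0`, then `g(v,Q) ≤ ρ(v)` is small; intermediate `v` have small probability; for remote `v`,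
-- `ρ(Q)` is at most a small multiple of `a(v)`, whose mean is at most `a(-w) ≤ C₀ρ(Q)`. The bound
-- is uniform in `w`, however large.
set_option maxHeartbeats 400000 in
lemma green_neg_le_of_pot_le (hξ : IsStepLaw ξ) {C₀ ε : ℝ} (hC₀ : 0 < C₀) (hε : 0 < ε) :
    ∃ N₀ : ℕ, ∀ Q : ℕ, N₀ ≤ Q → ∀ w : ℕ, pot ξ (-w) ≤ C₀ * rho ξ Q →
      green ξ (-w) Q ≤ ε * rho ξ Q := by
  obtain ⟨C, hC0, hC⟩ := exists_rho_le hξ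
  obtain ⟨N₁, hN₁⟩ := eventually_pot_ge hξ
  -- `δ`, `Λ` and `τ` make the near, remote and intermediate parts at most `ε/3` each; the factor
  -- `48 = 3·16` uses `ρ ≥ ratio/16`.
  set δ := ε / (48 * C) with hδ
  have hδ0 : 0 < δ := by positivity
  set Λ := 1 + 192 * C₀ * C / ε with hΛ
  have hΛ1 : 1 ≤ Λ := by
    have : 0 < 192 * C₀ * C / ε := by positivity
    linarith
  have hΛ0 : 0 < Λ := by linarith
  set τ := ε * δ / (6 * C * Λ) with hτ
  have hτ0 : 0 < τ := by positivity
  obtain ⟨ℓ, hℓ0, hℓ⟩ := exists_tail_mean_le hξ hτ0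
  obtain ⟨N₂, hN₂⟩ := eventually_atTop.1
    (((tendsto_ratio hξ).comp tendsto_natCast_atTop_atTop).eventually_ge_atTop (ℓ / δ))
  refine ⟨max (max N₁ N₂) 1, fun Q hQ w hw => ?_⟩
  have hQ1 : 1 ≤ Q := (le_max_right _ _).trans hQ
  have hQN1 : N₁ ≤ Q := ((le_max_left _ _).trans (le_max_left _ _)).trans hQ
  have hQN2 : N₂ ≤ Q := ((le_max_right _ _).trans (le_max_left _ _)).trans hQ
  have hr := ratio_pos hξ (show (0 : ℝ) < Q by exact_mod_cast hQ1)
  have hρl := rho_ge hξ Q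
  have hρu := hC Q
  have hρ : 0 < rho ξ Q := by linarith
  rcases Nat.eq_zero_or_pos w with rfl | hw1
  · rw [Nat.cast_zero, neg_zero, green_zero, pot_zero hξ]; positivity
  have hℓQ : ℓ ≤ δ * ratio ξ Q := by
    rw [mul_comm]; exact (div_le_iff₀ hδ0).1 (hN₂ Q hQN2)
  obtain ⟨Y, hY1, hYl, hYu⟩ := exists_ratio_mem hξ hQ1 (ℓ := Λ * ratio ξ Q) (by nlinarith)
  have hmid := exitLaw_middle_le hξ hC0 hC hw1 hY1 (l := δ * ratio ξ Q) le_rfl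
  have hmid2 : C * ratio ξ Y * ∫ k in {k : ℤ | 0 < k ∧ δ * ratio ξ Q < ratio ξ k}, (k : ℝ) ∂ξ
      ≤ ε / 3 := by
    refine (mul_le_mul (mul_le_mul_of_nonneg_left hYu hC0.le) (hℓ _ hℓQ)
      (setIntegral_id_nonneg _ fun k hk => hk.1.le) (by positivity)).trans (le_of_eq ?_)
    rw [hτ]; field_simp; norm_num
  set V := exitLaw ξ (Set.Iio 0) (-(w : ℤ)) with hV
  have hfin : IsFiniteMeasure V := isFiniteMeasure_exitLaw hξ.integrable _ _
  obtain ⟨hpi, hpot⟩ := integral_exitLaw_le hξ.integrable (linGrowth_pot hξ) (pot_nonneg hξ)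
    (D := Set.Iio 0) (fun z hz => by
      rw [avg_pot hξ, if_neg (ne_of_lt hz), add_zero]) (-(w : ℤ))
  rw [avg_pot hξ, if_neg (by omega), add_zero] at hpot
  obtain ⟨K, hK⟩ := abs_green_le hξ Q
  set b := 64 * rho ξ Q / (Λ * ratio ξ Q) with hb
  have hb0 : 0 ≤ b := by positivity
  have hmi : Integrable (fun v : ℤ => if 0 ≤ v ∧ δ * ratio ξ Q < ratio ξ v ∧ ratio ξ v < ratio ξ Y
      then (1 : ℝ) else 0) V := by
    refine Integrable.of_bound (measurable_of_countable _).aestronglyMeasurable 1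
      (Eventually.of_forall fun v => ?_)
    split_ifs <;> simp
  have hle : green ξ (-w) Q ≤ ∫ v, (C * (δ * ratio ξ Q) + rho ξ Q * (if 0 ≤ v ∧
      δ * ratio ξ Q < ratio ξ v ∧ ratio ξ v < ratio ξ Y then (1 : ℝ) else 0) + b * pot ξ v) ∂V := by
    rw [← green_eq_exit hξ (Set.Iio 0) (by omega) (by omega) (by simp) (by simp)]
    refine integral_mono_ae (Integrable.of_bound
        (measurable_of_countable _).aestronglyMeasurable K (Eventually.of_forall hK))
        (((integrable_const _).add (hmi.const_mul _)).add (hpi.const_mul b)) ?_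
    filter_upwards [exitLaw_ae_mem (Set.Iio 0) (-(w : ℤ))] with v hv
    have hv0 : 0 ≤ v := by simpa using hv
    have hp := mul_nonneg hb0 (pot_nonneg hξ v)
    rcases le_or_gt (ratio ξ v) (δ * ratio ξ Q) with h1 | h1
    · have h2 := (green_le_left hξ v Q).trans (rho_le_ratio_abs hC v)
      rw [abs_of_nonneg (by exact_mod_cast hv0)] at h2
      have h3 := mul_le_mul_of_nonneg_left h1 hC0.le
      have h4 : 0 ≤ rho ξ Q * (if 0 ≤ v ∧
        δ * ratio ξ Q < ratio ξ v ∧ ratio ξ v < ratio ξ Y then (1 : ℝ) else 0) := by positivity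
      linarith
    have h0 : 0 ≤ C * (δ * ratio ξ Q) := by positivity
    rcases lt_or_ge (ratio ξ v) (ratio ξ Y) with h2 | h2
    · rw [if_pos ⟨hv0, h1, h2⟩, mul_one]
      linarith [green_le hξ v Q]
    · lift v to ℕ using hv0
      simp only [Int.cast_natCast] at h2
      have hQv : Q ≤ v := by
        by_contra! hlt
        have := ratio_mono hξ (Nat.cast_nonneg v) (Nat.cast_le.2 hlt.le)
        nlinarith
      have h3 := hN₁ v (hQN1.trans hQv)
      have h4 : rho ξ Q ≤ b * pot ξ v := by
        rw [hb, div_mul_eq_mul_div, le_div_iff₀ (by positivity)]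
        have := mul_le_mul_of_nonneg_left
          (show Λ * ratio ξ Q ≤ 64 * pot ξ v by linarith [pot_nonneg hξ v]) hρ.le
        linarith
      rw [if_neg fun h => by have := h.2.2; simp only [Int.cast_natCast] at this; linarith]
      linarith [green_le hξ v Q]
  have e1 := integral_add ((integrable_const (μ := V) (C * (δ * ratio ξ Q))).add
    (hmi.const_mul (rho ξ Q))) (hpi.const_mul b)
  have e2 := integral_add (integrable_const (μ := V) (C * (δ * ratio ξ Q)))
    (hmi.const_mul (rho ξ Q))
  simp only [Pi.add_apply] at e1
  rw [e1, e2, integral_const, smul_eq_mul, integral_const_mul, integral_const_mul] at hle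
  have hV1 : V.real Set.univ ≤ 1 := exitLaw_real_le_one hξ.integrable _ _ _
  refine hle.trans ?_
  have p1 : V.real Set.univ * (C * (δ * ratio ξ Q)) ≤ ε / 3 * rho ξ Q := by
    have : C * (δ * ratio ξ Q) ≤ ε / 3 * rho ξ Q := by
      have h5 : C * δ = ε / 48 := by rw [hδ]; field_simp
      rw [← mul_assoc, h5]
      have := mul_le_mul_of_nonneg_left hρl (show 0 ≤ ε / 3 by positivity)
      linarith
    exact (mul_le_of_le_one_left (by positivity) hV1).trans this
  have p2 := mul_le_mul_of_nonneg_left (hmid.trans hmid2) hρ.le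
  have p3 : b * ∫ v, pot ξ v ∂V ≤ ε / 3 * rho ξ Q := by
    have h6 : b ≤ 64 * C / Λ := by
      rw [hb, div_le_div_iff₀ (by positivity) hΛ0]
      have := mul_le_mul_of_nonneg_left hρu hΛ0.le
      linarith
    have h7 : 64 * C / Λ * C₀ ≤ ε / 3 := by
      rw [div_mul_eq_mul_div, div_le_iff₀ hΛ0, hΛ, mul_add]
      have : ε / 3 * (192 * C₀ * C / ε) = 64 * C₀ * C := by field_simp; norm_num
      rw [this]
      linarith
    have h8 : 0 ≤ 64 * C / Λ := by positivity
    calc b * ∫ v, pot ξ v ∂V ≤ 64 * C / Λ * (C₀ * rho ξ Q) :=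
          mul_le_mul h6 (hpot.trans hw) (integral_nonneg (pot_nonneg hξ)) h8
      _ = 64 * C / Λ * C₀ * rho ξ Q := by ring
      _ ≤ _ := mul_le_mul_of_nonneg_right h7 hρ.le
  linarith

end

end RandomWalk

/-! ### The capacitary potential of `{-Q, R}` -/

namespace RandomWalk

section

variable {ξ : Measure ℤ} [IsProbabilityMeasure ξ]

/-- The Green functions with poles at `y` and `y'`, combined with a constant. -/
noncomputable def greenComb (ξ : Measure ℤ) (y y' : ℤ) (a b c : ℝ) (z : ℤ) : ℝ :=
  a * green ξ z y + b * green ξ z y' + c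

lemma abs_greenComb_le (hξ : IsStepLaw ξ) (y y' : ℤ) (a b c : ℝ) :
    ∃ K, ∀ z, |greenComb ξ y y' a b c z| ≤ K := by
  obtain ⟨K, hK⟩ := abs_green_le hξ y
  obtain ⟨K', hK'⟩ := abs_green_le hξ y'
  refine ⟨|a| * K + |b| * K' + |c|, fun z => ?_⟩
  refine (abs_add_le _ _).trans (add_le_add ((abs_add_le _ _).trans (add_le_add ?_ ?_)) le_rfl)
  · rw [abs_mul]; exact mul_le_mul_of_nonneg_left (hK z) (abs_nonneg _)
  · rw [abs_mul]; exact mul_le_mul_of_nonneg_left (hK' z) (abs_nonneg _)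

lemma avg_greenComb (hξ : IsStepLaw ξ) (y y' : ℤ) (a b c : ℝ) (z : ℤ) :
    avg ξ (greenComb ξ y y' a b c) z =
      a * avg ξ (fun z => green ξ z y) z + b * avg ξ (fun z => green ξ z y') z + c := by
  obtain ⟨K, hK⟩ := abs_green_le hξ y
  obtain ⟨K', hK'⟩ := abs_green_le hξ y'
  have h := (linGrowth_of_bounded hK).const_mul a
  have h' := (linGrowth_of_bounded hK').const_mul b
  rw [← avg_const_mul, ← avg_const_mul, ← avg_add hξ.integrable h h']
  refine (avg_add hξ.integrable (h.add h') (linGrowth_const c) z).trans ?_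
  rw [avg_const]

lemma integral_greenComb (hξ : IsStepLaw ξ) {y y' : ℤ} {D : Set ℤ} (h0 : 0 ∉ D) (hy : y ∉ D)
    (hy' : y' ∉ D) (a b c : ℝ) (x : ℤ) : ∫ z, greenComb ξ y y' a b c z ∂(exitLaw ξ D x) =
      a * avg ξ (fun z => green ξ z y) x + b * avg ξ (fun z => green ξ z y') x + c := by
  obtain ⟨K, hK⟩ := abs_greenComb_le hξ y y' a b c
  have hne : D ≠ Set.univ := fun h => h0 (h ▸ Set.mem_univ _)
  rw [integral_exitLaw_eq hξ.integrable hK (D := D) (fun w hw => ?_) x (tendsto_aliveLaw hξ hne x),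
    avg_greenComb hξ]
  have e0 : w ≠ 0 := fun h => h0 (h ▸ hw)
  have e1 : w ≠ y := fun h => hy (h ▸ hw)
  have e2 : w ≠ y' := fun h => hy' (h ▸ hw)
  rw [avg_greenComb hξ, avg_green hξ, avg_green hξ, if_neg e0, if_neg e1, if_neg e2, greenComb]
  ring

lemma integrable_greenComb (hξ : IsStepLaw ξ) (y y' : ℤ) (a b c : ℝ) (D : Set ℤ) (x : ℤ) :
    Integrable (greenComb ξ y y' a b c) (exitLaw ξ D x) := by
  obtain ⟨K, hK⟩ := abs_greenComb_le hξ y y' a b c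
  have := isFiniteMeasure_exitLaw hξ.integrable D x
  exact Integrable.of_bound (measurable_of_countable _).aestronglyMeasurable K
    (Eventually.of_forall hK)

/-- The minimum principle for combinations of Green functions. -/
lemma greenComb_nonneg (hξ : IsStepLaw ξ) {y y' : ℤ} {a b c : ℝ} (h0 : 0 ≤ c)
    (hy : 0 ≤ greenComb ξ y y' a b c y) (hy' : 0 ≤ greenComb ξ y y' a b c y') (z : ℤ) :
    0 ≤ greenComb ξ y y' a b c z := by
  have hB : ∀ w ∈ ({y, 0, y'} : Set ℤ), 0 ≤ greenComb ξ y y' a b c w := by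
    rintro w (rfl | rfl | rfl)
    · exact hy
    · rw [greenComb, green_zero, green_zero, pot_zero hξ]; linarith
    · exact hy'
  by_cases hz : z ∈ ({y, 0, y'} : Set ℤ)
  · exact hB z hz
  have e : z ≠ y ∧ z ≠ 0 ∧ z ≠ y' := by
    simpa only [Set.mem_insert_iff, Set.mem_singleton_iff, not_or] using hz
  have h := integral_greenComb hξ (D := ({y, 0, y'} : Set ℤ)ᶜ) (y := y) (y' := y') (by simp)
    (by simp) (by simp) a b c z
  rw [avg_green hξ, avg_green hξ, if_neg e.1, if_neg e.2.1, if_neg e.2.2, add_zero, sub_zero,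
    add_zero, sub_zero] at h
  rw [greenComb, ← h]
  refine integral_nonneg_of_ae ?_
  filter_upwards [exitLaw_ae_mem ({y, 0, y'} : Set ℤ)ᶜ z] with w hw
  rw [compl_compl] at hw
  exact hB w hw

/-- The probability that the walk from `x` returns to `{-Q, 0, R}` at `0`. -/
noncomputable def hitZero (ξ : Measure ℤ) (Q R : ℕ) (x : ℤ) : ℝ :=
  (exitLaw ξ ({-(Q : ℤ), 0, (R : ℤ)} : Set ℤ)ᶜ x).real {0}

/-- The probability that the walk from `x` leaves `(-Q, R)` before visiting `0`. -/
noncomputable def escape (ξ : Measure ℤ) (Q R : ℕ) (x : ℤ) : ℝ :=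
  (exitLaw ξ (Set.Ioo (-(Q : ℤ)) R \ {0}) x).real (Set.Ioo (-(Q : ℤ)) R)ᶜ

/-- The determinant of the Green function on `{-Q, R}`. -/
noncomputable def greenDet (ξ : Measure ℤ) (Q R : ℕ) : ℝ :=
  rho ξ Q * rho ξ R - green ξ R (-Q) * green ξ (-Q) R

/-- The bounded function, harmonic off `{-Q, 0, R}`, that is `1` at `-Q` and `R` and `0` at `0`. -/
noncomputable def capPot (ξ : Measure ℤ) (Q R : ℕ) : ℤ → ℝ :=
  greenComb ξ R (-Q) ((rho ξ Q - green ξ R (-Q)) / greenDet ξ Q R)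
    ((rho ξ R - green ξ (-Q) R) / greenDet ξ Q R) 0

lemma capPot_right (hξ : IsStepLaw ξ) {Q R : ℕ} (hD : greenDet ξ Q R ≠ 0) :
    capPot ξ Q R R = 1 := by
  rw [capPot, greenComb, green_self hξ]
  field_simp
  rw [greenDet]; ring

lemma capPot_left (hξ : IsStepLaw ξ) {Q R : ℕ} (hD : greenDet ξ Q R ≠ 0) :
    capPot ξ Q R (-Q) = 1 := by
  rw [capPot, greenComb, green_self hξ, rho_neg]
  field_simp
  rw [greenDet]; ring

lemma capPot_zero (hξ : IsStepLaw ξ) (Q R : ℕ) : capPot ξ Q R 0 = 0 := by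
  rw [capPot, greenComb, green_zero, green_zero, pot_zero hξ]; ring

/-- On `{-Q,0,R}` the function `capPot` is the indicator of the complement of `0`, so optional
stopping gives its one-step mean at `x`. No restriction on `x` is needed, as the return time is at
least `1`. -/
lemma one_sub_hitZero (hξ : IsStepLaw ξ) {Q R : ℕ} (hQ : 0 < Q) (hR : 0 < R)
    (hD : greenDet ξ Q R ≠ 0) (x : ℤ) :
    1 - hitZero ξ Q R x =
      (rho ξ Q - green ξ R (-Q)) / greenDet ξ Q R * avg ξ (fun z => green ξ z R) x +
      (rho ξ R - green ξ (-Q) R) / greenDet ξ Q R * avg ξ (fun z => green ξ z (-Q)) x := by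
  set B : Set ℤ := {-(Q : ℤ), 0, (R : ℤ)} with hB
  have := isFiniteMeasure_exitLaw hξ.integrable Bᶜ x
  have h := integral_greenComb hξ (D := Bᶜ) (y := R) (y' := -Q) (by simp [hB]) (by simp [hB])
    (by simp [hB]) ((rho ξ Q - green ξ R (-Q)) / greenDet ξ Q R)
    ((rho ξ R - green ξ (-Q) R) / greenDet ξ Q R) 0 x
  rw [add_zero] at h
  rw [← h]
  have h1 : (exitLaw ξ Bᶜ x).real Set.univ = 1 :=
    exitLaw_real_univ hξ ((Set.ne_univ_iff_exists_notMem _).2 ⟨0, by simp [hB]⟩) x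
  have h2 : ∫ z, (1 - Set.indicator {0} (fun _ => (1 : ℝ)) z) ∂(exitLaw ξ Bᶜ x)
      = 1 - hitZero ξ Q R x := by
    rw [integral_sub (integrable_const _) ((integrable_const _).indicator .of_discrete),
      integral_const, h1, integral_indicator .of_discrete]
    simp [hitZero, hB, measureReal_def]
  rw [← h2]
  refine integral_congr_ae ?_
  filter_upwards [exitLaw_ae_mem Bᶜ x] with z hz
  rw [compl_compl] at hz
  change _ = capPot ξ Q R z
  rcases hz with rfl | rfl | rfl
  · rw [capPot_left hξ hD, Set.indicator_of_notMem (by simp; omega), sub_zero]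
  · rw [capPot_zero hξ]; simp
  · rw [capPot_right hξ hD, Set.indicator_of_notMem (by simp; omega), sub_zero]

lemma green_right_le (hξ : IsStepLaw ξ) (Q R : ℕ) : green ξ R (-Q) ≤ rho ξ Q := by
  have := green_le hξ R (-Q)
  rwa [rho_neg] at this

lemma greenDet_add (Q R : ℕ) : (rho ξ Q - green ξ R (-Q)) + (rho ξ R - green ξ (-Q) R) =
    rho ξ ((Q : ℤ) + R) := by
  simp only [rho, green, neg_neg]
  rw [show (R : ℤ) - -(Q : ℤ) = Q + R by ring, show -(Q : ℤ) - R = -(Q + R) by ring]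
  ring

lemma one_sub_hitZero_zero (hξ : IsStepLaw ξ) {Q R : ℕ} (hQ : 0 < Q) (hR : 0 < R)
    (hD : greenDet ξ Q R ≠ 0) :
    1 - hitZero ξ Q R 0 = rho ξ ((Q : ℤ) + R) / greenDet ξ Q R := by
  rw [one_sub_hitZero hξ hQ hR hD, avg_green hξ, avg_green hξ, green_zero, green_zero,
    pot_zero hξ, if_pos rfl, if_neg (by omega), if_neg (by omega), ← greenDet_add]
  ring

lemma capPot_le_one (hξ : IsStepLaw ξ) {Q R : ℕ} (hD : greenDet ξ Q R ≠ 0) (z : ℤ) :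
    capPot ξ Q R z ≤ 1 := by
  set p := (rho ξ Q - green ξ R (-Q)) / greenDet ξ Q R with hp
  set q := (rho ξ R - green ξ (-Q) R) / greenDet ξ Q R with hq
  have e : ∀ z, greenComb ξ R (-Q) (-p) (-q) 1 z = 1 - capPot ξ Q R z := fun z => by
    rw [capPot, greenComb, greenComb]; ring
  have := greenComb_nonneg hξ zero_le_one (y := R) (y' := -Q) (a := -p) (b := -q)
    (by rw [e, capPot_right hξ hD, sub_self]) (by rw [e, capPot_left hξ hD, sub_self]) z
  rw [e] at this
  linarith

/-- Both functions vanish at `0` and equal `1` at `R`, while at `-Q` the left one is at most `1`;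
the minimum principle does the rest. -/
lemma green_le_capPot_right (hξ : IsStepLaw ξ) {Q R : ℕ} (hD : greenDet ξ Q R ≠ 0)
    (hρ : 0 < rho ξ R) (z : ℤ) : green ξ z R / rho ξ R ≤ capPot ξ Q R z := by
  set p := (rho ξ Q - green ξ R (-Q)) / greenDet ξ Q R with hp
  set q := (rho ξ R - green ξ (-Q) R) / greenDet ξ Q R with hq
  have e : ∀ z, greenComb ξ R (-Q) (p - 1 / rho ξ R) q 0 z
      = capPot ξ Q R z - green ξ z R / rho ξ R := fun z => by
    rw [capPot, greenComb, greenComb]; ring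
  have := greenComb_nonneg hξ le_rfl (y := R) (y' := -Q) (a := p - 1 / rho ξ R) (b := q)
    (by rw [e, capPot_right hξ hD, green_self hξ, div_self hρ.ne', sub_self])
    (by rw [e, capPot_left hξ hD, sub_nonneg]; exact div_le_one_of_le₀ (green_le hξ _ _) hρ.le) z
  rw [e] at this
  linarith

lemma green_le_capPot_left (hξ : IsStepLaw ξ) {Q R : ℕ} (hD : greenDet ξ Q R ≠ 0)
    (hρ : 0 < rho ξ Q) (z : ℤ) : green ξ z (-Q) / rho ξ Q ≤ capPot ξ Q R z := by
  set p := (rho ξ Q - green ξ R (-Q)) / greenDet ξ Q R with hp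
  set q := (rho ξ R - green ξ (-Q) R) / greenDet ξ Q R with hq
  have e : ∀ z, greenComb ξ R (-Q) p (q - 1 / rho ξ Q) 0 z
      = capPot ξ Q R z - green ξ z (-Q) / rho ξ Q := fun z => by
    rw [capPot, greenComb, greenComb]; ring
  have := greenComb_nonneg hξ le_rfl (y := R) (y' := -Q) (a := p) (b := q - 1 / rho ξ Q)
    (by
      rw [e, capPot_right hξ hD, sub_nonneg]
      exact div_le_one_of_le₀ (green_right_le hξ Q R) hρ.le)
    (by rw [e, capPot_left hξ hD, green_self hξ, rho_neg, div_self hρ.ne', sub_self]) z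
  rw [e] at this
  linarith

/-- On leaving the window without `0`, the walk is either outside the window or at `0`. -/
lemma integral_window (hξ : IsStepLaw ξ) {Q R : ℕ} (hQ : 0 < Q) (hR : 0 < R) (x : ℤ) {f : ℤ → ℝ}
    (hf : Integrable f (exitLaw ξ (Set.Ioo (-(Q : ℤ)) R \ {0}) x)) :
    ∫ z, f z ∂(exitLaw ξ (Set.Ioo (-(Q : ℤ)) R \ {0}) x) =
      ∫ z in (Set.Ioo (-(Q : ℤ)) R)ᶜ, f z ∂(exitLaw ξ (Set.Ioo (-(Q : ℤ)) R \ {0}) x)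
        + (1 - escape ξ Q R x) * f 0 := by
  set W : Set ℤ := Set.Ioo (-(Q : ℤ)) R with hW
  set μ := exitLaw ξ (W \ {0}) x with hμ
  have := isFiniteMeasure_exitLaw hξ.integrable (W \ {0}) x
  have h1 : μ.real Set.univ = 1 := exitLaw_real_univ hξ
    ((Set.ne_univ_iff_exists_notMem _).2 ⟨0, fun h => h.2 rfl⟩) x
  have hae : W =ᵐ[μ] ({0} : Set ℤ) := by
    filter_upwards [exitLaw_ae_mem (W \ {0}) x] with z hz
    refine propext ⟨fun hzW => ?_, ?_⟩
    · by_contra hne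
      exact hz ⟨hzW, hne⟩
    · rintro rfl
      exact ⟨by omega, by omega⟩
  have h2 : μ.real {0} = 1 - escape ξ Q R x := by
    have := measureReal_add_measureReal_compl (μ := μ) (s := W) .of_discrete
    rw [h1, measureReal_congr hae] at this
    rw [escape]
    linarith
  rw [← integral_add_compl (s := W) .of_discrete hf, setIntegral_congr_set hae,
    integral_singleton, h2, smul_eq_mul]
  ring

/-- Eventually `a(-v) ≤ a(v)`; the constant absorbs the finitely many other `v`. -/
lemma exists_rho_le_pot (hξ : IsStepLaw ξ) : ∃ C : ℝ, 0 ≤ C ∧ ∀ v : ℕ,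
    rho ξ v ≤ C + 2 * pot ξ v := by
  obtain ⟨N₁, h₁⟩ := eventually_pot_ge hξ
  obtain ⟨N₂, h₂⟩ := eventually_pot_neg_le hξ (ε := 1 / 32) (by norm_num)
  have h0 : ∀ v ∈ Finset.range (max N₁ N₂), 0 ≤ rho ξ (v : ℕ) := fun v _ => rho_nonneg hξ _
  refine ⟨∑ v ∈ Finset.range (max N₁ N₂), rho ξ (v : ℕ), Finset.sum_nonneg h0, fun v => ?_⟩
  have hp := pot_nonneg hξ v
  rcases lt_or_ge v (max N₁ N₂) with h | h
  · have := Finset.single_le_sum h0 (Finset.mem_range.2 h)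
    linarith
  · have := h₁ v ((le_max_left _ _).trans h)
    have := h₂ v ((le_max_right _ _).trans h)
    have := Finset.sum_nonneg h0
    rw [rho]
    linarith

/-- Above `R`, subadditivity gives `ρ(R) - g(z,R) ≤ ρ(z-R)`. Below `-Q`, with `z = -Q-w`, one has
`ρ(Q) - g(z,-Q) = g(-w,Q)`: this is small if `a(-w)` is moderate, and otherwise `a(z) ≥ C₁ρ(Q)`, so
that the last term alone exceeds `1`. -/
lemma one_sub_capPot_le (hξ : IsStepLaw ξ) {Q R : ℕ} (hD : greenDet ξ Q R ≠ 0)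
    (hρQ : 0 < rho ξ Q) (hρR : 0 < rho ξ R) {C C₁ ε : ℝ} (hC0 : 0 ≤ C) (hC₁ : 0 < C₁) (hε : 0 ≤ ε)
    (hC : ∀ v : ℕ, rho ξ v ≤ C + 2 * pot ξ v)
    (hQ : ∀ w : ℕ, pot ξ (-w) ≤ (C₁ + 1) * rho ξ Q → green ξ (-w) Q ≤ ε * rho ξ Q)
    {z : ℤ} (hz : z ∉ Set.Ioo (-(Q : ℤ)) R) :
    1 - capPot ξ Q R z ≤
      C / rho ξ R + ε + 2 / rho ξ R * pot ξ (z - R) + 1 / (C₁ * rho ξ Q) * pot ξ z := by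
  have i1 : 0 ≤ 2 / rho ξ R * pot ξ (z - R) := mul_nonneg (by positivity) (pot_nonneg hξ _)
  have i2 : 0 ≤ 1 / (C₁ * rho ξ Q) * pot ξ z := mul_nonneg (by positivity) (pot_nonneg hξ _)
  have i3 : 0 ≤ C / rho ξ R := by positivity
  rcases le_or_gt (R : ℤ) z with hR | hR
  · have h1 := green_le_capPot_right hξ hD hρR z
    obtain ⟨v, hv⟩ := Int.eq_ofNat_of_zero_le (sub_nonneg.2 hR)
    have h2 := hC v
    rw [← hv] at h2
    have h3 : rho ξ R - green ξ z R ≤ rho ξ (z - R) := by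
      have := pot_add_le hξ z (-(z - R))
      rw [show z + -(z - R) = R by ring] at this
      simp only [rho, green]
      linarith
    have h4 : 1 - green ξ z R / rho ξ R ≤ C / rho ξ R + 2 / rho ξ R * pot ξ (z - R) := by
      rw [div_mul_eq_mul_div, ← add_div, one_sub_div hρR.ne']
      exact div_le_div_of_nonneg_right (h3.trans h2) hρR.le
    linarith
  have hzQ : z ≤ -(Q : ℤ) := by
    by_contra! h
    exact hz ⟨h, hR⟩
  obtain ⟨w, hw⟩ := Int.eq_ofNat_of_zero_le (show 0 ≤ -(z + Q) by omega)
  have hw' : -(w : ℤ) = z + Q := by rw [← hw]; ring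
  have h1 := green_le_capPot_left hξ hD hρQ z
  rcases le_or_gt (pot ξ (-w)) ((C₁ + 1) * rho ξ Q) with h2 | h2
  · have h3 := hQ w h2
    have h4 : 1 - green ξ z (-Q) / rho ξ Q ≤ ε := by
      rw [one_sub_div hρQ.ne', div_le_iff₀ hρQ]
      refine le_trans (le_of_eq ?_) h3
      rw [hw']
      simp only [rho, green, neg_neg]
      rw [show z + Q - (Q : ℤ) = z by ring, show z - -(Q : ℤ) = z + Q by ring]
      ring
    linarith
  · have h3 := pot_add_le hξ z Q
    rw [← hw'] at h3
    have h4 : pot ξ Q ≤ rho ξ Q := le_add_of_nonneg_right (pot_nonneg hξ _)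
    have h5 : C₁ * rho ξ Q ≤ pot ξ z := by linarith
    have h6 : 1 ≤ 1 / (C₁ * rho ξ Q) * pot ξ z := by
      rw [one_div_mul_eq_div, le_div_iff₀ (by positivity), one_mul]
      exact h5
    have h7 := div_nonneg (green_nonneg hξ z (-Q)) hρQ.le
    linarith

end

end RandomWalk

/-! ### Escape probabilities under the constraint, and the asymptotics -/

namespace RandomWalk

section

variable {ξ : Measure ℤ} [IsProbabilityMeasure ξ]

/-- The potential function modified at `0`. -/
noncomputable def potDagger (ξ : Measure ℤ) (x : ℤ) : ℝ := (if x = 0 then 1 else 0) + pot ξ x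

lemma potDagger_nonneg (hξ : IsStepLaw ξ) (x : ℤ) : 0 ≤ potDagger ξ x :=
  add_nonneg (by positivity) (pot_nonneg hξ x)

lemma avg_pot_eq (hξ : IsStepLaw ξ) (x : ℤ) : avg ξ (pot ξ) x = potDagger ξ x := by
  rw [avg_pot hξ, potDagger, add_comm]

lemma avg_green_eq (hξ : IsStepLaw ξ) {x y : ℤ} (h : x ≠ y) : avg ξ (fun z => green ξ z y) x =
    potDagger ξ x + (pot ξ (-y) - pot ξ (x - y)) := by
  rw [avg_green hξ, if_neg h, potDagger, green]; ring

/-- The constraint replaces both one-step means in `one_sub_hitZero` by `a†(x)(1 ± δ)`; their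
coefficients are nonnegative and sum to `1 - H^0_B(0)`. -/
lemma one_sub_hitZero_mem (hξ : IsStepLaw ξ) {Q R : ℕ} (hQ : 0 < Q) (hR : 0 < R)
    (hD : 0 < greenDet ξ Q R) {x : ℤ} (hxQ : -(Q : ℤ) < x) (hxR : x < R) {δ : ℝ}
    (hcQ : |pot ξ Q - pot ξ (x + Q)| ≤ δ * potDagger ξ x)
    (hcR : |pot ξ (-R) - pot ξ (x - R)| ≤ δ * potDagger ξ x) :
    (1 - δ) * (potDagger ξ x * (1 - hitZero ξ Q R 0)) ≤ 1 - hitZero ξ Q R x ∧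
    1 - hitZero ξ Q R x ≤ (1 + δ) * (potDagger ξ x * (1 - hitZero ξ Q R 0)) := by
  have hp : 0 ≤ (rho ξ Q - green ξ R (-Q)) / greenDet ξ Q R :=
    div_nonneg (sub_nonneg.2 (green_right_le hξ Q R)) hD.le
  have hq : 0 ≤ (rho ξ R - green ξ (-Q) R) / greenDet ξ Q R :=
    div_nonneg (sub_nonneg.2 (green_le hξ _ _)) hD.le
  rw [one_sub_hitZero_zero hξ hQ hR hD.ne', ← greenDet_add, add_div,
    one_sub_hitZero hξ hQ hR hD.ne', avg_green_eq hξ hxR.ne, avg_green_eq hξ hxQ.ne', neg_neg,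
    sub_neg_eq_add]
  obtain ⟨q1, q2⟩ := abs_le.1 hcQ
  obtain ⟨r1, r2⟩ := abs_le.1 hcR
  constructor
  · have h1 := mul_le_mul_of_nonneg_left r1 hp
    have h2 := mul_le_mul_of_nonneg_left q1 hq
    linarith
  · have h1 := mul_le_mul_of_nonneg_left r2 hp
    have h2 := mul_le_mul_of_nonneg_left q2 hq
    linarith

/-- Stop `g(·,y)`: it vanishes at `0` and is at most `ρ(y)` outside the window, while its one-step
mean at `x` is at least `a†(x)/2`. -/
lemma potDagger_le_escape (hξ : IsStepLaw ξ) {Q R : ℕ} (hQ : 0 < Q) (hR : 0 < R) {x y : ℤ}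
    (hy : y ∉ Set.Ioo (-(Q : ℤ)) R) (hxy : x ≠ y)
    (hc : |pot ξ (-y) - pot ξ (x - y)| ≤ 1 / 2 * potDagger ξ x) :
    potDagger ξ x ≤ 2 * rho ξ y * escape ξ Q R x := by
  set μ := exitLaw ξ (Set.Ioo (-(Q : ℤ)) R \ {0}) x with hμ
  have := isFiniteMeasure_exitLaw hξ.integrable (Set.Ioo (-(Q : ℤ)) R \ {0}) x
  have h1 := integral_greenComb hξ (D := Set.Ioo (-(Q : ℤ)) R \ {0}) (y := y) (y' := y)
    (fun h => h.2 rfl) (fun h => hy h.1) (fun h => hy h.1) 1 0 0 x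
  have hi := integrable_greenComb hξ y y 1 0 0 (Set.Ioo (-(Q : ℤ)) R \ {0}) x
  have hg : greenComb ξ y y 1 0 0 = fun z => green ξ z y := funext fun z => by
    rw [greenComb]; ring
  rw [hg] at h1 hi
  rw [integral_window hξ hQ hR x hi, green_zero, pot_zero hξ, avg_green_eq hξ hxy] at h1
  have h2 : ∫ z in (Set.Ioo (-(Q : ℤ)) R)ᶜ, green ξ z y ∂μ ≤
      ∫ z in (Set.Ioo (-(Q : ℤ)) R)ᶜ, rho ξ y ∂μ :=
    integral_mono hi.restrict (integrable_const _) fun z => green_le hξ z y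
  rw [setIntegral_const, smul_eq_mul] at h2
  have h3 : μ.real (Set.Ioo (-(Q : ℤ)) R)ᶜ = escape ξ Q R x := rfl
  rw [h3] at h2
  have := (abs_le.1 hc).1
  linarith

/-- The difference of the two probabilities is the mean of `1 - capPot` over the exit points outside
the window, hence nonnegative. The upper bound integrates `one_sub_capPot_le`, with the means of `a`
and `a(·-R)` at exit controlled by optional stopping. -/
lemma escape_sub_mem (hξ : IsStepLaw ξ) {Q R : ℕ} (hQ : 0 < Q) (hR : 0 < R)
    (hD : 0 < greenDet ξ Q R) (hρQ : 0 < rho ξ Q) (hρR : 0 < rho ξ R) {C C₁ ε : ℝ} (hC0 : 0 ≤ C)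
    (hC₁ : 0 < C₁) (hε : 0 ≤ ε) (hC : ∀ v : ℕ, rho ξ v ≤ C + 2 * pot ξ v)
    (hF : ∀ w : ℕ, pot ξ (-w) ≤ (C₁ + 1) * rho ξ Q → green ξ (-w) Q ≤ ε * rho ξ Q)
    {x : ℤ} (hxQ : -(Q : ℤ) < x) (hxR : x < R) {δ : ℝ} (hδ0 : 0 ≤ δ) (hδ : δ ≤ 1 / 2)
    (hcQ : |pot ξ Q - pot ξ (x + Q)| ≤ δ * potDagger ξ x)
    (hcR : |pot ξ (-R) - pot ξ (x - R)| ≤ δ * potDagger ξ x) :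
    1 - hitZero ξ Q R x ≤ escape ξ Q R x ∧
    escape ξ Q R x ≤ 1 - hitZero ξ Q R x + (C / rho ξ R + ε + 4 * δ + 2 * pot ξ (-R) / rho ξ R
      + 2 / C₁) * escape ξ Q R x := by
  have hA := potDagger_nonneg hξ x
  have hδA : δ * potDagger ξ x ≤ 1 / 2 * potDagger ξ x := mul_le_mul_of_nonneg_right hδ hA
  have hAR := potDagger_le_escape hξ hQ hR (y := R) (by simp) hxR.ne (hcR.trans hδA)
  have hAQ := potDagger_le_escape hξ hQ hR (y := -Q) (by simp) hxQ.ne'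
    (by rw [neg_neg, sub_neg_eq_add]; exact hcQ.trans hδA)
  rw [rho_neg] at hAQ
  set W : Set ℤ := Set.Ioo (-(Q : ℤ)) R with hW
  set μ := exitLaw ξ (W \ {0}) x with hμ
  have hfin := isFiniteMeasure_exitLaw hξ.integrable (W \ {0}) x
  have hesc : μ.real Wᶜ = escape ξ Q R x := rfl
  have he0 : 0 ≤ escape ξ Q R x := measureReal_nonneg
  have hki : Integrable (capPot ξ Q R) μ := integrable_greenComb hξ _ _ _ _ _ _ _
  have hk := integral_greenComb hξ (D := W \ {0}) (y := R) (y' := -Q) (fun h => h.2 rfl)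
    (fun h => by simpa [hW] using h.1) (fun h => by simpa [hW] using h.1)
    ((rho ξ Q - green ξ R (-Q)) / greenDet ξ Q R)
    ((rho ξ R - green ξ (-Q) R) / greenDet ξ Q R) 0 x
  rw [add_zero, ← one_sub_hitZero hξ hQ hR hD.ne'] at hk
  have hk : ∫ z, capPot ξ Q R z ∂μ = 1 - hitZero ξ Q R x := hk
  rw [integral_window hξ hQ hR x hki, capPot_zero hξ, mul_zero, add_zero] at hk
  have hone : ∫ z in Wᶜ, (1 - capPot ξ Q R z) ∂μ = escape ξ Q R x - (1 - hitZero ξ Q R x) := by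
    rw [integral_sub (integrable_const _) hki.restrict, hk, setIntegral_const, hesc, smul_eq_mul,
      mul_one]
  have hge : 0 ≤ ∫ z in Wᶜ, (1 - capPot ξ Q R z) ∂μ :=
    integral_nonneg fun z => sub_nonneg.2 (capPot_le_one hξ hD.ne' z)
  refine ⟨by linarith, ?_⟩
  obtain ⟨hpi, hpot⟩ := integral_exitLaw_le hξ.integrable (linGrowth_pot hξ) (pot_nonneg hξ)
    (D := W \ {0}) (fun z hz => by rw [avg_pot hξ, if_neg (show z ≠ 0 from hz.2), add_zero]) x
  rw [avg_pot_eq hξ, integral_window hξ hQ hR x hpi, pot_zero hξ, mul_zero, add_zero] at hpot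
  obtain ⟨hsi, hshift⟩ := integral_exitLaw_le hξ.integrable ((linGrowth_pot hξ).translate (-R))
    (fun _ => pot_nonneg hξ _) (D := W \ {0}) (fun z hz => by
      have h1 : z < R := hz.1.2
      rw [avg_translate, avg_pot hξ, if_neg (by omega), add_zero]) x
  rw [avg_translate, avg_pot hξ, if_neg (show x + -(R : ℤ) ≠ 0 by omega), add_zero,
    integral_window hξ hQ hR x hsi, zero_add] at hshift
  simp only [← sub_eq_add_neg] at hsi hshift
  have hbound : ∫ z in Wᶜ, (1 - capPot ξ Q R z) ∂μ ≤ ∫ z in Wᶜ, ((C / rho ξ R + ε) +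
      2 / rho ξ R * pot ξ (z - R) + 1 / (C₁ * rho ξ Q) * pot ξ z) ∂μ := by
    refine setIntegral_mono_on (((integrable_const _).sub hki).integrableOn)
      ((((integrable_const _).add (hsi.const_mul _)).add (hpi.const_mul _)).integrableOn)
      .of_discrete fun z hz => ?_
    exact one_sub_capPot_le hξ hD.ne' hρQ hρR hC0 hC₁ hε hC hF hz
  have e1 := integral_add (((integrable_const (C / rho ξ R + ε)).add
    (hsi.const_mul (2 / rho ξ R))).restrict (s := Wᶜ))
    ((hpi.const_mul (1 / (C₁ * rho ξ Q))).restrict (s := Wᶜ))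
  have e2 := integral_add ((integrable_const (C / rho ξ R + ε)).restrict (s := Wᶜ))
    ((hsi.const_mul (2 / rho ξ R)).restrict (s := Wᶜ))
  simp only [Pi.add_apply] at e1
  rw [hone, e1, e2, setIntegral_const, hesc, smul_eq_mul, integral_const_mul, integral_const_mul]
    at hbound
  -- The contribution of `0` is subtracted from the mean of `a(·-R)`: there remains `a(x-R) -
  -- a(-R)`, small by the constraint, plus `a(-R)` times the escape probability.
  have hs : ∫ z in Wᶜ, pot ξ (z - R) ∂μ ≤
      δ * (2 * rho ξ R * escape ξ Q R x) + escape ξ Q R x * pot ξ (-R) := by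
    have h1 := (abs_le.1 hcR).1
    have h2 := mul_le_mul_of_nonneg_left hAR hδ0
    linarith
  have b1 : 2 / rho ξ R * ∫ z in Wᶜ, pot ξ (z - R) ∂μ ≤
      (4 * δ + 2 * pot ξ (-R) / rho ξ R) * escape ξ Q R x := by
    refine (mul_le_mul_of_nonneg_left hs (by positivity)).trans (le_of_eq ?_)
    field_simp
    ring
  have b2 : 1 / (C₁ * rho ξ Q) * ∫ z in Wᶜ, pot ξ z ∂μ ≤ 2 / C₁ * escape ξ Q R x := by
    refine (mul_le_mul_of_nonneg_left (hpot.trans hAQ) (by positivity)).trans (le_of_eq ?_)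
    field_simp
  linarith

lemma tendsto_rho (hξ : IsStepLaw ξ) : Tendsto (fun n : ℕ => rho ξ n) atTop atTop :=
  tendsto_atTop_mono (rho_ge hξ)
    (((tendsto_ratio hξ).comp tendsto_natCast_atTop_atTop).const_mul_atTop (by norm_num))

lemma eventually_pot_neg_le_rho (hξ : IsStepLaw ξ) {ε : ℝ} (hε : 0 < ε) :
    ∃ N₀ : ℕ, ∀ w : ℕ, N₀ ≤ w → pot ξ (-w) ≤ ε * rho ξ w := by
  obtain ⟨N₀, h⟩ := eventually_pot_neg_le hξ (ε := ε / 16) (by positivity)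
  refine ⟨N₀, fun w hw => (h w hw).trans ?_⟩
  have := mul_le_mul_of_nonneg_left (rho_ge hξ w) hε.le
  linarith

/-- The factor `g(-Q,R)` is at most `a(-Q) + a(-R)`, and `g(R,-Q)` is at most both `ρ(Q)` and
`ρ(R)`, so their product is at most `2ε ρ(Q)ρ(R)`. -/
lemma greenDet_mem (hξ : IsStepLaw ξ) {Q R : ℕ} {ε : ℝ} (hQ : pot ξ (-Q) ≤ ε * rho ξ Q)
    (hR : pot ξ (-R) ≤ ε * rho ξ R) :
    (1 - 2 * ε) * (rho ξ Q * rho ξ R) ≤ greenDet ξ Q R ∧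
      greenDet ξ Q R ≤ rho ξ Q * rho ξ R := by
  have h1 : green ξ (-Q) R ≤ pot ξ (-Q) + pot ξ (-R) := by
    rw [green]; linarith [pot_nonneg hξ (-(Q : ℤ) - R)]
  have h2 := green_nonneg hξ (-(Q : ℤ)) R
  have h3 := green_nonneg hξ R (-(Q : ℤ))
  have h4 := green_right_le hξ Q R
  have h5 := green_le_left hξ R (-(Q : ℤ))
  have e1 : green ξ R (-Q) * pot ξ (-Q) ≤ rho ξ R * (ε * rho ξ Q) :=
    mul_le_mul h5 hQ (pot_nonneg hξ _) (rho_nonneg hξ _)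
  have e2 : green ξ R (-Q) * pot ξ (-R) ≤ rho ξ Q * (ε * rho ξ R) :=
    mul_le_mul h4 hR (pot_nonneg hξ _) (rho_nonneg hξ _)
  have e3 := mul_le_mul_of_nonneg_left h1 h3
  have e4 := mul_nonneg h3 h2
  rw [greenDet]
  constructor <;> linarith

lemma abs_ratio_sub_one_lt {h A E δ e ε : ℝ} (hA : 0 < A) (he : 0 < e) (he1 : e ≤ 1 / 8)
    (hε : 4 * e < ε) (hδ : δ ≤ e) (h1 : (1 - δ) * A ≤ h) (h2 : h ≤ (1 + δ) * A) (h3 : h ≤ E)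
    (h4 : E ≤ h + e * E) : |E / A - 1| < ε := by
  have h5 : (1 - e) * A ≤ E := by nlinarith
  have h6 : E ≤ (1 + 4 * e) * A := by
    have : (1 - e) * E ≤ (1 - e) * ((1 + 4 * e) * A) := by nlinarith
    exact le_of_mul_le_mul_left this (by linarith)
  have h7 : E / A ≤ 1 + 4 * e := (div_le_iff₀ hA).2 h6
  have h8 : 1 - e ≤ E / A := (le_div_iff₀ hA).2 h5
  rw [abs_lt]
  constructor <;> linarith

lemma abs_capacity_ratio_sub_one_lt {α β s p q t D e ε : ℝ} (he : 0 < e) (he1 : e ≤ 1 / 8)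
    (hε : 4 * e < ε) (hα : 0 < α) (hβ : 0 < β) (hs : 0 < s) (hp : (1 - e / 10) * α ≤ p)
    (hp' : p ≤ α) (hq : (1 - e / 10) * β ≤ q) (hq' : q ≤ β) (ht : (1 - e / 10) * s ≤ t)
    (ht' : t ≤ s) (hD : (1 - e / 5) * (α * β) ≤ D) (hD' : D ≤ α * β) :
    |s * (p * q) / (D * t) - 1| < ε := by
  have he10 : 0 < 1 - e / 10 := by linarith
  have he5 : 0 < 1 - e / 5 := by linarith
  have hαβ : 0 < α * β := mul_pos hα hβ
  have p0 : 0 < p := (mul_pos he10 hα).trans_le hp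
  have q0 : 0 < q := (mul_pos he10 hβ).trans_le hq
  have t0 : 0 < t := (mul_pos he10 hs).trans_le ht
  have D0 : 0 < D := (mul_pos he5 hαβ).trans_le hD
  have u1 : p * q ≤ α * β := mul_le_mul hp' hq' q0.le hα.le
  have u2 : (1 - e / 10) * α * ((1 - e / 10) * β) ≤ p * q :=
    mul_le_mul hp hq (by positivity) p0.le
  have v1 : (1 - e / 5) * D ≤ p * q := by
    have h1 := mul_le_mul_of_nonneg_left hD' he5.le
    have h2 := mul_nonneg (sq_nonneg (e / 10)) hαβ.le
    linarith
  have v2 : (1 - e / 5) * (p * q) ≤ D := (mul_le_mul_of_nonneg_left u1 he5.le).trans hD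
  have w1 : (1 - e / 5) * D * t ≤ p * q * s := mul_le_mul v1 ht' t0.le (by positivity)
  have w2 : (1 - e / 5) * (p * q) * ((1 - e / 10) * s) ≤ D * t :=
    mul_le_mul v2 ht (by positivity) D0.le
  have hden : 0 < D * t := mul_pos D0 t0
  have hnum : 0 < s * (p * q) := by positivity
  have w3 : s * (p * q) ≤ (1 + e) * (D * t) := by
    have c1 : 1 ≤ (1 + e) * ((1 - e / 10) * (1 - e / 5)) := by nlinarith
    have c2 := mul_le_mul_of_nonneg_right c1 hnum.le
    have c3 := mul_le_mul_of_nonneg_left w2 (show 0 ≤ 1 + e by positivity)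
    linarith
  exact abs_ratio_sub_one_lt (δ := e) hden he he1 hε le_rfl
    (by linarith [mul_pos he hden]) w3 le_rfl (by linarith [mul_pos he hnum])

theorem escape_asymptotics (hξ : IsStepLaw ξ) (ε : ℝ) (hε : 0 < ε) :
    ∃ δ : ℝ, 0 < δ ∧ ∃ N : ℕ, ∀ Q R : ℕ, 0 < Q → 0 < R → N ≤ min Q R →
      ∀ x : ℤ, -(Q : ℤ) < x → x < (R : ℤ) → potDagger ξ x ≠ 0 →
        |pot ξ Q - pot ξ (x + Q)| + |pot ξ (-R) - pot ξ (x - R)| ≤ δ * |potDagger ξ x| →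
        |escape ξ Q R x / (potDagger ξ x * (1 - hitZero ξ Q R 0)) - 1| < ε ∧
        |potDagger ξ x * (1 - hitZero ξ Q R 0) /
            (potDagger ξ x * (pot ξ ((Q : ℤ) + R) / (pot ξ Q * pot ξ R))) - 1| < ε := by
  set e := min ε 1 / 8 with he
  have he0 : 0 < e := by positivity
  have he1 : e ≤ 1 / 8 := by rw [he]; linarith [min_le_right ε 1]
  have heε : 4 * e < ε := by rw [he]; linarith [min_le_left ε 1]
  obtain ⟨C, hC0, hC⟩ := exists_rho_le_pot hξ
  obtain ⟨N₁, hN₁⟩ := green_neg_le_of_pot_le hξ (C₀ := 10 / e + 1) (ε := e / 5) (by positivity)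
    (by positivity)
  obtain ⟨N₂, hN₂⟩ := eventually_pot_neg_le_rho hξ (ε := e / 10) (by positivity)
  obtain ⟨N₃, hN₃⟩ := eventually_atTop.1 ((tendsto_rho hξ).eventually_ge_atTop (5 * C / e + 1))
  -- The five error terms of `escape_sub_mem` are at most `e/5` each: `4δ = e/5` for `δ = e/20`,
  -- `2/C₁ = e/5` for `C₁ = 10/e`, the negative-side ratio is `e/10`, and large `ρ(R)` handles
  -- `C/ρ(R)`.
  refine ⟨e / 20, by positivity, max N₁ (max N₂ N₃), fun Q R hQ hR hN x hxQ hxR hx hc => ?_⟩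
  obtain ⟨hNQ, hNR⟩ := le_min_iff.1 hN
  simp only [max_le_iff] at hNQ hNR
  obtain ⟨q1, q2, q3⟩ := hNQ
  obtain ⟨-, r2, r3⟩ := hNR
  have hC5 : 0 ≤ 5 * C / e := by positivity
  have hρQ : 0 < rho ξ Q := by linarith [hN₃ Q q3]
  have hρR : 0 < rho ξ R := by linarith [hN₃ R r3]
  have hS := hN₂ (Q + R) (by omega)
  have hρS : 0 < rho ξ ((Q + R : ℕ) : ℤ) := by linarith [hN₃ (Q + R) (by omega)]
  push_cast at hS hρS
  have hbQ := hN₂ Q q2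
  have hbR := hN₂ R r2
  obtain ⟨d1, d2⟩ := greenDet_mem hξ hbQ hbR
  have hP : 0 < rho ξ Q * rho ξ R := mul_pos hρQ hρR
  have hD : 0 < greenDet ξ Q R := by nlinarith
  have hA : 0 < potDagger ξ x := (potDagger_nonneg hξ x).lt_of_ne' hx
  rw [abs_of_pos hA] at hc
  have hcQ : |pot ξ Q - pot ξ (x + Q)| ≤ e / 20 * potDagger ξ x := by
    linarith [abs_nonneg (pot ξ (-R) - pot ξ (x - R))]
  have hcR : |pot ξ (-R) - pot ξ (x - R)| ≤ e / 20 * potDagger ξ x := by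
    linarith [abs_nonneg (pot ξ Q - pot ξ (x + Q))]
  have hH : 0 < 1 - hitZero ξ Q R 0 := by
    rw [one_sub_hitZero_zero hξ hQ hR hD.ne']; exact div_pos hρS hD
  have aQ : (1 - e / 10) * rho ξ Q ≤ pot ξ Q := by rw [rho] at hbQ ⊢; linarith
  have aR : (1 - e / 10) * rho ξ R ≤ pot ξ R := by rw [rho] at hbR ⊢; linarith
  have aS : (1 - e / 10) * rho ξ ((Q : ℤ) + R) ≤ pot ξ ((Q : ℤ) + R) := by
    rw [rho] at hS ⊢; linarith
  have aQ' : pot ξ Q ≤ rho ξ Q := le_add_of_nonneg_right (pot_nonneg hξ _)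
  have aR' : pot ξ R ≤ rho ξ R := le_add_of_nonneg_right (pot_nonneg hξ _)
  have aS' : pot ξ ((Q : ℤ) + R) ≤ rho ξ ((Q : ℤ) + R) :=
    le_add_of_nonneg_right (pot_nonneg hξ _)
  have pQ : 0 < pot ξ Q := (mul_pos (by linarith) hρQ).trans_le aQ
  have pR : 0 < pot ξ R := (mul_pos (by linarith) hρR).trans_le aR
  have pS : 0 < pot ξ ((Q : ℤ) + R) := (mul_pos (by linarith) hρS).trans_le aS
  constructor
  · obtain ⟨h1, h2⟩ := one_sub_hitZero_mem hξ hQ hR hD hxQ hxR hcQ hcR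
    obtain ⟨h3, h4⟩ := escape_sub_mem hξ hQ hR hD hρQ hρR hC0 (C₁ := 10 / e) (by positivity)
      (ε := e / 5) (by positivity) hC (fun w hw => hN₁ Q q1 w hw) hxQ hxR (by positivity)
      (by linarith) hcQ hcR
    have hE : 0 ≤ escape ξ Q R x := measureReal_nonneg
    refine abs_ratio_sub_one_lt (mul_pos hA hH) he0 he1 heε (by linarith) h1 h2 h3
      (h4.trans (add_le_add le_rfl (mul_le_mul_of_nonneg_right ?_ hE)))
    have t1 : C / rho ξ R ≤ e / 5 := by
      rw [div_le_iff₀ hρR]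
      have h5 := mul_le_mul_of_nonneg_left (hN₃ R r3) (show 0 ≤ e / 5 by positivity)
      have h6 : e / 5 * (5 * C / e + 1) = C + e / 5 := by field_simp
      linarith
    have t2 : 2 * pot ξ (-R) / rho ξ R ≤ e / 5 := by
      rw [div_le_iff₀ hρR]; linarith
    have t3 : 2 / (10 / e) = e / 5 := by field_simp; norm_num
    linarith
  · have hT : potDagger ξ x * (1 - hitZero ξ Q R 0) /
        (potDagger ξ x * (pot ξ ((Q : ℤ) + R) / (pot ξ Q * pot ξ R))) =
        rho ξ ((Q : ℤ) + R) * (pot ξ Q * pot ξ R) / (greenDet ξ Q R * pot ξ ((Q : ℤ) + R)) := by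
      rw [one_sub_hitZero_zero hξ hQ hR hD.ne']
      field_simp
    rw [hT]
    exact abs_capacity_ratio_sub_one_lt he0 he1 heε hρQ hρR hρS aQ aQ' aR aR' aS aS'
      (by linarith) d2

end

end RandomWalk

/-! ### From the random variables to the law of the increments -/

namespace RandomWalk

section

variable {Ω : Type*} [MeasurableSpace Ω] {P : Measure Ω} [IsProbabilityMeasure P]
  {X : ℕ → Ω → ℤ}

lemma measurable_walk (hX : ∀ n, Measurable (X n)) (x : ℤ) (n : ℕ) : Measurable (walk X x n) :=
  (Finset.measurable_sum _ fun k _ => hX k).const_add x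

/-- The event that the walk from `x` is in `D` at the times `1, …, n`. -/
def aliveEvent (X : ℕ → Ω → ℤ) (D : Set ℤ) (x : ℤ) (n : ℕ) : Set Ω :=
  {ω | ∀ m, 1 ≤ m → m ≤ n → walk X x m ω ∈ D}

lemma measurableSet_aliveEvent (hX : ∀ n, Measurable (X n)) (D : Set ℤ) (x : ℤ) (n : ℕ) :
    MeasurableSet (aliveEvent X D x n) := by
  have : aliveEvent X D x n = ⋂ m, ⋂ (_ : 1 ≤ m), ⋂ (_ : m ≤ n), walk X x m ⁻¹' D := by
    ext ω; simp [aliveEvent]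
  rw [this]
  exact .iInter fun m => .iInter fun _ => .iInter fun _ => measurable_walk hX x m .of_discrete

lemma isProbabilityMeasure_map (hX : IsAdmissible P X) : IsProbabilityMeasure (P.map (X 0)) :=
  Measure.isProbabilityMeasure_map (hX.measurable 0).aemeasurable

/-- The first two events depend only on the increments with index below `n`, which are independent
of `X n`. -/
lemma measure_alive_inter (hX : IsAdmissible P X) (D : Set ℤ) (x : ℤ) (n : ℕ) (s t : Set ℤ) :
    P (aliveEvent X D x n ∩ (walk X x n ⁻¹' s ∩ X n ⁻¹' t)) =
      P (aliveEvent X D x n ∩ walk X x n ⁻¹' s) * P.map (X 0) t := by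
  have hind := hX.indep.indepFun_finset (Finset.range n) {n} (by simp) hX.measurable
  set T : Ω → (Finset.range n → ℤ) := fun ω i => X i ω with hT
  set U : Ω → (({n} : Finset ℕ) → ℤ) := fun ω i => X i ω with hU
  -- Extension by `0` of a finite vector of increments, so that its partial sums can be written like
  -- the walk.
  set ext : (Finset.range n → ℤ) → ℕ → ℤ := fun v k => if h : k ∈ Finset.range n then v ⟨k, h⟩ else 0
    with hext
  set G : Set (Finset.range n → ℤ) := {v | (∀ m, 1 ≤ m → m ≤ n →
    x + ∑ k ∈ Finset.range m, ext v k ∈ D) ∧ x + ∑ k ∈ Finset.range n, ext v k ∈ s} with hG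
  have hw : ∀ ω m, m ≤ n → x + ∑ k ∈ Finset.range m, ext (T ω) k = walk X x m ω := by
    intro ω m hm
    rw [walk]
    congr 1
    refine Finset.sum_congr rfl fun k hk => ?_
    have : k ∈ Finset.range n := Finset.mem_range.2 ((Finset.mem_range.1 hk).trans_le hm)
    simp only [hext, dif_pos this, hT]
  have e1 : T ⁻¹' G = aliveEvent X D x n ∩ walk X x n ⁻¹' s := by
    ext ω
    simp only [hG, Set.mem_preimage, Set.mem_ofPred_eq, aliveEvent, Set.mem_inter_iff]
    rw [hw ω n le_rfl]
    exact and_congr_left fun _ => forall_congr' fun m => forall_congr' fun _ =>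
      forall_congr' fun hm => by rw [hw ω m hm]
  have e2 : U ⁻¹' {v | v ⟨n, by simp⟩ ∈ t} = X n ⁻¹' t := rfl
  have h := hind.measure_inter_preimage_eq_mul G {v | v ⟨n, by simp⟩ ∈ t} .of_discrete
    (measurableSet_preimage (measurable_pi_apply _) .of_discrete)
  rw [e1, e2, Set.inter_assoc] at h
  rw [h, ← (hX.identDistrib n).map_eq, Measure.map_apply (hX.measurable n) .of_discrete]

lemma walk_succ (x : ℤ) (n : ℕ) (ω : Ω) : walk X x (n + 1) ω = walk X x n ω + X n ω := by
  rw [walk, walk, Finset.sum_range_succ, add_assoc]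

lemma map_walk_succ (hX : IsAdmissible P X) (D : Set ℤ) (x : ℤ) (n : ℕ) :
    (P.restrict (aliveEvent X D x n)).map (walk X x (n + 1)) =
      (P.restrict (aliveEvent X D x n)).map (walk X x n) ∗ P.map (X 0) := by
  have := isProbabilityMeasure_map hX
  have hm := measurable_walk hX.measurable x n
  have hA := measurableSet_aliveEvent hX.measurable D x n
  have hprod : ((P.restrict (aliveEvent X D x n)).map (walk X x n)).prod (P.map (X 0)) =
      (P.restrict (aliveEvent X D x n)).map fun ω => (walk X x n ω, X n ω) := by
    refine Measure.prod_eq fun s t hs ht => ?_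
    have hst := hm.prodMk (hX.measurable n) (hs.prod ht)
    rw [Measure.map_apply (hm.prodMk (hX.measurable n)) (hs.prod ht), Measure.restrict_apply hst,
      Measure.map_apply hm hs, Measure.restrict_apply (hm hs), Set.inter_comm,
      Set.inter_comm (walk X x n ⁻¹' s), ← measure_alive_inter hX]
    rfl
  rw [Measure.conv, hprod, Measure.map_map (by fun_prop) (hm.prodMk (hX.measurable n))]
  congr 1
  exact funext fun ω => walk_succ x n ω

lemma aliveEvent_succ (D : Set ℤ) (x : ℤ) (n : ℕ) :
    aliveEvent X D x (n + 1) = walk X x (n + 1) ⁻¹' D ∩ aliveEvent X D x n := by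
  ext ω
  refine ⟨fun h => ⟨h _ (by omega) le_rfl, fun m h1 h2 => h m h1 (by omega)⟩, fun h m h1 h2 => ?_⟩
  rcases h2.lt_or_eq with h3 | rfl
  · exact h.2 m h1 (by omega)
  · exact h.1

/-- The law of the killed walk. -/
lemma map_walk (hX : IsAdmissible P X) (D : Set ℤ) (x : ℤ) (n : ℕ) :
    (P.restrict (aliveEvent X D x n)).map (walk X x n) = aliveLaw (P.map (X 0)) D x n := by
  have := isProbabilityMeasure_map hX
  induction n with
  | zero =>
    have h1 : aliveEvent X D x 0 = Set.univ := Set.eq_univ_of_forall fun ω m h1 h2 => by omega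
    have h2 : walk X x 0 = fun _ => x := funext fun ω => by simp [walk]
    rw [h1, h2, Measure.restrict_univ, Measure.map_const, measure_univ, one_smul, aliveLaw_zero]
  | succ n ih =>
    have hm := measurable_walk hX.measurable x (n + 1)
    rw [aliveLaw_succ, ← ih, ← map_walk_succ hX, Measure.restrict_map hm .of_discrete,
      Measure.restrict_restrict (hm .of_discrete), aliveEvent_succ]

lemma walkLaw_real_singleton (hX : IsAdmissible P X) (n : ℕ) (y : ℤ) :
    (walkLaw (P.map (X 0)) n).real {y} = P.real {ω | walk X 0 n ω = y} := by
  have h1 : aliveEvent X Set.univ 0 n = Set.univ := Set.eq_univ_of_forall fun ω m _ _ => trivial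
  rw [walkLaw, ← map_walk hX, h1, Measure.restrict_univ, map_measureReal_apply
    (measurable_walk hX.measurable 0 n) .of_discrete]
  rfl

/-- The event that the walk from `x` is in `T` when it first is outside `D`. -/
def exitEvent (X : ℕ → Ω → ℤ) (D : Set ℤ) (x : ℤ) (T : Set ℤ) : Set Ω :=
  ⋃ n, (aliveEvent X D x n ∩ walk X x (n + 1) ⁻¹' (T ∩ Dᶜ))

lemma exitLaw_apply (hX : IsAdmissible P X) (D : Set ℤ) (x : ℤ) (T : Set ℤ) :
    exitLaw (P.map (X 0)) D x T = P (exitEvent X D x T) := by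
  have hm := fun n => measurable_walk hX.measurable x n
  have hA := measurableSet_aliveEvent hX.measurable D x
  rw [exitEvent, measure_iUnion]
  · rw [exitLaw, Measure.sum_apply _ .of_discrete]
    congr 1 with n
    rw [Measure.restrict_apply .of_discrete, ← map_walk hX, ← map_walk_succ hX,
      Measure.map_apply (hm _) .of_discrete, Measure.restrict_apply (hm _ .of_discrete),
      Set.inter_comm]
  · have hlt : ∀ n n', n < n' → Disjoint (aliveEvent X D x n ∩ walk X x (n + 1) ⁻¹' (T ∩ Dᶜ))
        (aliveEvent X D x n' ∩ walk X x (n' + 1) ⁻¹' (T ∩ Dᶜ)) := fun n n' h =>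
      Set.disjoint_left.2 fun ω h1 h2 => h1.2.2 (h2.1 _ (by omega) h)
    intro n n' h
    rcases h.lt_or_gt with h | h
    · exact hlt n n' h
    · exact (hlt n' n h).symm
  · exact fun n => (hA n).inter (hm _ .of_discrete)

lemma exitLaw_real (hX : IsAdmissible P X) (D : Set ℤ) (x : ℤ) (T : Set ℤ) :
    (exitLaw (P.map (X 0)) D x).real T = P.real (exitEvent X D x T) := by
  rw [measureReal_def, measureReal_def, exitLaw_apply hX]

lemma hitTime_lt_iff {x : ℤ} {B : Set ℤ} {ω : Ω} {t : ℕ∞} :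
    hitTime X x B ω < t ↔ ∃ n : ℕ, (1 ≤ n ∧ walk X x n ω ∈ B) ∧ (n : ℕ∞) < t := by
  simp only [hitTime, iInf_lt_iff, exists_prop]

lemma lt_hitTime_iff {x : ℤ} {B : Set ℤ} {ω : Ω} {n : ℕ} :
    (n : ℕ∞) < hitTime X x B ω ↔ ∀ m, 1 ≤ m → m ≤ n → walk X x m ω ∉ B := by
  rw [← not_iff_not, not_lt, ← ENat.lt_add_one_iff (ENat.natCast_ne_top n), hitTime_lt_iff]
  push Not
  refine exists_congr fun m => ?_
  rw [show ((n : ℕ∞) + 1) = ((n + 1 : ℕ) : ℕ∞) by push_cast; rfl, Nat.cast_lt, Nat.lt_succ_iff]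
  tauto

lemma hitTime_eq_iff {x : ℤ} {B : Set ℤ} {ω : Ω} {n : ℕ} :
    hitTime X x B ω = n ↔
      ∃ k, n = k + 1 ∧ ω ∈ aliveEvent X Bᶜ x k ∧ walk X x (k + 1) ω ∈ B := by
  constructor
  · intro h
    obtain ⟨m, ⟨hm1, hmB⟩, hm⟩ := hitTime_lt_iff.1
      (show hitTime X x B ω < ((n + 1 : ℕ) : ℕ∞) by rw [h]; exact_mod_cast Nat.lt_succ_self n)
    rw [Nat.cast_lt] at hm
    have hle : n ≤ m := by
      by_contra! hlt
      have : hitTime X x B ω < n := hitTime_lt_iff.2 ⟨m, ⟨hm1, hmB⟩, by exact_mod_cast hlt⟩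
      exact absurd h this.ne
    obtain rfl : m = n := by omega
    obtain ⟨k, rfl⟩ : ∃ k, m = k + 1 := ⟨m - 1, by omega⟩
    refine ⟨k, rfl, ?_, hmB⟩
    exact lt_hitTime_iff.1 (by rw [h]; exact_mod_cast Nat.lt_succ_self k)
  · rintro ⟨k, rfl, h1, h2⟩
    refine le_antisymm ?_ ?_
    · exact iInf₂_le (k + 1) ⟨by omega, h2⟩
    · have := lt_hitTime_iff.2 h1
      push_cast
      exact Order.add_one_le_of_lt this

lemma hitDist_eq (hX : IsAdmissible P X) (x : ℤ) {B : Set ℤ} {y : ℤ} (hy : y ∈ B) :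
    hitDist P X x B y = (exitLaw (P.map (X 0)) Bᶜ x).real {y} := by
  rw [exitLaw_real hX, hitDist]
  congr 1
  ext ω
  simp only [exitEvent, Set.mem_iUnion, Set.mem_ofPred_eq, hitTime_eq_iff]
  constructor
  · rintro ⟨_, ⟨k, rfl, h1, h2⟩, h3⟩
    exact ⟨k, h1, h3, by rwa [compl_compl]⟩
  · rintro ⟨k, h1, h2, -⟩
    have h2 : walk X x (k + 1) ω = y := h2
    exact ⟨k + 1, ⟨k, rfl, h1, by rwa [h2]⟩, h2⟩

lemma escapeProb_eq (hX : IsAdmissible P X) {Q R : ℕ} (hQ : 0 < Q) (hR : 0 < R) (x : ℤ) :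
    escapeProb P X Q R x = escape (P.map (X 0)) Q R x := by
  rw [escape, exitLaw_real hX, escapeProb]
  congr 1
  ext ω
  simp only [exitEvent, Set.mem_iUnion, Set.mem_ofPred_eq, hitTime_lt_iff, lt_hitTime_iff]
  constructor
  · intro h
    classical
    have h' : ∃ n, 1 ≤ n ∧ walk X x n ω ∈ (Set.Ioo (-(Q : ℤ)) R)ᶜ := by
      obtain ⟨n, h1, -⟩ := h
      exact ⟨n, h1⟩
    obtain ⟨n, ⟨h1, h2⟩, h3⟩ := h
    have hs := Nat.find_spec h'
    have hle : Nat.find h' ≤ n := Nat.find_min' h' ⟨h1, h2⟩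
    obtain ⟨k, hk⟩ : ∃ k, Nat.find h' = k + 1 := ⟨Nat.find h' - 1, by omega⟩
    rw [hk] at hs
    -- Before its first time outside the window the walk is inside it, and it has not visited `0`;
    -- so this is also its first exit from the window without `0`.
    refine ⟨k, fun m hm1 hmk => ⟨?_, h3 m hm1 (by omega)⟩, hs.2, fun h => hs.2 h.1⟩
    by_contra hmW
    exact Nat.find_min h' (show m < Nat.find h' by omega) ⟨hm1, hmW⟩
  · rintro ⟨k, h1, h2, -⟩
    refine ⟨k + 1, ⟨by omega, h2⟩, fun m hm1 hmk h0 => ?_⟩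
    rcases hmk.lt_or_eq with h3 | rfl
    · exact (h1 m hm1 (by omega)).2 h0
    · refine h2 ?_
      rw [show walk X x (k + 1) ω = 0 from h0]
      exact ⟨by omega, by omega⟩

lemma potential_eq (hX : IsAdmissible P X) (x : ℤ) : potential P X x = pot (P.map (X 0)) x := by
  rw [potential, pot]
  congr 1
  funext N
  rw [potSum, visits, visits, ← Finset.sum_sub_distrib]
  simp only [walkLaw_real_singleton hX, neg_zero]

lemma integral_map_step (hX : IsAdmissible P X) (f : ℤ → ℝ) :
    ∫ k, f k ∂(P.map (X 0)) = ∫ ω, f (X 0 ω) ∂P :=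
  integral_map (hX.measurable 0).aemeasurable (measurable_of_countable f).aestronglyMeasurable

lemma integrable_step (hX : IsAdmissible P X) :
    Integrable (fun k : ℤ => (k : ℝ)) (P.map (X 0)) :=
  (integrable_map_measure (measurable_of_countable _).aestronglyMeasurable
    (hX.measurable 0).aemeasurable).2 hX.integrable

lemma eta_eq_integral {Y : Ω → ℝ} (hY : Integrable Y P) (y : ℝ) :
    eta P Y y = ∫ ω, max (Y ω - y) 0 ∂P := by
  have hi : Integrable (fun ω => max (Y ω - y) 0) P :=
    (hY.sub (integrable_const y)).sup (integrable_const 0)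
  rw [hi.integral_eq_integral_meas_lt (Eventually.of_forall fun ω => le_max_right _ _), eta]
  have hpre : (· + y) ⁻¹' Set.Ioi y = Set.Ioi (0 : ℝ) := by ext t; simp
  rw [← (measurePreserving_add_right volume y).setIntegral_preimage_emb
    (MeasurableEquiv.addRight y).measurableEmbedding _ _, hpre]
  refine setIntegral_congr_fun measurableSet_Ioi fun t ht => ?_
  have ht : 0 < t := ht
  simp only [tail]
  congr 1
  ext ω
  simp only [Set.mem_ofPred_eq, lt_max_iff, lt_sub_iff_add_lt, ht.not_gt, or_false]

/-- The derivative of `hubMean` at `y` is the mean of `(g(X) - y)^+` for `y ≥ 0`, which is the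
integrated tail by the layer-cake formula. This identifies `m_+` and `m_-` with their definitions as
means. -/
lemma doubleTail_eq (hX : IsAdmissible P X) {g : ℤ → ℝ} (hg : ∀ k : ℤ, |g k| ≤ |(k : ℝ)|) {x : ℝ}
    (hx : 0 ≤ x) :
    doubleTail P (fun ω => g (X 0 ω)) x = hubMean (P.map (X 0)) (fun k => max (g k) 0) x := by
  have := isProbabilityMeasure_map hX
  have hξ := integrable_step hX
  have h0 : ∀ k, 0 ≤ max (g k) 0 := fun k => le_max_right _ _
  have h1 : ∀ k : ℤ, max (g k) 0 ≤ |(k : ℝ)| := fun k =>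
    max_le ((le_abs_self _).trans (hg k)) (abs_nonneg _)
  have hgi : Integrable (fun ω => g (X 0 ω)) P :=
    (integrable_map_measure (measurable_of_countable g).aestronglyMeasurable
      (hX.measurable 0).aemeasurable).1
      (integrable_of_le_abs hξ 1 fun k => by rw [one_mul]; exact hg k)
  have hanti : Antitone fun y => ∫ k, max (max (g k) 0 - y) 0 ∂(P.map (X 0)) := fun a b hab =>
    integral_mono (integrable_max_sub hξ h0 h1 b) (integrable_max_sub hξ h0 h1 a) fun k =>
      max_le_max (by linarith) le_rfl
  have h2 := intervalIntegral.integral_eq_sub_of_hasDerivAt (a := 0) (b := x)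
    (fun y _ => hasDerivAt_hubMean hξ h0 h1 y) hanti.intervalIntegrable
  rw [hubMean_zero h0, sub_zero] at h2
  rw [← h2, doubleTail]
  refine intervalIntegral.integral_congr fun y hy => ?_
  rw [Set.uIcc_of_le hx] at hy
  rw [eta_eq_integral hgi, integral_map_step hX fun k => max (max (g k) 0 - y) 0]
  refine integral_congr_ae (Eventually.of_forall fun ω => ?_)
  dsimp only
  rcases le_total (g (X 0 ω)) 0 with h | h
  · rw [max_eq_right h, max_eq_right (by linarith [hy.1]), max_eq_right (by linarith [hy.1])]
  · rw [max_eq_left h]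

lemma isStepLaw_map (hX : IsAdmissible P X)
    (hm : Tendsto (fun x : ℝ => mPlus P X x / mTotal P X x) atTop (𝓝 0)) :
    IsStepLaw (P.map (X 0)) where
  integrable := integrable_step hX
  mean_zero := by rw [integral_map_step hX]; exact hX.mean_zero
  sq_infinite := by
    rw [lintegral_map (measurable_of_countable _) (hX.measurable 0)]
    exact hX.sq_infinite
  irreducible := fun y => by
    have := isProbabilityMeasure_map hX
    obtain ⟨n, hn⟩ := hX.irreducible 0 y
    refine ⟨n, ?_⟩
    have h1 : 0 < (walkLaw (P.map (X 0)) n).real {y} := by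
      rw [walkLaw_real_singleton hX]
      exact ENNReal.toReal_pos hn.ne' (measure_ne_top _ _)
    exact (ENNReal.toReal_pos_iff.1 h1).1
  small_plus := by
    have := isProbabilityMeasure_map hX
    refine hm.congr' ?_
    filter_upwards [eventually_ge_atTop 0] with x hx
    have h1 : mPlus P X x = bigMp (P.map (X 0)) x :=
      doubleTail_eq hX (g := fun k => (k : ℝ)) (fun _ => le_rfl) hx
    have h2 : mMinus P X x = bigMm (P.map (X 0)) x :=
      doubleTail_eq hX (g := fun k => -(k : ℝ)) (fun _ => (abs_neg _).le) hx
    rw [mTotal, h1, h2, bigM_eq_add (integrable_step hX) hx]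

end

end RandomWalk

theorem mainTheorem10 {Ω : Type*} [MeasurableSpace Ω] (P : Measure Ω) [IsProbabilityMeasure P]
    (X : ℕ → Ω → ℤ) (hX : RandomWalk.IsAdmissible P X)
    (hm : Tendsto (fun x : ℝ => RandomWalk.mPlus P X x / RandomWalk.mTotal P X x)
      atTop (𝓝 0)) :
    ∀ ε : ℝ, 0 < ε → ∃ δ : ℝ, 0 < δ ∧ ∃ N : ℕ, ∀ Q R : ℕ, 0 < Q → 0 < R → N ≤ min Q R →
      ∀ x : ℤ, -(Q : ℤ) < x → x < (R : ℤ) →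
        RandomWalk.potentialDagger P X x ≠ 0 →
        |RandomWalk.potential P X Q - RandomWalk.potential P X (x + Q)|
            + |RandomWalk.potential P X (-R) - RandomWalk.potential P X (x - R)|
          ≤ δ * |RandomWalk.potentialDagger P X x| →
        |RandomWalk.escapeProb P X Q R x /
            (RandomWalk.potentialDagger P X x *
              (1 - RandomWalk.hitDist P X 0 {-(Q : ℤ), 0, (R : ℤ)} 0)) - 1| < ε ∧
        |RandomWalk.potentialDagger P X x *
              (1 - RandomWalk.hitDist P X 0 {-(Q : ℤ), 0, (R : ℤ)} 0) /
            (RandomWalk.potentialDagger P X x *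
              (RandomWalk.potential P X ((Q : ℤ) + R) /
                (RandomWalk.potential P X Q * RandomWalk.potential P X R))) - 1| < ε := by
  have := RandomWalk.isProbabilityMeasure_map hX
  intro ε hε
  obtain ⟨δ, hδ, N, h⟩ := RandomWalk.escape_asymptotics (RandomWalk.isStepLaw_map hX hm) ε hε
  refine ⟨δ, hδ, N, fun Q R hQ hR hN x hxQ hxR hx hc => ?_⟩
  have hd : RandomWalk.potentialDagger P X x = RandomWalk.potDagger (P.map (X 0)) x := by
    rw [RandomWalk.potentialDagger, RandomWalk.potDagger, RandomWalk.potential_eq hX]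
  have hh : RandomWalk.hitDist P X 0 {-(Q : ℤ), 0, (R : ℤ)} 0 =
      RandomWalk.hitZero (P.map (X 0)) Q R 0 := RandomWalk.hitDist_eq hX 0 (by simp)
  rw [hd] at hx
  simp only [RandomWalk.potential_eq hX, hd] at hc
  simp only [RandomWalk.potential_eq hX, hd, hh, RandomWalk.escapeProb_eq hX hQ hR]
  exact h Q R hQ hR hN x hxQ hxR hx hc
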